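/- **Setting.** Let $m,n\ge 0$. Let $\varphi_m=(\varphi_m^{\mu\nu}(u,v))_{1\le\mu,\nu\le m}$ and $\varphi_n=(\varphi_n^{ij}(a,b))_{1\le i,j\le n}$ be formal power series over $\mathbb R$ in two groups of $m$, respectively $n$, variables, which are skew: $\varphi^{ij}(u,v)=-\varphi^{ji}(v,u)$. For such a $\varphi$ (in dimension $n$; similarly in dimension $m$) put, with summation over repeated indices, $$\begin{aligned}\Phi^{ijk}(u,v,w)={}&\varphi^{ks}(w,u)\tfrac{\partial\varphi^{ij}(u,v)}{\partial u^s}+\varphi^{sk}(v,w)\tfrac{\partial\varphi^{ji}(v,u)}{\partial v^s}+\varphi^{is}(u,v)\tfrac{\partial\varphi^{jk}(v,w)}{\partial v^s}\\&+\varphi^{si}(w,u)\tfrac{\partial\varphi^{kj}(w,v)}{\partial w^s}+\varphi^{js}(v,w)\tfrac{\partial\varphi^{ki}(w,u)}{\partial w^s}+\varphi^{sj}(u,v)\tfrac{\partial\varphi^{ik}(u,w)}{\partial u^s}.\end{aligned}$$ The classical Yang–Baxter equation (CYBE) is $\Phi=0$. Let $J^\infty(\mathbb R^m,\mathbb R^n)$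 be the formal manifold of formal maps $F^i(u)=\sum_I f^i_Iu^I$ ($1\le i\le n$, $I\in\mathbb Z_{\ge0}^m$), with coordinates $f^i_I$ of degree $|I|$. Its algebra of functions is $\mathcal A=\bigoplus_k\mathcal A_k$, the formal power series in the $f^i_I$ with finitely many nonzero homogeneous components. On it consider the biderivation whose values $\{f^i_I,f^j_J\}$ are the coefficients of $u^Iv^J$ in $\{F^i(u),F^j(v)\}=\Pi^{ij}$, where $$\Pi^{ij}(j^\infty_uF,j^\infty_vF)=(F_{*u})^i_\mu(F_{*v})^j_\nu\,\varphi_m^{\mu\nu}(u,v)-\varphi_n^{ij}(F(u),F(v)).$$ **Proposition.** 1. All brackets $\{F^i(u),F^j(v)\}$ and $\{\{F^i(u),F^j(v)\},F^k(w)\}$ are given by locally finite sums of formal power series, and for all $i,j,k$ the Jacobi identity $$\{\{F^i(u),F^j(v)\},F^k(w)\}+\{\{F^k(w),F^i(u)\},F^j(v)\}+\{\{F^j(v),F^k(w)\},F^i(u)\}=0$$ holds, as an identity of power series in $u,v,w$ and the coordinates $f^i_I$, if and only if $$\Phi_n^{ijk}(F(u),F(v),F(w))=(F_{*u})^i_\mu(F_{*v})^j_\nu(F_{*w})^k_\sigma\,\Phi_m^{\mu\nu\sigma}(u,v,w).\qquad(*)$$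 Moreover $\Pi$ is Poisson (it makes $\mathcal A$ a Poisson algebra) if and only if $(*)$ holds for all $i,j,k$. 2. Suppose $\varphi_m$ and $\varphi_n$ both solve the CYBE. Then $\Pi$ is a Poisson structure on $J^\infty(\mathbb R^m,\mathbb R^n)$. So are $\Omega_n$ and $\Omega_m$, defined in the coordinates of $FDiff(\mathbb R^n)$ and $FDiff(\mathbb R^m)$ by $$\Omega_n^{ij}(j^\infty_aY,j^\infty_bY)=(Y_{*a})^i_k(Y_{*b})^j_l\varphi_n^{kl}(a,b)-\varphi_n^{ij}(Y(a),Y(b))$$ and the same formula for $\varphi_m$. With respect to these structures the left–right action $F\mapsto\overline F=Y\circ F\circ X^{-1}$ of $FDiff(\mathbb R^n)\times FDiff(\mathbb R^m)$ is Poisson: the action map $(Y,X,F)\mapsto\overline F$ respects the brackets, where the source carries the product of $\{Y^i(a),Y^j(b)\}=\Omega_n^{ij}(j^\infty_aY,j^\infty_bY)$, of $\{(X^{-1})^\sigma(u),(X^{-1})^\rho(v)\}=\Omega_m^{\sigma\rho}(j^\infty_uX^{-1},j^\infty_vX^{-1})$, and of $\Pi$. Moreover the equation $$\begin{aligned}\Pi^{ij}(j^\infty_u\overline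 F,j^\infty_v\overline F)={}&(Y_{*a})^i_k(Y_{*b})^j_l\,\Pi^{kl}(j^\infty_{u'}F,j^\infty_{v'}F)\\&+(Y_{*a})^i_k(F_{*u'})^k_\sigma(Y_{*b})^j_l(F_{*v'})^l_\rho\,\Omega_m^{\sigma\rho}(j^\infty_uX^{-1},j^\infty_vX^{-1})+\Omega_n^{ij}(j^\infty_aY,j^\infty_bY),\end{aligned}$$ with $u'=X^{-1}(u)$, $v'=X^{-1}(v)$, $a=F(u')$, $b=F(v')$, holds for all formal diffeomorphisms $X,Y$ and formal maps $F$ with coefficients in any commutative $\mathbb R$-algebra and nilpotent constant terms. -/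

import Mathlib

universe u

noncomputable section

namespace JetPoisson

open MvPowerSeries

/-! ### Locally finite sums of formal power series -/

/-- A family of power series is formally summable if every monomial occurs in only finitely many
members of the family. -/
def FormallySummable {κ T : Type} (t : κ → MvPowerSeries T ℝ) : Prop :=
  ∀ d : T →₀ ℕ, {x : κ | coeff d (t x) ≠ 0}.Finite

/-- The coefficientwise sum of a formally summable family. -/
def formalSum {κ T : Type} (t : κ → MvPowerSeries T ℝ) : MvPowerSeries T ℝ :=
  fun d => ∑ᶠ x : κ, coeff d (t x)

/-! ### Two-point tensors `φ^{ij}(u,v) ∈ ℝ[[u,v]]` and the Yang-Baxter expression -/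

/-- `n²` formal power series `φ^{ij}(u,v)` in `u = (u^1, …, u^n)` (left variables) and
`v = (v^1, …, v^n)` (right variables). -/
abbrev TwoTensor (n : ℕ) : Type := Fin n → Fin n → MvPowerSeries (Fin n ⊕ Fin n) ℝ

/-- `φ^{ij}(a,b)`: substitution of `u = a`, `v = b`. -/
def TwoTensor.at {n : ℕ} {T : Type} {R : Type*} [CommRing R] [Algebra ℝ R]
    (φ : TwoTensor n) (i j : Fin n) (a b : Fin n → MvPowerSeries T R) : MvPowerSeries T R :=
  subst (Sum.elim a b) (φ i j)

/-- `φ^{ij}(u,v) = -φ^{ji}(v,u)`. -/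
def TwoTensor.IsSkew {n : ℕ} (φ : TwoTensor n) : Prop :=
  ∀ i j : Fin n, φ i j = -φ.at j i (fun l => X (Sum.inr l)) (fun l => X (Sum.inl l))

/-- The `r`-th of the three points `u, v, w` (for `r = 0, 1, 2`), in the ring `ℝ[[u,v,w]]`. -/
def slot {n : ℕ} (r : Fin 3) : Fin n → MvPowerSeries (Fin 3 × Fin n) ℝ := fun l => X (r, l)

/-- The left-hand side `Φ^{ijk}(u,v,w)` of the classical Yang-Baxter equation. -/
def TwoTensor.Phi {n : ℕ} (φ : TwoTensor n) (i j k : Fin n) :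
    MvPowerSeries (Fin 3 × Fin n) ℝ :=
  let u : Fin n → MvPowerSeries (Fin 3 × Fin n) ℝ := slot 0
  let v : Fin n → MvPowerSeries (Fin 3 × Fin n) ℝ := slot 1
  let w : Fin n → MvPowerSeries (Fin 3 × Fin n) ℝ := slot 2
  ∑ s : Fin n,
    (φ.at k s w u * pderiv ℝ (0, s) (φ.at i j u v) + φ.at s k v w * pderiv ℝ (1, s) (φ.at j i v u)
      + φ.at i s u v * pderiv ℝ (1, s) (φ.at j k v w) + φ.at s i w u * pderiv ℝ (2, s) (φ.at k j w v)
      + φ.at j s v w * pderiv ℝ (2, s) (φ.at k i w u) + φ.at s j u v * pderiv ℝ (0, s) (φ.at i k u w))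

/-- `φ` is a (skew-symmetric) solution of the classical Yang-Baxter equation for the Lie algebra
of formal vector fields on `ℝⁿ`. -/
def TwoTensor.IsCYBESolution {n : ℕ} (φ : TwoTensor n) : Prop :=
  φ.IsSkew ∧ ∀ i j k : Fin n, φ.Phi i j k = 0

/-! ### The jet space as a formal graded manifold and its generic point -/

/-- The coordinates `f^i_I` (`i ≤ n`, `I` a multi-index in `m` variables) on the space
`J^∞(ℝ^m, ℝ^n)` of formal maps `F^i(u) = ∑_I f^i_I u^I`. For `m = n` these are also the
coordinates on `FDiff(ℝⁿ)`. -/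
abbrev Coord (m n : ℕ) : Type := Fin n × (Fin m →₀ ℕ)

/-- The `f^i_I`-monomial `d` has degree `∑ |I|`, summed over its factors `f^i_I`. -/
def weight {m n : ℕ} (d : Coord m n →₀ ℕ) : ℕ := d.sum fun p e => e * p.2.degree

/-- The graded algebra `⨁_k 𝒜_k` of functions on the jet space: formal power series in the `f^i_I`
with only finitely many nonzero homogeneous components, where `f^i_I` has degree `|I|`. -/
def Functions (m n : ℕ) : Set (MvPowerSeries (Coord m n) ℝ) :=
  {a | ∃ k : ℕ, ∀ d : Coord m n →₀ ℕ, coeff d a ≠ 0 → weight d ≤ k}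

/-- The generic formal map `F^i(a) = ∑_I f^i_I a^I` at the point `a`; the variable `c (i, I)` plays
the role of the coordinate `f^i_I`. -/
def genericMap {m n : ℕ} {T : Type} (c : Coord m n → T) (a : Fin m → MvPowerSeries T ℝ) :
    Fin n → MvPowerSeries T ℝ :=
  fun i => formalSum fun I : Fin m →₀ ℕ => X (c (i, I)) * ∏ μ : Fin m, a μ ^ I μ

/-- The variables: the coordinates `f^i_I` together with `k` points of `ℝ^m`. -/
abbrev Vars (m n k : ℕ) : Type := Coord m n ⊕ (Fin k × Fin m)

/-- The `r`-th point of `ℝ^m`. -/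
def point (m n : ℕ) {k : ℕ} (r : Fin k) : Fin m → MvPowerSeries (Vars m n k) ℝ :=
  fun μ => X (Sum.inr (r, μ))

/-- `F^i(u)`, where `F` is the generic formal map and `u` is the `r`-th point. -/
def jet (m n : ℕ) {k : ℕ} (r : Fin k) : Fin n → MvPowerSeries (Vars m n k) ℝ :=
  genericMap Sum.inl (point m n r)

/-- `(F_{*u})^i_μ = ∂F^i(u)/∂u^μ`, where `u` is the `r`-th point. -/
def jetDeriv (m n : ℕ) {k : ℕ} (r : Fin k) (i : Fin n) (μ : Fin m) :
    MvPowerSeries (Vars m n k) ℝ :=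
  pderiv ℝ (Sum.inr (r, μ)) (jet m n r i)

/-- The tensor `Π^{ij}(j^∞_u F, j^∞_v F) = (F_{*u})^i_μ (F_{*v})^j_ν φ_m^{μν}(u,v) - φ_n^{ij}(F(u),F(v))`
at the generic formal map `F`, where `u` and `v` are the `r`-th and `s`-th points. -/
def tensorPi {m n : ℕ} (φm : TwoTensor m) (φn : TwoTensor n) {k : ℕ} (r s : Fin k)
    (i j : Fin n) : MvPowerSeries (Vars m n k) ℝ :=
  (∑ μ : Fin m, ∑ ν : Fin m,
      jetDeriv m n r i μ * jetDeriv m n s j ν * φm.at μ ν (point m n r) (point m n s))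
    - φn.at i j (jet m n r) (jet m n s)

/-- The components `ω^{{i,I}{j,J}}`: the coefficient of `u^I v^J` in `Π^{ij}`, a power series in
the coordinates. -/
def components {m n : ℕ} (φm : TwoTensor m) (φn : TwoTensor n) (p q : Coord m n) :
    MvPowerSeries (Coord m n) ℝ :=
  fun d => coeff (Finsupp.sumElim d
      (p.2.mapDomain (fun μ => ((0 : Fin 2), μ)) + q.2.mapDomain (fun μ => ((1 : Fin 2), μ))))
    (tensorPi φm φn (0 : Fin 2) 1 p.1 q.1)

/-! ### Poisson brackets -/

/-- The terms `∂a/∂x^p · ∂b/∂x^q · ω^{pq}(x)` of the bracket of `a` and `b`. The variable `c p`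
plays the role of the coordinate `x^p`; all other variables are constants for the bracket. -/
def bracketTerm {C T : Type} (c : C → T) (ω : C → C → MvPowerSeries C ℝ)
    (a b : MvPowerSeries T ℝ) : C × C → MvPowerSeries T ℝ :=
  fun p => pderiv ℝ (c p.1) a * pderiv ℝ (c p.2) b * subst (fun x => (X (c x) : MvPowerSeries T ℝ)) (ω p.1 p.2)

/-- `{a, b} = ∑_{p,q} ∂a/∂x^p · ∂b/∂x^q · ω^{pq}(x)`. -/
def bracket {C T : Type} (c : C → T) (ω : C → C → MvPowerSeries C ℝ)
    (a b : MvPowerSeries T ℝ) : MvPowerSeries T ℝ :=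
  formalSum (bracketTerm c ω a b)

/-- The biderivation with components `ω` is a Poisson bracket on the algebra of functions. -/
structure IsPoisson {m n : ℕ} (ω : Coord m n → Coord m n → MvPowerSeries (Coord m n) ℝ) :
    Prop where
  summable : ∀ a ∈ Functions m n, ∀ b ∈ Functions m n, FormallySummable (bracketTerm id ω a b)
  mem : ∀ a ∈ Functions m n, ∀ b ∈ Functions m n, bracket id ω a b ∈ Functions m n
  add : ∀ a ∈ Functions m n, ∀ b ∈ Functions m n, ∀ c ∈ Functions m n,
    bracket id ω (a + b) c = bracket id ω a c + bracket id ω b c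
  smul : ∀ t : ℝ, ∀ a ∈ Functions m n, ∀ b ∈ Functions m n,
    bracket id ω (t • a) b = t • bracket id ω a b
  skew : ∀ a ∈ Functions m n, ∀ b ∈ Functions m n, bracket id ω a b = -bracket id ω b a
  leibniz : ∀ a ∈ Functions m n, ∀ b ∈ Functions m n, ∀ c ∈ Functions m n,
    bracket id ω (a * b) c = a * bracket id ω b c + bracket id ω a c * b
  jacobi : ∀ a ∈ Functions m n, ∀ b ∈ Functions m n, ∀ c ∈ Functions m n,
    bracket id ω (bracket id ω a b) c + bracket id ω (bracket id ω c a) b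
      + bracket id ω (bracket id ω b c) a = 0

/-- The components of the natural product Poisson structure. -/
def productComponents {C D : Type} (ω : C → C → MvPowerSeries C ℝ)
    (η : D → D → MvPowerSeries D ℝ) : C ⊕ D → C ⊕ D → MvPowerSeries (C ⊕ D) ℝ
  | Sum.inl p, Sum.inl q => subst (fun x => (X (Sum.inl x) : MvPowerSeries (C ⊕ D) ℝ)) (ω p q)
  | Sum.inr p, Sum.inr q => subst (fun x => (X (Sum.inr x) : MvPowerSeries (C ⊕ D) ℝ)) (η p q)
  | _, _ => 0

/-- The map from a formal manifold with coordinates `C` to the jet space which is given in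
coordinates by `f^p = z p` respects the brackets with components `Ω` (source) and `ω` (target):
`z^*{a,b} = {z^*a, z^*b}`, where `z^*` is substitution of the `z p` for the coordinates. -/
def IsPoissonMap {C : Type} {m n : ℕ} (Ω : C → C → MvPowerSeries C ℝ)
    (ω : Coord m n → Coord m n → MvPowerSeries (Coord m n) ℝ)
    (z : Coord m n → MvPowerSeries C ℝ) : Prop :=
  HasSubst z ∧ ∀ a ∈ Functions m n, ∀ b ∈ Functions m n,
    FormallySummable (bracketTerm id Ω (subst z a) (subst z b)) ∧
      bracket id Ω (subst z a) (subst z b) = subst z (bracket id ω a b)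

/-! ### The Jacobi identity and the push-forward condition -/

/-- All infinite sums in the brackets `{F^i(u),F^j(v)}` and `{{F^i(u),F^j(v)},F^k(w)}` are locally
finite, and `{F^i(u),F^j(v)} = Π^{ij}(j^∞_u F, j^∞_v F)`, for distinct points `u, v, w`. -/
def BracketRepresentsPi {m n : ℕ} (φm : TwoTensor m) (φn : TwoTensor n) : Prop :=
  ∀ r s t : Fin 3, r ≠ s → s ≠ t → r ≠ t → ∀ i j k : Fin n,
    FormallySummable (bracketTerm Sum.inl (components φm φn) (jet m n r i) (jet m n s j)) ∧
    bracket Sum.inl (components φm φn) (jet m n r i) (jet m n s j) = tensorPi φm φn r s i j ∧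
    FormallySummable (bracketTerm Sum.inl (components φm φn)
      (bracket Sum.inl (components φm φn) (jet m n r i) (jet m n s j)) (jet m n t k))

/-- The Jacobi identity
`{{F^i(u),F^j(v)},F^k(w)} + {{F^k(w),F^i(u)},F^j(v)} + {{F^j(v),F^k(w)},F^i(u)} = 0`. -/
def JacobiIdentity {m n : ℕ} (φm : TwoTensor m) (φn : TwoTensor n) (i j k : Fin n) : Prop :=
  let br : MvPowerSeries (Vars m n 3) ℝ → MvPowerSeries (Vars m n 3) ℝ →
      MvPowerSeries (Vars m n 3) ℝ := bracket Sum.inl (components φm φn)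
  br (br (jet m n 0 i) (jet m n 1 j)) (jet m n 2 k)
    + br (br (jet m n 2 k) (jet m n 0 i)) (jet m n 1 j)
    + br (br (jet m n 1 j) (jet m n 2 k)) (jet m n 0 i) = 0

/-- `Φ_n^{ijk}(F(u),F(v),F(w)) = (F_{*u})^i_μ (F_{*v})^j_ν (F_{*w})^k_σ Φ_m^{μνσ}(u,v,w)`. -/
def PushForwardIdentity {m n : ℕ} (φm : TwoTensor m) (φn : TwoTensor n) (i j k : Fin n) : Prop :=
  subst (fun p : Fin 3 × Fin n => (jet m n p.1 p.2 : MvPowerSeries (Vars m n 3) ℝ)) (φn.Phi i j k)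
    = ∑ μ : Fin m, ∑ ν : Fin m, ∑ σ : Fin m,
        jetDeriv m n (0 : Fin 3) i μ * jetDeriv m n 1 j ν * jetDeriv m n 2 k σ
          * subst (fun p : Fin 3 × Fin m => (point m n p.1 p.2 : MvPowerSeries (Vars m n 3) ℝ))
              (φm.Phi μ ν σ)

/-! ### The left-right action `F ↦ Y ∘ F ∘ X⁻¹` -/

/-- The coordinates on `FDiff(ℝⁿ) × FDiff(ℝ^m) × J^∞(ℝ^m, ℝⁿ)`: those of `Y`, of `X⁻¹`, of `F`. -/
abbrev ActionCoord (m n : ℕ) : Type := (Coord n n ⊕ Coord m m) ⊕ Coord m n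

/-- The action map in coordinates: the coefficient of `u^I` in `(Y ∘ F ∘ X⁻¹)^i(u)`, where `Y`,
`X⁻¹` and `F` are generic. -/
def actionMap (m n : ℕ) (p : Coord m n) : MvPowerSeries (ActionCoord m n) ℝ :=
  let u : Fin m → MvPowerSeries (ActionCoord m n ⊕ Fin m) ℝ := fun μ => X (Sum.inr μ)
  let Xinv : Fin m → MvPowerSeries (ActionCoord m n ⊕ Fin m) ℝ :=
    genericMap (fun q : Coord m m => Sum.inl (Sum.inl (Sum.inr q))) u
  let FXinv : Fin n → MvPowerSeries (ActionCoord m n ⊕ Fin m) ℝ :=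
    genericMap (fun q : Coord m n => Sum.inl (Sum.inr q)) Xinv
  let YFXinv : Fin n → MvPowerSeries (ActionCoord m n ⊕ Fin m) ℝ :=
    genericMap (fun q : Coord n n => Sum.inl (Sum.inl (Sum.inl q))) FXinv
  fun d => coeff (Finsupp.sumElim d p.2) (YFXinv p.1)

/-- `F(a)`, for a formal map `F` with coefficients in `R`. -/
def evalAt {m n : ℕ} {T : Type} {R : Type*} [CommRing R] (F : Fin n → MvPowerSeries (Fin m) R)
    (a : Fin m → MvPowerSeries T R) : Fin n → MvPowerSeries T R :=
  fun i => subst a (F i)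

/-- `(F_{*a})^i_μ`, for a formal map `F` with coefficients in `R`. -/
def derivAt {m n : ℕ} {T : Type} {R : Type*} [CommRing R] (F : Fin n → MvPowerSeries (Fin m) R)
    (a : Fin m → MvPowerSeries T R) (i : Fin n) (μ : Fin m) : MvPowerSeries T R :=
  subst a (pderiv R μ (F i))

/-- `Π^{ij}(j^∞_a F, j^∞_b F)`, for a formal map `F` with coefficients in `R`. -/
def tensorPiAt {m n : ℕ} {T : Type} {R : Type*} [CommRing R] [Algebra ℝ R]
    (φm : TwoTensor m) (φn : TwoTensor n) (F : Fin n → MvPowerSeries (Fin m) R)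
    (a b : Fin m → MvPowerSeries T R) (i j : Fin n) : MvPowerSeries T R :=
  (∑ μ : Fin m, ∑ ν : Fin m, derivAt F a i μ * derivAt F b j ν * φm.at μ ν a b)
    - φn.at i j (evalAt F a) (evalAt F b)

/-- The points of the formal jet space with coefficients in `R`: formal maps whose constant terms
are infinitesimal (nilpotent), so that all compositions are defined. -/
structure FormalMap (m n : ℕ) (R : Type*) [CommRing R] where
  toFun : Fin n → MvPowerSeries (Fin m) R
  nilpotent : ∀ i : Fin n, IsNilpotent (constantCoeff (toFun i))

/-- The group `FDiff(ℝⁿ)` of formal diffeomorphisms with coefficients in `R`: formal maps with an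
inverse `invMap` for composition. -/
structure FDiff (n : ℕ) (R : Type*) [CommRing R] extends FormalMap n n R where
  invMap : FormalMap n n R
  right_inv : evalAt toFun invMap.toFun = X
  left_inv : evalAt invMap.toFun toFun = X

/-- The equation expressing, for `Fbar = Y ∘ F ∘ X⁻¹`, the tensor `Π` at `Fbar` through `Π` at `F`,
`Ω_m` at `X⁻¹` and `Ω_n` at `Y`:
`Π(Fbar)(u,v) = Y_* Y_* Π(F)(X⁻¹(u), X⁻¹(v)) + Y_* F_* Y_* F_* Ω_m(X⁻¹)(u,v) + Ω_n(Y)(F(X⁻¹(u)), F(X⁻¹(v)))`,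
for all points with coefficients in `R`. -/
def ActionEquation {m n : ℕ} (φm : TwoTensor m) (φn : TwoTensor n) (R : Type*) [CommRing R]
    [Algebra ℝ R] : Prop :=
  ∀ (Xd : FDiff m R) (Y : FDiff n R) (F : FormalMap m n R) (i j : Fin n),
    let u : Fin m → MvPowerSeries (Fin m ⊕ Fin m) R := fun μ => X (Sum.inl μ)
    let v : Fin m → MvPowerSeries (Fin m ⊕ Fin m) R := fun μ => X (Sum.inr μ)
    let Xinv : Fin m → MvPowerSeries (Fin m) R := Xd.invMap.toFun
    let Fbar : Fin n → MvPowerSeries (Fin m) R := evalAt Y.toFun (evalAt F.toFun Xinv)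
    let u' := evalAt Xinv u
    let v' := evalAt Xinv v
    let a := evalAt F.toFun u'
    let b := evalAt F.toFun v'
    tensorPiAt φm φn Fbar u v i j =
      (∑ k : Fin n, ∑ l : Fin n,
        derivAt Y.toFun a i k * derivAt Y.toFun b j l * tensorPiAt φm φn F.toFun u' v' k l)
      + (∑ k : Fin n, ∑ l : Fin n, ∑ σ : Fin m, ∑ ρ : Fin m,
          derivAt Y.toFun a i k * derivAt F.toFun u' k σ
            * (derivAt Y.toFun b j l * derivAt F.toFun v' l ρ)
            * tensorPiAt φm φm Xinv u v σ ρ)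
      + tensorPiAt φn φn Y.toFun a b i j

/-- The left-right action of `(FDiff(ℝⁿ), Ω_n) × (FDiff(ℝ^m), Ω_m)` on `(J^∞(ℝ^m,ℝⁿ), Π)` is
Poisson: the action map respects the brackets of the product structure and of `Π`, and the
corresponding equation holds at all points. Here `Ω_n` and `Ω_m` have the components
`components φn φn` and `components φm φm`, and the bracket on `FDiff(ℝ^m)` is
`{(X⁻¹)^σ(u), (X⁻¹)^ρ(v)} = Ω_m^{σρ}(j^∞_u X⁻¹, j^∞_v X⁻¹)`. -/
def IsPoissonAction {m n : ℕ} (φm : TwoTensor m) (φn : TwoTensor n) : Prop :=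
  IsPoissonMap
      (productComponents (productComponents (components φn φn) (components φm φm))
        (components φm φn))
      (components φm φn) (actionMap m n) ∧
    ∀ (R : Type u) [CommRing R] [Algebra ℝ R], ActionEquation φm φn R

end JetPoisson

end

noncomputable section

namespace JetPoisson

open MvPowerSeries

/-! ### Additive maps whose coefficients depend on finitely many coefficients -/

section Local

variable {S T T' R : Type*} [CommRing R]

/-! The proof treats $\Pi$ as the generating series of the bracket. If $\partial A/\partial
f^k_I=M_k\,a^I$ and $\partial B/\partial f^l_J=N_l\,b^J$ for all $I,J$, then summing the components
against $a^Ib^J$ gives $\{A,B\}=M_kN_l\Pi^{kl}(a,b)$ (`IsGrading.br_generic`). Every bracket of an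
explicit map in the file comes from this formula, together with naturality of $\Pi$ under
substitution (`subst_evPi`, `hasFSum_evPi`).

Convergence rests on a filtration. With weight $|I|$ for $f^i_I$ and $-1$ for the point variables,
$F(u)$ has weight $0$ and $F_{*u}$ weight $1$, so $\Pi$ has weight at most $2$ and the component at
$(i,I),(j,J)$ at most $|I|+|J|+2$ (`bdd_components`). A derivative by $f^i_I$ lowers weight by
$|I|$, hence only finitely many derivatives of a bounded series reach a given coefficient, and
brackets of bounded series are again bounded. Identities for infinite sums are transported by
additive maps each of whose output coefficients depends on finitely many input coefficients
(`LocalFun.ext`, `HasFSum.map`).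

For the Jacobi identity, $\{\partial_\mu F^i(u),F^k(w)\}=\partial_{u^\mu}\Pi^{ik}(u,w)$ because the
bracket commutes with differentiation by a parameter. The double bracket
$\{\{F^i(u),F^j(v)\},F^k(w)\}$ is then a difference of two halves, one for each inner point
(`jetBr_tensorPi`). Each half consists of a part symmetric in the other two points, a push-forward
of a term of $\Phi_m$, and a term of $\Phi_n$ at the images (`halfBr_eq`). In the cyclic sum the
symmetric parts cancel in pairs, and what remains is the push-forward of $\Phi_m$ minus
$\Phi_n(F(u),F(v),F(w))$ (`jac_jet`). The Jacobiator is a derivation in each argument, since it is a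
commutator of Hamiltonian vector fields minus a Hamiltonian vector field (`IsGrading.hasFSum_jac`).
So its values on jets, on coordinates and on all functions vanish together
(`jac_coords_eq_zero_iff`, `IsGrading.jac_eq_zero`).

The action equation is the chain rule followed by a telescoping sum (`tensor_comp`). The same
telescoping, applied to the three brackets on the source, shows that the bracket of $Y\circ F\circ
X^{-1}$ at two points is $\Pi$ at the composite (`br_act_pt`). Comparing coefficients gives the
Poisson property on coordinates (`br_actionMap`). A function of bounded weight involves finitely
many coordinates, so a finite chain rule extends this to all functions. -/

/-- An additive functional on power series which only depends on finitely many coefficients. -/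
def LocalFun {M : Type*} [AddCommGroup M] (L : MvPowerSeries S R →+ M) : Prop :=
  ∃ s : Finset (S →₀ ℕ), ∀ a, (∀ e ∈ s, coeff e a = 0) → L a = 0

/-- An additive map between power series rings, each of whose output coefficients depends only on
finitely many input coefficients. -/
def IsLocal (L : MvPowerSeries S R →+ MvPowerSeries T R) : Prop :=
  ∀ d, LocalFun ((coeff (R := R) d).toAddMonoidHom.comp L)

theorem isLocal_iff (L : MvPowerSeries S R →+ MvPowerSeries T R) :
    IsLocal L ↔ ∀ d, ∃ s : Finset (S →₀ ℕ), ∀ a, (∀ e ∈ s, coeff e a = 0) → coeff d (L a) = 0 :=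
  Iff.rfl

/-- Truncating `a` to the finitely many coefficients seen by `L` and `L'` leaves a finite sum of
monomials on which both take the same values as on `a`. Identities involving substitution of
infinite series are thereby reduced to monomials. -/
theorem LocalFun.ext {M : Type*} [AddCommGroup M] {L L' : MvPowerSeries S R →+ M}
    (h : LocalFun L) (h' : LocalFun L') (hm : ∀ e r, L (monomial e r) = L' (monomial e r)) :
    L = L' := by
  classical
  obtain ⟨s, hs⟩ := h
  obtain ⟨s', hs'⟩ := h'
  ext a
  set b := ∑ e ∈ s ∪ s', monomial e (coeff e a) with hb
  have hco : ∀ e ∈ s ∪ s', coeff e (a - b) = 0 := by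
    intro e he
    simp only [hb, map_sub, map_sum, coeff_monomial]
    rw [Finset.sum_eq_single e]
    · simp
    · intro x _ hx; rw [if_neg hx.symm]
    · intro h; exact absurd he h
  have h1 := hs (a - b) fun e he => hco e (Finset.mem_union_left _ he)
  have h2 := hs' (a - b) fun e he => hco e (Finset.mem_union_right _ he)
  have h3 : L b = L' b := by simp only [hb, map_sum, hm]
  rw [map_sub, sub_eq_zero] at h1 h2
  rw [h1, h2, h3]

theorem LocalFun.add {M : Type*} [AddCommGroup M] {L L' : MvPowerSeries S R →+ M}
    (h : LocalFun L) (h' : LocalFun L') : LocalFun (L + L') := by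
  classical
  obtain ⟨s, hs⟩ := h
  obtain ⟨s', hs'⟩ := h'
  refine ⟨s ∪ s', fun a ha => ?_⟩
  rw [AddMonoidHom.add_apply, hs a fun e he => ha e (Finset.mem_union_left _ he),
    hs' a fun e he => ha e (Finset.mem_union_right _ he), add_zero]

theorem LocalFun.sum {M : Type*} [AddCommGroup M] {ι : Type*} (F : Finset ι)
    {L : ι → MvPowerSeries S R →+ M} (h : ∀ i, LocalFun (L i)) : LocalFun (∑ i ∈ F, L i) := by
  classical
  induction F using Finset.induction_on with
  | empty => exact ⟨∅, fun a _ => by simp⟩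
  | insert i F hi ih => rw [Finset.sum_insert hi]; exact (h i).add ih

theorem IsLocal.comp {L : MvPowerSeries S R →+ MvPowerSeries T R}
    {L' : MvPowerSeries T R →+ MvPowerSeries T' R} (h' : IsLocal L') (h : IsLocal L) :
    IsLocal (L'.comp L) := by
  classical
  intro d
  obtain ⟨s', hs'⟩ := h' d
  choose s hs using h
  exact ⟨s'.biUnion s, fun a ha => hs' _ fun e he =>
    hs e a fun x hx => ha x (Finset.mem_biUnion.2 ⟨e, he, hx⟩)⟩

theorem isLocal_mulLeft (c : MvPowerSeries S R) : IsLocal (AddMonoidHom.mulLeft c) := by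
  classical
  intro d
  refine ⟨(Finset.HasAntidiagonal.antidiagonal d).image Prod.snd, fun a ha => ?_⟩
  change coeff d (c * a) = 0
  rw [coeff_mul]
  exact Finset.sum_eq_zero fun x hx => by rw [ha x.2 (Finset.mem_image_of_mem _ hx), mul_zero]

theorem isLocal_pderiv (t : S) : IsLocal ((pderiv R t).toLinearMap.toAddMonoidHom) := by
  intro d
  refine ⟨{d + Finsupp.single t 1}, fun a ha => ?_⟩
  change coeff d (pderiv R t a) = 0
  rw [coeff_pderiv, ha _ (Finset.mem_singleton_self _), zero_mul]

theorem isLocal_subst {y : S → MvPowerSeries T R} (hy : HasSubst y) :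
    IsLocal ((substAlgHom (R := R) hy).toLinearMap.toAddMonoidHom) := by
  intro d
  -- For the series with all coefficients equal to 1, this finite set contains every exponent whose
  -- monomial in `y` reaches `d`, so it serves for all `a` at once.
  have hf := coeff_subst_finite (R := R) hy (fun _ => 1) d
  refine ⟨hf.toFinset, fun a ha => ?_⟩
  change coeff d (substAlgHom (R := R) hy a) = 0
  rw [substAlgHom_apply, coeff_subst hy, finsum_eq_zero_of_forall_eq_zero]
  intro e
  by_cases he : e ∈ hf.toFinset
  · rw [ha e he, zero_smul]
  · have : coeff d (e.prod fun s k => y s ^ k) = 0 := by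
      by_contra hne
      refine he (hf.mem_toFinset.2 ?_)
      change (1 : R) • _ ≠ 0
      rwa [one_smul]
    rw [this, smul_zero]

theorem pderiv_pderiv_comm (s t : S) (a : MvPowerSeries S R) :
    pderiv R s (pderiv R t a) = pderiv R t (pderiv R s a) := by
  classical
  ext d
  simp only [coeff_pderiv, Finsupp.add_apply]
  rw [add_right_comm d]
  by_cases h : s = t
  · subst h; ring
  · rw [Finsupp.single_eq_of_ne h, Finsupp.single_eq_of_ne (Ne.symm h)]
    push_cast; ring

/-- Leibniz rule for a monomial in power series. -/
theorem derivation_finsuppProd {A : Type*} [CommRing A] [Algebra R A] (D : Derivation R A A)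
    (y : S → A) (e : S →₀ ℕ) (F : Finset S) (hF : e.support ⊆ F) :
    D (e.prod fun s k => y s ^ k) =
      ∑ s ∈ F, (e s : A) * (e - Finsupp.single s 1).prod (fun s k => y s ^ k) * D (y s) := by
  classical
  let f : MvPolynomial S R := MvPolynomial.monomial e 1
  have h1 : (e.prod fun s k => y s ^ k) = MvPolynomial.aeval y f := by
    simp [f, MvPolynomial.aeval_monomial]
  have h2 : ∀ p : MvPolynomial S R, p.vars ⊆ F → D (MvPolynomial.aeval y p) =
      ∑ s ∈ F, MvPolynomial.aeval y (MvPolynomial.pderiv s p) * D (y s) := by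
    intro p hp
    -- Evaluation at `y` makes `A` a module over the polynomial ring. Both sides then become
    -- derivations `D1`, `D2` into `A`, and these need only be compared on the variables of `p`.
    let _ : Module (MvPolynomial S R) A := Module.compHom A (MvPolynomial.aeval y).toRingHom
    have hsm : ∀ (q : MvPolynomial S R) (x : A), q • x = MvPolynomial.aeval y q * x :=
      fun _ _ => rfl
    have : IsScalarTower R (MvPolynomial S R) A := ⟨fun r q x => by
      rw [hsm, hsm, map_smul, smul_mul_assoc]⟩
    let D1 : Derivation R (MvPolynomial S R) A :=
      Derivation.mk' (D.toLinearMap.comp (MvPolynomial.aeval y).toLinearMap) fun a b => by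
        simp [hsm, Derivation.leibniz]
    let D2 : Derivation R (MvPolynomial S R) A :=
      Derivation.mk' (∑ s ∈ F, (LinearMap.mulRight R (D (y s))).comp
        ((MvPolynomial.aeval y).toLinearMap.comp (MvPolynomial.pderiv s).toLinearMap)) fun a b => by
        simp only [LinearMap.sum_apply, LinearMap.comp_apply, Derivation.coeFn_coe,
          Derivation.leibniz, AlgHom.toLinearMap_apply, map_add, smul_eq_mul, map_mul,
          LinearMap.mulRight_apply, hsm, Finset.mul_sum, ← Finset.sum_add_distrib]
        exact Finset.sum_congr rfl fun _ _ => by ring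
    have := MvPolynomial.derivation_eq_of_forall_mem_vars (D₁ := D1) (D₂ := D2) (f := p)
      fun i hi => by
        change D (MvPolynomial.aeval y (MvPolynomial.X i)) = (∑ s ∈ F, _ : _ →ₗ[R] _) _
        simp only [LinearMap.sum_apply, LinearMap.comp_apply, Derivation.coeFn_coe,
          AlgHom.toLinearMap_apply, MvPolynomial.aeval_X, LinearMap.mulRight_apply,
          MvPolynomial.pderiv_X]
        rw [Finset.sum_eq_single i]
        · simp
        · intro b _ hb
          rw [Pi.single_eq_of_ne hb.symm, map_zero, zero_mul]
        · exact fun h => absurd (hp hi) h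
    change D1 p = _
    rw [this]
    change (∑ s ∈ F, _ : _ →ₗ[R] _) p = _
    simp [LinearMap.sum_apply]
  rw [h1, h2]
  · refine Finset.sum_congr rfl fun s _ => ?_
    simp only [f, MvPolynomial.pderiv_monomial, one_mul, MvPolynomial.aeval_monomial]
    simp
  -- `vars_monomial` needs a nonzero coefficient, so the zero ring is treated separately.
  · rcases subsingleton_or_nontrivial R with hR | hR
    · rw [Subsingleton.elim f (MvPolynomial.C 0), MvPolynomial.vars_C]
      exact Finset.empty_subset _
    simpa [f, MvPolynomial.vars_monomial] using hF

theorem pderiv_monomial' (s : S) (e : S →₀ ℕ) (r : R) :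
    pderiv R s (monomial e r) = monomial (e - Finsupp.single s 1) (r * e s) := by
  rw [← MvPolynomial.coe_monomial, pderiv_coe, MvPolynomial.pderiv_monomial,
    MvPolynomial.coe_monomial]

/-- The chain rule, coefficientwise: the sum over all variables is finite for each coefficient. -/
theorem coeff_pderiv_subst {y : S → MvPowerSeries T R} (hy : HasSubst y) (t : T) (d : T →₀ ℕ) :
    ∃ F₀ : Finset S, ∀ F : Finset S, F₀ ⊆ F → ∀ f : MvPowerSeries S R,
      coeff d (pderiv R t (subst y f)) =
        coeff d (∑ s ∈ F, subst y (pderiv R s f) * pderiv R t (y s)) := by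
  classical
  -- The derivative of `y s` affects the coefficient at `d` only through coefficients of `y s` at
  -- exponents below `d + single t 1`. The resulting finite set does not depend on `f`, so both
  -- sides can be compared as local functionals of `f`.
  have hfin : (⋃ e ∈ Finset.Iic (d + Finsupp.single t 1), {s | coeff e (y s) ≠ 0}).Finite :=
    Set.Finite.biUnion (Finset.finite_toSet _) fun e _ => hy.coeff_zero e
  refine ⟨hfin.toFinset, fun F hF f => ?_⟩
  have hzero : ∀ s ∉ F, ∀ g, coeff d (g * pderiv R t (y s)) = 0 := by
    intro s hs g
    rw [coeff_mul]
    refine Finset.sum_eq_zero fun x hx => ?_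
    rw [coeff_pderiv]
    have hle : x.2 ≤ d := by
      rw [← Finset.HasAntidiagonal.mem_antidiagonal.1 hx]; exact le_add_self
    by_cases h0 : coeff (x.2 + Finsupp.single t 1) (y s) = 0
    · rw [h0, zero_mul, mul_zero]
    · refine absurd (hF (hfin.mem_toFinset.2 ?_)) hs
      simp only [Set.mem_iUnion]
      exact ⟨_, Finset.mem_Iic.2 (add_le_add_left hle _), h0⟩
  let A : MvPowerSeries S R →+ MvPowerSeries T R := (substAlgHom (R := R) hy).toLinearMap.toAddMonoidHom
  have hA : ∀ g, A g = subst y g := fun g => substAlgHom_apply hy g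
  let L1 := ((pderiv R t).toLinearMap.toAddMonoidHom).comp A
  let L2 : S → MvPowerSeries S R →+ MvPowerSeries T R := fun s =>
    (AddMonoidHom.mulLeft (pderiv R t (y s))).comp (A.comp (pderiv R s).toLinearMap.toAddMonoidHom)
  have hL1 : IsLocal L1 := (isLocal_pderiv t).comp (isLocal_subst hy)
  have hL2 : ∀ s, IsLocal (L2 s) := fun s =>
    (isLocal_mulLeft _).comp ((isLocal_subst hy).comp (isLocal_pderiv s))
  have key := LocalFun.ext (hL1 d) (LocalFun.sum F fun s => hL2 s d) (fun e r => ?_)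
  · have := DFunLike.congr_fun key f
    simp only [AddMonoidHom.finsetSum_apply] at this
    rw [map_sum]
    rw [← hA]
    refine Eq.trans ?_ (this.trans (Finset.sum_congr rfl fun s _ => ?_))
    · rfl
    · rw [← hA, mul_comm]
      rfl
  · simp only [AddMonoidHom.finsetSum_apply, AddMonoidHom.comp_apply]
    change coeff d (pderiv R t (A _)) = ∑ s ∈ F, coeff d (pderiv R t (y s) * A (pderiv R s _))
    -- The support of `e` may be added to `F`, since `hzero` kills the new terms; afterwards the
    -- Leibniz rule for monomials applies.
    have hu : ∑ s ∈ F, coeff d (pderiv R t (y s) * A (pderiv R s (monomial e r))) =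
        ∑ s ∈ F ∪ e.support, coeff d (pderiv R t (y s) * A (pderiv R s (monomial e r))) := by
      refine Finset.sum_subset Finset.subset_union_left fun s _ hs => ?_
      rw [mul_comm, hzero s hs]
    rw [hu, ← map_sum]
    congr 1
    rw [hA, subst_monomial hy, ← Algebra.smul_def, Derivation.map_smul,
      derivation_finsuppProd _ y e (F ∪ e.support) Finset.subset_union_right, Finset.smul_sum]
    refine Finset.sum_congr rfl fun s _ => ?_
    rw [hA, pderiv_monomial', subst_monomial hy, Algebra.smul_def, map_mul, map_natCast]
    ring

/-- The chain rule, if only finitely many of the substituted series depend on the variable. -/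
theorem pderiv_subst_of_pderiv_eq_zero {y : S → MvPowerSeries T R} (hy : HasSubst y) (t : T)
    (F : Finset S) (hF : ∀ s ∉ F, pderiv R t (y s) = 0) (f : MvPowerSeries S R) :
    pderiv R t (subst y f) = ∑ s ∈ F, subst y (pderiv R s f) * pderiv R t (y s) := by
  classical
  ext d
  obtain ⟨F₀, h₀⟩ := coeff_pderiv_subst hy t d
  rw [h₀ (F ∪ F₀) Finset.subset_union_right]
  congr 1
  exact (Finset.sum_subset Finset.subset_union_left fun s _ hs => by rw [hF s hs, mul_zero]).symm

/-- The chain rule, if the outer series depends on finitely many variables. -/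
theorem pderiv_subst_of_vars {y : S → MvPowerSeries T R} (hy : HasSubst y) (t : T)
    (F : Finset S) (f : MvPowerSeries S R) (hF : ∀ s ∉ F, pderiv R s f = 0) :
    pderiv R t (subst y f) = ∑ s ∈ F, subst y (pderiv R s f) * pderiv R t (y s) := by
  classical
  ext d
  obtain ⟨F₀, h₀⟩ := coeff_pderiv_subst hy t d
  rw [h₀ (F ∪ F₀) Finset.subset_union_right]
  congr 1
  refine (Finset.sum_subset Finset.subset_union_left fun s _ hs => ?_).symm
  rw [hF s hs, ← substAlgHom_apply hy, map_zero, zero_mul]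

theorem pderiv_subst [Fintype S] {y : S → MvPowerSeries T R} (hy : HasSubst y) (t : T)
    (f : MvPowerSeries S R) :
    pderiv R t (subst y f) = ∑ s, subst y (pderiv R s f) * pderiv R t (y s) :=
  pderiv_subst_of_vars hy t Finset.univ f fun s hs => absurd (Finset.mem_univ s) hs

end Local

/-! ### Formal sums -/

section FormalSums

variable {κ κ' T T' : Type}

/-- The family `t` is formally summable with sum `a`. -/
def HasFSum (t : κ → MvPowerSeries T ℝ) (a : MvPowerSeries T ℝ) : Prop :=
  FormallySummable t ∧ formalSum t = a

theorem coeff_formalSum (t : κ → MvPowerSeries T ℝ) (d : T →₀ ℕ) :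
    coeff d (formalSum t) = ∑ᶠ x, coeff d (t x) := rfl

theorem FormallySummable.hasFSum {t : κ → MvPowerSeries T ℝ} (h : FormallySummable t) :
    HasFSum t (formalSum t) := ⟨h, rfl⟩

theorem HasFSum.unique {t : κ → MvPowerSeries T ℝ} {a b : MvPowerSeries T ℝ}
    (h : HasFSum t a) (h' : HasFSum t b) : a = b := h.2.symm.trans h'.2

theorem FormallySummable.coeff_eq_sum {t : κ → MvPowerSeries T ℝ} (_h : FormallySummable t)
    (d : T →₀ ℕ) (F : Finset κ) (hF : ∀ x ∉ F, coeff d (t x) = 0) :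
    coeff d (formalSum t) = ∑ x ∈ F, coeff d (t x) := by
  rw [coeff_formalSum]
  exact finsum_eq_sum_of_support_subset _ fun x hx => by
    by_contra hn
    exact hx (hF x hn)

theorem hasFSum_of_finset {t : κ → MvPowerSeries T ℝ} (F : Finset κ) (h : ∀ x ∉ F, t x = 0) :
    HasFSum t (∑ x ∈ F, t x) := by
  have hs : FormallySummable t := fun d => F.finite_toSet.subset fun x hx => by
    by_contra hn
    exact hx (by rw [h x hn, map_zero])
  refine ⟨hs, ?_⟩
  ext d
  rw [hs.coeff_eq_sum d F fun x hx => by rw [h x hx, map_zero], map_sum]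

theorem hasFSum_fintype [Fintype κ] (t : κ → MvPowerSeries T ℝ) : HasFSum t (∑ x, t x) :=
  hasFSum_of_finset Finset.univ fun x hx => absurd (Finset.mem_univ x) hx

theorem hasFSum_zero : HasFSum (fun _ : κ => (0 : MvPowerSeries T ℝ)) 0 := by
  simpa using hasFSum_of_finset (∅ : Finset κ) (t := fun _ => (0 : MvPowerSeries T ℝ))
    (fun _ _ => rfl)

/-- One output coefficient of `L` depends on finitely many input coefficients, and each of these is
nonzero in only finitely many members of the family. Coefficient by coefficient, the sum is
therefore finite and additivity suffices. -/
theorem HasFSum.map {t : κ → MvPowerSeries T ℝ} {a : MvPowerSeries T ℝ} (h : HasFSum t a)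
    {L : MvPowerSeries T ℝ →+ MvPowerSeries T' ℝ} (hL : IsLocal L) :
    HasFSum (fun x => L (t x)) (L a) := by
  classical
  obtain ⟨hs, rfl⟩ := h
  have key : ∀ d, ∃ F : Finset κ, (∀ x ∉ F, coeff d (L (t x)) = 0) ∧
      coeff d (L (formalSum t)) = ∑ x ∈ F, coeff d (L (t x)) := by
    intro d
    obtain ⟨s, h0⟩ := (isLocal_iff L).1 hL d
    have hfin : (⋃ e ∈ s, {x : κ | coeff e (t x) ≠ 0}).Finite :=
      Set.Finite.biUnion s.finite_toSet fun e _ => hs e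
    have hz : ∀ x ∉ hfin.toFinset, ∀ e ∈ s, coeff e (t x) = 0 := by
      intro x hx e he
      by_contra hne
      exact hx (hfin.mem_toFinset.2 (Set.mem_biUnion he hne))
    refine ⟨hfin.toFinset, fun x hx => h0 _ (hz x hx), ?_⟩
    rw [← map_sum, ← map_sum, ← sub_eq_zero, ← map_sub, ← map_sub]
    refine h0 _ fun e he => ?_
    rw [map_sub, map_sum, hs.coeff_eq_sum e hfin.toFinset (fun x hx => hz x hx e he), sub_self]
  have hs' : FormallySummable fun x => L (t x) := fun d => by
    obtain ⟨F, hF, -⟩ := key d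
    exact F.finite_toSet.subset fun x hx => by
      by_contra hn
      exact hx (hF x hn)
  refine ⟨hs', ?_⟩
  ext d
  obtain ⟨F, hF, hd⟩ := key d
  rw [hs'.coeff_eq_sum d F hF, hd]

theorem HasFSum.mul_left {t : κ → MvPowerSeries T ℝ} {a : MvPowerSeries T ℝ} (h : HasFSum t a)
    (b : MvPowerSeries T ℝ) : HasFSum (fun x => b * t x) (b * a) :=
  h.map (isLocal_mulLeft b)

theorem HasFSum.mul_right {t : κ → MvPowerSeries T ℝ} {a : MvPowerSeries T ℝ} (h : HasFSum t a)
    (b : MvPowerSeries T ℝ) : HasFSum (fun x => t x * b) (a * b) := by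
  simpa only [mul_comm _ b] using h.mul_left b

theorem HasFSum.pderiv {t : κ → MvPowerSeries T ℝ} {a : MvPowerSeries T ℝ} (h : HasFSum t a)
    (s : T) : HasFSum (fun x => MvPowerSeries.pderiv ℝ s (t x)) (MvPowerSeries.pderiv ℝ s a) :=
  h.map (isLocal_pderiv s)

theorem HasFSum.subst {t : κ → MvPowerSeries T ℝ} {a : MvPowerSeries T ℝ} (h : HasFSum t a)
    {y : T → MvPowerSeries T' ℝ} (hy : HasSubst y) :
    HasFSum (fun x => MvPowerSeries.subst y (t x)) (MvPowerSeries.subst y a) := by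
  simp only [← substAlgHom_apply hy]
  exact h.map (isLocal_subst hy)

theorem HasFSum.neg {t : κ → MvPowerSeries T ℝ} {a : MvPowerSeries T ℝ} (h : HasFSum t a) :
    HasFSum (fun x => -t x) (-a) := by
  simpa only [neg_one_mul] using h.mul_left (-1)

theorem HasFSum.add {s t : κ → MvPowerSeries T ℝ} {a b : MvPowerSeries T ℝ} (h : HasFSum s a)
    (h' : HasFSum t b) : HasFSum (fun x => s x + t x) (a + b) := by
  classical
  obtain ⟨h, rfl⟩ := h
  obtain ⟨h', rfl⟩ := h'
  have hs : FormallySummable fun x => s x + t x := fun d =>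
    ((h d).union (h' d)).subset fun x hx => by
      by_contra hn
      simp only [Set.mem_union, Set.mem_ofPred_eq, not_or, not_not] at hn
      exact hx (by rw [map_add, hn.1, hn.2, add_zero])
  refine ⟨hs, ?_⟩
  ext d
  rw [map_add, coeff_formalSum, coeff_formalSum, coeff_formalSum, ← finsum_add_distrib (h d) (h' d)]
  simp only [map_add]

theorem HasFSum.sub {s t : κ → MvPowerSeries T ℝ} {a b : MvPowerSeries T ℝ} (h : HasFSum s a)
    (h' : HasFSum t b) : HasFSum (fun x => s x - t x) (a - b) := by
  simpa only [sub_eq_add_neg] using h.add h'.neg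

theorem HasFSum.finsetSum {ι : Type*} (F : Finset ι) {t : ι → κ → MvPowerSeries T ℝ}
    {a : ι → MvPowerSeries T ℝ} (h : ∀ i ∈ F, HasFSum (t i) (a i)) :
    HasFSum (fun x => ∑ i ∈ F, t i x) (∑ i ∈ F, a i) := by
  classical
  induction F using Finset.induction_on with
  | empty => simpa using hasFSum_zero
  | insert i F hi ih =>
    simp only [Finset.sum_insert hi]
    exact (h i (Finset.mem_insert_self _ _)).add
      (ih fun j hj => h j (Finset.mem_insert_of_mem hj))

theorem HasFSum.congr {s t : κ → MvPowerSeries T ℝ} {a : MvPowerSeries T ℝ} (h : HasFSum s a)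
    (hst : ∀ x, t x = s x) : HasFSum t a := by
  rwa [show t = s from funext hst]

theorem HasFSum.equiv {t : κ → MvPowerSeries T ℝ} {a : MvPowerSeries T ℝ} (h : HasFSum t a)
    (e : κ' ≃ κ) : HasFSum (fun x => t (e x)) a := by
  obtain ⟨h, rfl⟩ := h
  refine ⟨fun d => (h d).preimage e.injective.injOn, ?_⟩
  ext d
  rw [coeff_formalSum, coeff_formalSum]
  exact finsum_comp_equiv e (f := fun x => coeff d (t x))

/-- Extension of a formal sum by zero along an injective map. -/
theorem HasFSum.extend {t : κ → MvPowerSeries T ℝ} {a : MvPowerSeries T ℝ} (h : HasFSum t a)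
    {j : κ → κ'} (hj : Function.Injective j) {t' : κ' → MvPowerSeries T ℝ}
    (ht : ∀ x, t' (j x) = t x) (h0 : ∀ y ∉ Set.range j, t' y = 0) : HasFSum t' a := by
  classical
  obtain ⟨h, rfl⟩ := h
  have hs : FormallySummable t' := fun d => ((h d).image j).subset fun y hy => by
    by_cases hr : y ∈ Set.range j
    · obtain ⟨x, rfl⟩ := hr
      exact ⟨x, by simpa only [Set.mem_ofPred_eq, ht] using hy, rfl⟩
    · exact absurd (by rw [h0 y hr, map_zero]) hy
  refine ⟨hs, ?_⟩
  ext d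
  rw [hs.coeff_eq_sum d ((h d).toFinset.map ⟨j, hj⟩), h.coeff_eq_sum d (h d).toFinset,
    Finset.sum_map]
  · simp only [Function.Embedding.coeFn_mk, ht]
  · intro x hx
    simpa using hx
  · intro y hy
    by_cases hr : y ∈ Set.range j
    · obtain ⟨x, rfl⟩ := hr
      rw [ht]
      by_contra hne
      exact hy (Finset.mem_map.2 ⟨x, (h d).mem_toFinset.2 hne, rfl⟩)
    · rw [h0 y hr, map_zero]

/-- Summation over the fibers of a product. -/
theorem HasFSum.fiberwise {t : κ × κ' → MvPowerSeries T ℝ} {a : MvPowerSeries T ℝ}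
    (h : HasFSum t a) {b : κ → MvPowerSeries T ℝ} (hb : ∀ x, HasFSum (fun y => t (x, y)) (b x)) :
    HasFSum b a := by
  classical
  obtain ⟨h, rfl⟩ := h
  have hz : ∀ d, ∀ x ∉ (h d).toFinset.image Prod.fst, ∀ y, coeff d (t (x, y)) = 0 := by
    intro d x hx y
    by_contra hne
    exact hx (Finset.mem_image.2 ⟨(x, y), (h d).mem_toFinset.2 hne, rfl⟩)
  have hbz : ∀ d, ∀ x ∉ (h d).toFinset.image Prod.fst, coeff d (b x) = 0 := by
    intro d x hx
    rw [← (hb x).2, (hb x).1.coeff_eq_sum d ∅ fun y _ => hz d x hx y, Finset.sum_empty]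
  have hs : FormallySummable b := fun d =>
    (Finset.finite_toSet _).subset fun x hx => by
      by_contra hn
      exact hx (hbz d x hn)
  refine ⟨hs, ?_⟩
  ext d
  set P := (h d).toFinset with hP
  rw [hs.coeff_eq_sum d _ (hbz d), h.coeff_eq_sum d (P.image Prod.fst ×ˢ P.image Prod.snd),
    Finset.sum_product]
  · refine Finset.sum_congr rfl fun x _ => ?_
    rw [← (hb x).2, (hb x).1.coeff_eq_sum d]
    intro y hy
    by_contra hne
    exact hy (Finset.mem_image.2 ⟨(x, y), (h d).mem_toFinset.2 hne, rfl⟩)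
  · rintro ⟨x, y⟩ hxy
    by_contra hne
    have := (h d).mem_toFinset.2 hne
    exact hxy (Finset.mem_product.2 ⟨Finset.mem_image_of_mem _ this, Finset.mem_image_of_mem _ this⟩)

/-- The coefficient of the product at `d` only sees the coefficients of `s x` at the finitely many
exponents below `d`, so the factors `r x` can be arbitrary. Hence a bracket of bounded series
converges whatever its components are. -/
theorem FormallySummable.mul_any {s : κ → MvPowerSeries T ℝ} (h : FormallySummable s)
    (r : κ → MvPowerSeries T ℝ) : FormallySummable fun x => s x * r x := by
  classical
  intro d
  have hfin : (⋃ e ∈ Finset.HasAntidiagonal.antidiagonal d, {x | coeff e.1 (s x) ≠ 0}).Finite :=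
    Set.Finite.biUnion (Finset.finite_toSet _) fun e _ => h e.1
  refine hfin.subset fun x hx => ?_
  by_contra hn
  refine hx ?_
  rw [coeff_mul]
  refine Finset.sum_eq_zero fun e he => ?_
  have : coeff e.1 (s x) = 0 := by
    by_contra hne
    exact hn (Set.mem_biUnion he hne)
  rw [this, zero_mul]

/-- For each splitting of `d`, finitely many `x` contribute through the first factor, and for each
of them finitely many `y` through the second. No uniformity of `r x` in `x` is needed. -/
theorem FormallySummable.mul_dep {s : κ → MvPowerSeries T ℝ} (h : FormallySummable s)
    {r : κ → κ' → MvPowerSeries T ℝ} (hr : ∀ x, FormallySummable (r x)) :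
    FormallySummable fun x : κ × κ' => s x.1 * r x.1 x.2 := by
  classical
  intro d
  have hfin : (⋃ e ∈ Finset.HasAntidiagonal.antidiagonal d, ⋃ x ∈ {x | coeff e.1 (s x) ≠ 0},
      (fun y => (x, y)) '' {y | coeff e.2 (r x y) ≠ 0}).Finite :=
    Set.Finite.biUnion (Finset.finite_toSet _) fun e _ =>
      Set.Finite.biUnion (h e.1) fun x _ => (hr x e.2).image _
  refine hfin.subset fun ⟨x, y⟩ hx => ?_
  by_contra hn
  refine hx ?_
  rw [coeff_mul]
  refine Finset.sum_eq_zero fun e he => ?_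
  by_contra hne
  refine hn (Set.mem_biUnion he (Set.mem_biUnion (x := x) (left_ne_zero_of_mul hne)
    ⟨y, right_ne_zero_of_mul hne, rfl⟩))

theorem HasFSum.mul {s : κ → MvPowerSeries T ℝ} {t : κ' → MvPowerSeries T ℝ}
    {a b : MvPowerSeries T ℝ} (h : HasFSum s a) (h' : HasFSum t b) :
    HasFSum (fun x : κ × κ' => s x.1 * t x.2) (a * b) := by
  have hs : FormallySummable fun x : κ × κ' => s x.1 * t x.2 :=
    h.1.mul_dep (r := fun _ => t) fun _ => h'.1
  refine ⟨hs, ?_⟩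
  have := hs.hasFSum.fiberwise (b := fun x => s x * b) fun x => h'.mul_left (s x)
  exact this.unique (h.mul_right b)

theorem HasFSum.eq_sum {t : κ → MvPowerSeries T ℝ} {a : MvPowerSeries T ℝ} (h : HasFSum t a)
    (F : Finset κ) (hF : ∀ x ∉ F, t x = 0) : a = ∑ x ∈ F, t x :=
  h.unique (hasFSum_of_finset F hF)

/-- A sum over a product with a finite type. -/
theorem HasFSum.of_fintype_prod {ι : Type} [Fintype ι] {t : ι × κ → MvPowerSeries T ℝ}
    {b : ι → MvPowerSeries T ℝ} (h : ∀ i, HasFSum (fun x => t (i, x)) (b i)) :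
    HasFSum t (∑ i, b i) := by
  have hs : FormallySummable t := fun d => by
    refine (Set.finite_iUnion fun i => ((h i).1 d).image fun x => (i, x)).subset ?_
    rintro ⟨i, x⟩ hx
    exact Set.mem_iUnion.2 ⟨i, x, hx, rfl⟩
  exact ⟨hs, (hs.hasFSum.fiberwise h).unique (hasFSum_fintype b)⟩

end FormalSums

/-! ### Power series of bounded weight -/

section Weights

variable {S T : Type}

/-- All monomials of `a` have weight at most `K`. -/
def Bdd (wt : T → ℤ) (K : ℤ) (a : MvPowerSeries T ℝ) : Prop :=
  ∀ d, coeff d a ≠ 0 → Finsupp.weight wt d ≤ K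

variable {wt : T → ℤ} {K K' : ℤ} {a b : MvPowerSeries T ℝ}

theorem Bdd.mono (h : Bdd wt K a) (hK : K ≤ K') : Bdd wt K' a := fun d hd => (h d hd).trans hK

theorem Bdd.zero : Bdd wt K 0 := fun _ hd => absurd (map_zero _) hd

theorem Bdd.add (h : Bdd wt K a) (h' : Bdd wt K b) : Bdd wt K (a + b) := fun d hd => by
  by_cases ha : coeff d a = 0
  · exact h' d fun hb => hd (by rw [map_add, ha, hb, add_zero])
  · exact h d ha

theorem Bdd.neg (h : Bdd wt K a) : Bdd wt K (-a) := fun d hd =>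
  h d fun h0 => hd (by rw [map_neg, h0, neg_zero])

theorem Bdd.sub (h : Bdd wt K a) (h' : Bdd wt K b) : Bdd wt K (a - b) := by
  rw [sub_eq_add_neg]; exact h.add h'.neg

theorem Bdd.sum {ι : Type*} (F : Finset ι) {a : ι → MvPowerSeries T ℝ}
    (h : ∀ i, Bdd wt K (a i)) : Bdd wt K (∑ i ∈ F, a i) := by
  classical
  induction F using Finset.induction_on with
  | empty => exact Bdd.zero
  | insert i F hi ih => rw [Finset.sum_insert hi]; exact (h i).add ih

theorem Bdd.smul (h : Bdd wt K a) (r : ℝ) : Bdd wt K (r • a) := fun d hd =>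
  h d fun h0 => hd (by rw [map_smul, h0, smul_zero])

theorem Bdd.mul (h : Bdd wt K a) (h' : Bdd wt K' b) : Bdd wt (K + K') (a * b) := by
  classical
  intro d hd
  rw [coeff_mul] at hd
  obtain ⟨e, he, hne⟩ := Finset.exists_ne_zero_of_sum_ne_zero hd
  rw [← Finset.HasAntidiagonal.mem_antidiagonal.1 he, map_add]
  exact add_le_add (h _ (left_ne_zero_of_mul hne)) (h' _ (right_ne_zero_of_mul hne))

theorem Bdd.one : Bdd wt 0 (1 : MvPowerSeries T ℝ) := by
  classical
  intro d hd
  rw [coeff_one] at hd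
  rw [(ite_ne_right_iff.1 hd).1, map_zero]

theorem Bdd.pow (h : Bdd wt K a) (n : ℕ) : Bdd wt (n * K) (a ^ n) := by
  induction n with
  | zero => simpa using Bdd.one
  | succ n ih =>
    rw [pow_succ]
    exact (ih.mul h).mono (by push_cast; linarith)

theorem Bdd.prod {ι : Type*} (F : Finset ι) {a : ι → MvPowerSeries T ℝ} {K : ι → ℤ}
    (h : ∀ i, Bdd wt (K i) (a i)) : Bdd wt (∑ i ∈ F, K i) (∏ i ∈ F, a i) := by
  classical
  induction F using Finset.induction_on with
  | empty => simpa using Bdd.one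
  | insert i F hi ih => rw [Finset.sum_insert hi, Finset.prod_insert hi]; exact (h i).mul ih

theorem bdd_X (t : T) : Bdd wt (wt t) (X t) := by
  classical
  intro d hd
  rw [coeff_X] at hd
  rw [(ite_ne_right_iff.1 hd).1]
  simp [Finsupp.weight_apply]

theorem Bdd.pderiv (h : Bdd wt K a) (t : T) :
    Bdd wt (K - wt t) (MvPowerSeries.pderiv ℝ t a) := by
  intro d hd
  rw [coeff_pderiv] at hd
  have := h _ (left_ne_zero_of_mul hd)
  rw [map_add] at this
  simp [Finsupp.weight_apply] at this ⊢
  linarith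

theorem Bdd.formalSum {κ : Type} {t : κ → MvPowerSeries T ℝ}
    (h : ∀ x, Bdd wt K (t x)) : Bdd wt K (formalSum t) := by
  intro d hd
  rw [coeff_formalSum] at hd
  obtain ⟨x, hx⟩ := not_forall.1 (mt finsum_eq_zero_of_forall_eq_zero hd)
  exact h x d hx

theorem Bdd.subst {wS : S → ℤ} {y : S → MvPowerSeries T ℝ} (hy : HasSubst y)
    (hw : ∀ s, Bdd wt (wS s) (y s)) {f : MvPowerSeries S ℝ} (hf : Bdd wS K f) :
    Bdd wt K (MvPowerSeries.subst y f) := by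
  intro d hd
  rw [coeff_subst hy] at hd
  obtain ⟨e, he⟩ := not_forall.1 (mt finsum_eq_zero_of_forall_eq_zero hd)
  have h1 := hf e (left_ne_zero_of_smul he)
  have h2 : Bdd wt (∑ s ∈ e.support, e s * wS s) (e.prod fun s k => y s ^ k) :=
    Bdd.prod _ fun s => (hw s).pow _
  refine (h2 d (right_ne_zero_of_smul he)).trans (le_of_eq_of_le ?_ h1)
  simp [Finsupp.weight_apply, Finsupp.sum]

/-- Together with `Bdd.subst`, this bounds a completely arbitrary series such as $\varphi^{ij}$
after substitution of series of weight at most 0. -/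
theorem bdd_zero_weight (f : MvPowerSeries T ℝ) : Bdd (fun _ => 0) 0 f := fun d _ => by
  simp [Finsupp.weight_apply]

end Weights

/-! ### Formal vector fields and biderivations -/

section Brackets

variable {C T : Type}

/-- The monomials of `a` have bounded weight. -/
def IsBdd (wt : T → ℤ) (a : MvPowerSeries T ℝ) : Prop := ∃ K, Bdd wt K a

section IsBdd
variable {wt : T → ℤ} {a b : MvPowerSeries T ℝ}

theorem IsBdd.add (h : IsBdd wt a) (h' : IsBdd wt b) : IsBdd wt (a + b) := by
  obtain ⟨K, hK⟩ := h
  obtain ⟨K', hK'⟩ := h'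
  exact ⟨max K K', (hK.mono (le_max_left _ _)).add (hK'.mono (le_max_right _ _))⟩

theorem IsBdd.neg (h : IsBdd wt a) : IsBdd wt (-a) := h.imp fun _ h => h.neg

theorem IsBdd.mul (h : IsBdd wt a) (h' : IsBdd wt b) : IsBdd wt (a * b) := by
  obtain ⟨K, hK⟩ := h
  obtain ⟨K', hK'⟩ := h'
  exact ⟨_, hK.mul hK'⟩

theorem IsBdd.smul (h : IsBdd wt a) (r : ℝ) : IsBdd wt (r • a) := h.imp fun _ h => h.smul r

theorem IsBdd.pderiv (h : IsBdd wt a) (t : T) : IsBdd wt (MvPowerSeries.pderiv ℝ t a) := by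
  obtain ⟨K, hK⟩ := h
  exact ⟨_, hK.pderiv t⟩

theorem isBdd_X (t : T) : IsBdd wt (X t) := ⟨_, bdd_X t⟩

theorem isBdd_zero : IsBdd wt 0 := ⟨0, Bdd.zero⟩

theorem IsBdd.sum {ι : Type*} (F : Finset ι) {a : ι → MvPowerSeries T ℝ}
    (h : ∀ i ∈ F, IsBdd wt (a i)) : IsBdd wt (∑ i ∈ F, a i) := by
  classical
  induction F using Finset.induction_on with
  | empty => exact isBdd_zero
  | insert i F hi ih =>
    rw [Finset.sum_insert hi]
    exact (h i (Finset.mem_insert_self _ _)).add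
      (ih fun j hj => h j (Finset.mem_insert_of_mem hj))

end IsBdd

/-- The action of the formal vector field `∑ ξ^p ∂/∂x^p`. -/
def vf (c : C → T) (ξ : C → MvPowerSeries T ℝ) (a : MvPowerSeries T ℝ) : MvPowerSeries T ℝ :=
  formalSum fun p => pderiv ℝ (c p) a * ξ p

/-- The biderivation with components `Ω`. -/
def br (c : C → T) (Ω : C → C → MvPowerSeries T ℝ) (a b : MvPowerSeries T ℝ) :
    MvPowerSeries T ℝ :=
  formalSum fun p : C × C => pderiv ℝ (c p.1) a * pderiv ℝ (c p.2) b * Ω p.1 p.2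

/-- The coordinates `c` have weights tending to infinity. -/
structure IsGrading (wt : T → ℤ) (c : C → T) : Prop where
  inj : Function.Injective c
  finite : ∀ N : ℤ, {p | wt (c p) ≤ N}.Finite

variable {wt : T → ℤ} {c : C → T} {Ω : C → C → MvPowerSeries T ℝ} {a b e : MvPowerSeries T ℝ}

theorem IsGrading.exists_lower (h : IsGrading wt c) : ∃ m : ℤ, ∀ p, m ≤ wt (c p) := by
  obtain ⟨m, hm⟩ := ((h.finite 0).image fun p => wt (c p)).bddBelow
  refine ⟨min m 0, fun p => ?_⟩
  by_cases hp : wt (c p) ≤ 0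
  · exact (min_le_left _ _).trans (hm ⟨p, hp, rfl⟩)
  · exact (min_le_right _ _).trans (not_le.1 hp).le

/-- A monomial `d` in the derivative by `c p` forces the weight of `d` to be at most `K - wt (c p)`.
This bounds `wt (c p)` from above, which leaves finitely many `p`. -/
theorem IsGrading.summable_pderiv (h : IsGrading wt c) (ha : IsBdd wt a) :
    FormallySummable fun p => pderiv ℝ (c p) a := by
  obtain ⟨K, hK⟩ := ha
  intro d
  refine (h.finite (K - Finsupp.weight wt d)).subset fun p hp => ?_
  have := hK.pderiv (c p) d hp
  change wt (c p) ≤ _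
  linarith

/-- Only the sum of the two coordinate weights is bounded from above directly; the common lower
bound `m` turns this into a bound on each of them. -/
theorem IsGrading.summable_pderiv_pderiv (h : IsGrading wt c) (ha : IsBdd wt a) :
    FormallySummable fun p : C × C => pderiv ℝ (c p.1) (pderiv ℝ (c p.2) a) := by
  obtain ⟨K, hK⟩ := ha
  obtain ⟨m, hm⟩ := h.exists_lower
  intro d
  refine ((h.finite (K - m - Finsupp.weight wt d)).prod
    (h.finite (K - m - Finsupp.weight wt d))).subset fun p hp => ?_
  have := (hK.pderiv (c p.2)).pderiv (c p.1) d hp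
  have h1 := hm p.1
  have h2 := hm p.2
  exact ⟨show wt (c p.1) ≤ _ by linarith, show wt (c p.2) ≤ _ by linarith⟩

theorem IsGrading.hasFSum_vf (h : IsGrading wt c) (ha : IsBdd wt a) (ξ : C → MvPowerSeries T ℝ) :
    HasFSum (fun p => pderiv ℝ (c p) a * ξ p) (vf c ξ a) :=
  ((h.summable_pderiv ha).mul_any ξ).hasFSum

theorem IsGrading.hasFSum_br (h : IsGrading wt c) (ha : IsBdd wt a) (hb : IsBdd wt b)
    (Ω : C → C → MvPowerSeries T ℝ) :
    HasFSum (fun p : C × C => pderiv ℝ (c p.1) a * pderiv ℝ (c p.2) b * Ω p.1 p.2)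
      (br c Ω a b) :=
  (((h.summable_pderiv ha).mul_dep (r := fun _ q => pderiv ℝ (c q) b)
    fun _ => h.summable_pderiv hb).mul_any fun p => Ω p.1 p.2).hasFSum

theorem IsGrading.pderiv_X (h : IsGrading wt c) [DecidableEq C] (p q : C) :
    pderiv ℝ (c p) (X (c q) : MvPowerSeries T ℝ) = if p = q then 1 else 0 := by
  split_ifs with hpq
  · rw [hpq, pderiv_X_self]
  · exact pderiv_X_of_ne fun h' => hpq (h.inj h').symm

theorem IsGrading.hasFSum_br_X (h : IsGrading wt c) (hb : IsBdd wt b) (p : C) :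
    HasFSum (fun q => pderiv ℝ (c q) b * Ω p q) (br c Ω (X (c p)) b) := by
  classical
  have h1 := ((h.summable_pderiv hb).mul_any (Ω p)).hasFSum
  have h2 := h.hasFSum_br (isBdd_X (c p)) hb Ω
  rwa [← (h1.extend (j := fun q => (p, q)) (fun _ _ hq => (Prod.mk.inj hq).2) (fun q => by
    rw [h.pderiv_X, if_pos rfl, one_mul]) fun x hx => by
    rw [h.pderiv_X, if_neg fun hp => hx ⟨x.2, Prod.ext hp.symm rfl⟩, zero_mul, zero_mul]).unique h2]

/-- This is the Hamiltonian vector field of `b`: its component along the coordinate `p` is the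
bracket of that coordinate with `b`. -/
theorem IsGrading.br_eq_vf (h : IsGrading wt c) (ha : IsBdd wt a) (hb : IsBdd wt b) :
    br c Ω a b = vf c (fun p => br c Ω (X (c p)) b) a := by
  refine ((h.hasFSum_br ha hb Ω).fiberwise fun p => ?_).unique (h.hasFSum_vf ha _)
  exact ((h.hasFSum_br_X hb p).mul_left (pderiv ℝ (c p) a)).congr fun q => mul_assoc _ _ _

theorem IsGrading.br_add_left (h : IsGrading wt c) {a' : MvPowerSeries T ℝ} (ha : IsBdd wt a)
    (ha' : IsBdd wt a') (hb : IsBdd wt b) :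
    br c Ω (a + a') b = br c Ω a b + br c Ω a' b :=
  (h.hasFSum_br (ha.add ha') hb Ω).unique
    (((h.hasFSum_br ha hb Ω).add (h.hasFSum_br ha' hb Ω)).congr fun p => by
      rw [map_add]; ring)

theorem IsGrading.br_smul_left (h : IsGrading wt c) (r : ℝ) (ha : IsBdd wt a)
    (hb : IsBdd wt b) : br c Ω (r • a) b = r • br c Ω a b := by
  rw [smul_eq_C_mul (br c Ω a b)]
  refine (h.hasFSum_br (ha.smul r) hb Ω).unique
    (((h.hasFSum_br ha hb Ω).mul_left (MvPowerSeries.C r)).congr fun p => ?_)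
  rw [Derivation.map_smul, smul_eq_C_mul]; ring

theorem IsGrading.br_zero_left (h : IsGrading wt c) (hb : IsBdd wt b) : br c Ω 0 b = 0 := by
  simpa using h.br_smul_left (Ω := Ω) 0 isBdd_zero hb

theorem IsGrading.br_neg_left (h : IsGrading wt c) (ha : IsBdd wt a) (hb : IsBdd wt b) :
    br c Ω (-a) b = -br c Ω a b := by
  simpa using h.br_smul_left (Ω := Ω) (-1) ha hb

theorem IsGrading.br_sub_left (h : IsGrading wt c) {a' : MvPowerSeries T ℝ} (ha : IsBdd wt a)
    (ha' : IsBdd wt a') (hb : IsBdd wt b) :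
    br c Ω (a - a') b = br c Ω a b - br c Ω a' b := by
  rw [sub_eq_add_neg, h.br_add_left ha ha'.neg hb, h.br_neg_left ha' hb, sub_eq_add_neg]

theorem IsGrading.br_sum_left (h : IsGrading wt c) {ι : Type*} (F : Finset ι)
    {a : ι → MvPowerSeries T ℝ} (ha : ∀ i ∈ F, IsBdd wt (a i)) (hb : IsBdd wt b) :
    br c Ω (∑ i ∈ F, a i) b = ∑ i ∈ F, br c Ω (a i) b := by
  classical
  induction F using Finset.induction_on with
  | empty => simpa using h.br_zero_left hb
  | insert i F hi ih =>
    have hF : ∀ j ∈ F, IsBdd wt (a j) := fun j hj => ha j (Finset.mem_insert_of_mem hj)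
    rw [Finset.sum_insert hi, Finset.sum_insert hi,
      h.br_add_left (ha i (Finset.mem_insert_self _ _)) (IsBdd.sum F hF) hb, ih hF]

theorem IsGrading.br_mul_left (h : IsGrading wt c) {a' : MvPowerSeries T ℝ} (ha : IsBdd wt a)
    (ha' : IsBdd wt a') (hb : IsBdd wt b) :
    br c Ω (a * a') b = a * br c Ω a' b + br c Ω a b * a' :=
  (h.hasFSum_br (ha.mul ha') hb Ω).unique
    ((((h.hasFSum_br ha' hb Ω).mul_left a).add ((h.hasFSum_br ha hb Ω).mul_right a')).congr
      fun p => by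
        rw [Derivation.leibniz, smul_eq_mul, smul_eq_mul]; ring)

theorem IsGrading.br_skew (h : IsGrading wt c) (hΩ : ∀ p q, Ω p q = -Ω q p) (ha : IsBdd wt a)
    (hb : IsBdd wt b) : br c Ω a b = -br c Ω b a :=
  (h.hasFSum_br ha hb Ω).unique
    (((h.hasFSum_br hb ha Ω).neg.equiv (Equiv.prodComm C C)).congr fun p => by
      rw [hΩ]
      simp only [Equiv.prodComm_apply, Prod.fst_swap, Prod.snd_swap]
      ring)

/-- The bracket commutes with differentiation by a parameter. -/
theorem IsGrading.pderiv_br (h : IsGrading wt c) (ha : IsBdd wt a) (hb : IsBdd wt b) (t : T)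
    (hΩ : ∀ p q, pderiv ℝ t (Ω p q) = 0) :
    pderiv ℝ t (br c Ω a b) = br c Ω (pderiv ℝ t a) b + br c Ω a (pderiv ℝ t b) :=
  ((h.hasFSum_br ha hb Ω).pderiv t).unique
    (((h.hasFSum_br (ha.pderiv t) hb Ω).add (h.hasFSum_br ha (hb.pderiv t) Ω)).congr fun p => by
      simp only [Derivation.leibniz, hΩ, smul_eq_mul, pderiv_pderiv_comm t]
      ring)

theorem IsGrading.br_subst_left_of_vars (h : IsGrading wt c) {S : Type}
    {y : S → MvPowerSeries T ℝ} (hy : HasSubst y) (hyb : ∀ s, IsBdd wt (y s))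
    {f : MvPowerSeries S ℝ} (F : Finset S) (hF : ∀ s ∉ F, pderiv ℝ s f = 0)
    (hf : IsBdd wt (subst y f)) (hb : IsBdd wt b) :
    br c Ω (subst y f) b = ∑ s ∈ F, subst y (pderiv ℝ s f) * br c Ω (y s) b :=
  (h.hasFSum_br hf hb Ω).unique
    ((HasFSum.finsetSum F fun s _ =>
      (h.hasFSum_br (hyb s) hb Ω).mul_left (subst y (pderiv ℝ s f))).congr fun p => by
        rw [pderiv_subst_of_vars hy _ F f hF, Finset.sum_mul, Finset.sum_mul]
        exact Finset.sum_congr rfl fun s _ => by ring)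

theorem IsGrading.br_subst_left (h : IsGrading wt c) {S : Type} [Fintype S]
    {y : S → MvPowerSeries T ℝ} (hy : HasSubst y) (hyb : ∀ s, IsBdd wt (y s))
    {f : MvPowerSeries S ℝ} (hf : IsBdd wt (subst y f)) (hb : IsBdd wt b) :
    br c Ω (subst y f) b = ∑ s, subst y (pderiv ℝ s f) * br c Ω (y s) b :=
  h.br_subst_left_of_vars hy hyb Finset.univ (fun s hs => absurd (Finset.mem_univ s) hs) hf hb

/-- Components whose weight exceeds that of the coordinates by a bounded amount. -/
def BddComponents (wt : T → ℤ) (c : C → T) (Ω : C → C → MvPowerSeries T ℝ) : Prop :=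
  ∃ L, ∀ p q, Bdd wt (wt (c p) + wt (c q) + L) (Ω p q)

/-- The two derivatives lower the bound by the weights of their coordinates, and the bound on `Ω p
q` gives these back up to the constant `L`. All terms then share one bound, and brackets can be
iterated. -/
theorem BddComponents.isBdd_br (hΩ : BddComponents wt c Ω) (ha : IsBdd wt a) (hb : IsBdd wt b) :
    IsBdd wt (br c Ω a b) := by
  obtain ⟨K, hK⟩ := ha
  obtain ⟨K', hK'⟩ := hb
  obtain ⟨L, hL⟩ := hΩ
  exact ⟨K + K' + L, Bdd.formalSum fun p =>
    (((hK.pderiv (c p.1)).mul (hK'.pderiv (c p.2))).mul (hL p.1 p.2)).mono (by linarith)⟩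

/-- The second-order part of a composition of two vector fields. -/
theorem IsGrading.vf_vf (h : IsGrading wt c) (ha : IsBdd wt a) {ξ η : C → MvPowerSeries T ℝ}
    (hη : ∀ p, IsBdd wt (η p)) (hηa : IsBdd wt (vf c η a)) :
    vf c ξ (vf c η a) =
      formalSum (fun p : C × C => pderiv ℝ (c p.1) (pderiv ℝ (c p.2) a) * (ξ p.1 * η p.2))
        + vf c (fun p => vf c ξ (η p)) a := by
  have h1 := ((h.summable_pderiv_pderiv ha).mul_any fun p => ξ p.1 * η p.2).hasFSum
  have h2' := (h.summable_pderiv ha).mul_dep (r := fun q p => pderiv ℝ (c p) (η q) * ξ p)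
    fun q => (h.hasFSum_vf (hη q) ξ).1
  have h2 : HasFSum (fun p : C × C =>
      pderiv ℝ (c p.2) a * (pderiv ℝ (c p.1) (η p.2) * ξ p.1)) (vf c (fun p => vf c ξ (η p)) a) := by
    have h3 := h2'.hasFSum.fiberwise (b := fun q => pderiv ℝ (c q) a * vf c ξ (η q)) fun q =>
      (h.hasFSum_vf (hη q) ξ).mul_left (pderiv ℝ (c q) a)
    have h4 := h2'.hasFSum.equiv (Equiv.prodComm C C)
    rw [h3.unique (h.hasFSum_vf ha _)] at h4
    exact h4
  refine ((h1.add h2).fiberwise fun p => ?_).unique (h.hasFSum_vf hηa ξ) |>.symm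
  exact (((h.hasFSum_vf ha η).pderiv (c p)).mul_right (ξ p)).congr fun q => by
    simp only [Derivation.leibniz, smul_eq_mul]; ring

/-- The second-order parts of the two compositions agree, because partial derivatives commute and
the index pair can be swapped. Only a vector field remains. -/
theorem IsGrading.vf_comm (h : IsGrading wt c) (ha : IsBdd wt a) {ξ η : C → MvPowerSeries T ℝ}
    (hξ : ∀ p, IsBdd wt (ξ p)) (hη : ∀ p, IsBdd wt (η p))
    (hξa : IsBdd wt (vf c ξ a)) (hηa : IsBdd wt (vf c η a)) :
    vf c ξ (vf c η a) - vf c η (vf c ξ a) = vf c (fun p => vf c ξ (η p) - vf c η (ξ p)) a := by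
  have hs : formalSum (fun p : C × C => pderiv ℝ (c p.1) (pderiv ℝ (c p.2) a) * (ξ p.1 * η p.2))
      = formalSum (fun p : C × C => pderiv ℝ (c p.1) (pderiv ℝ (c p.2) a) * (η p.1 * ξ p.2)) := by
    have h1 := ((h.summable_pderiv_pderiv ha).mul_any fun p => ξ p.1 * η p.2).hasFSum
    have h2 := ((h.summable_pderiv_pderiv ha).mul_any fun p => η p.1 * ξ p.2).hasFSum
    refine ((h1.equiv (Equiv.prodComm C C)).congr fun p => ?_).unique h2 |>.symm ▸ rfl
    simp only [Equiv.prodComm_apply, Prod.fst_swap, Prod.snd_swap]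
    rw [pderiv_pderiv_comm, mul_comm (η _)]
  rw [h.vf_vf ha hη hηa, h.vf_vf ha hξ hξa, hs, add_sub_add_left_eq_sub]
  exact ((h.hasFSum_vf ha _).sub (h.hasFSum_vf ha _)).unique
    ((h.hasFSum_vf ha _).congr fun p => (mul_sub _ _ _).symm)

/-- The Jacobiator. -/
def jac (c : C → T) (Ω : C → C → MvPowerSeries T ℝ) (a b e : MvPowerSeries T ℝ) :
    MvPowerSeries T ℝ :=
  br c Ω (br c Ω a b) e + br c Ω (br c Ω e a) b + br c Ω (br c Ω b e) a

theorem jac_cyclic (c : C → T) (Ω : C → C → MvPowerSeries T ℝ) (a b e : MvPowerSeries T ℝ) :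
    jac c Ω a b e = jac c Ω b e a := by
  unfold jac; ring

/-- In this form the first two terms are a commutator of Hamiltonian vector fields applied to `a`,
and the third is another Hamiltonian vector field applied to `a`. Hence no second derivatives of `a`
survive. -/
theorem IsGrading.jac_eq (h : IsGrading wt c) (hΩ : BddComponents wt c Ω)
    (hs : ∀ p q, Ω p q = -Ω q p) (ha : IsBdd wt a) (hb : IsBdd wt b) (he : IsBdd wt e) :
    jac c Ω a b e = br c Ω (br c Ω a b) e - br c Ω (br c Ω a e) b - br c Ω a (br c Ω b e) := by
  rw [jac, h.br_skew hs he ha, h.br_neg_left (hΩ.isBdd_br ha he) hb,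
    h.br_skew hs (hΩ.isBdd_br hb he) ha]
  ring

/-- The Jacobiator is a derivation in each argument. -/
theorem IsGrading.hasFSum_jac (h : IsGrading wt c) (hΩ : BddComponents wt c Ω)
    (hs : ∀ p q, Ω p q = -Ω q p) (ha : IsBdd wt a) (hb : IsBdd wt b) (he : IsBdd wt e) :
    HasFSum (fun p => pderiv ℝ (c p) a * jac c Ω (X (c p)) b e) (jac c Ω a b e) := by
  have hbX : ∀ {b}, IsBdd wt b → ∀ p, IsBdd wt (br c Ω (X (c p)) b) := fun hb p =>
    hΩ.isBdd_br (isBdd_X _) hb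
  have hvb := hΩ.isBdd_br ha hb
  have hve := hΩ.isBdd_br ha he
  have hbe := hΩ.isBdd_br hb he
  have hv := h.vf_comm ha (hbX he) (hbX hb) (by rwa [← h.br_eq_vf ha he])
    (by rwa [← h.br_eq_vf ha hb])
  rw [← h.br_eq_vf ha he, ← h.br_eq_vf ha hb, ← h.br_eq_vf hvb he, ← h.br_eq_vf hve hb] at hv
  rw [h.jac_eq hΩ hs ha hb he, hv, h.br_eq_vf ha hbe]
  refine ((h.hasFSum_vf ha _).sub (h.hasFSum_vf ha _)).congr fun p => ?_
  rw [h.jac_eq hΩ hs (isBdd_X _) hb he, h.br_eq_vf (hbX hb p) he, h.br_eq_vf (hbX he p) hb, mul_sub]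

/-- The derivation property expands the first argument in coordinates. Rotating the arguments
cyclically and repeating this treats the other two. -/
theorem IsGrading.jac_eq_zero (h : IsGrading wt c) (hΩ : BddComponents wt c Ω)
    (hs : ∀ p q, Ω p q = -Ω q p)
    (h0 : ∀ p q r, jac c Ω (X (c p)) (X (c q)) (X (c r)) = 0)
    (ha : IsBdd wt a) (hb : IsBdd wt b) (he : IsBdd wt e) : jac c Ω a b e = 0 := by
  have key : ∀ {a b e : MvPowerSeries T ℝ}, IsBdd wt a → IsBdd wt b → IsBdd wt e →
      (∀ p, jac c Ω (X (c p)) b e = 0) → jac c Ω a b e = 0 := fun ha hb he hz =>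
    (h.hasFSum_jac hΩ hs ha hb he).unique (hasFSum_zero.congr fun p => by rw [hz, mul_zero])
  refine key ha hb he fun p => ?_
  rw [jac_cyclic]
  refine key hb he (isBdd_X _) fun q => ?_
  rw [jac_cyclic]
  refine key he (isBdd_X _) (isBdd_X _) fun r => ?_
  rw [jac_cyclic]
  exact h0 p q r

end Brackets

/-! ### Substitutions -/

section Substitutions

variable {S P T T' : Type} {R : Type*} [CommRing R]

theorem hasSubst_X_comp {c : S → T} (hc : Function.Injective c) :
    HasSubst (fun p => (X (c p) : MvPowerSeries T R)) := by
  classical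
  refine ⟨fun s => by simp, fun d => ?_⟩
  refine Set.Subsingleton.finite fun x hx y hy => hc ?_
  simp only [Set.mem_ofPred_eq, coeff_X] at hx hy
  exact Finsupp.single_left_injective one_ne_zero
    ((ite_ne_right_iff.1 hx).1.symm.trans (ite_ne_right_iff.1 hy).1)

theorem hasSubst_elim {g : S → MvPowerSeries T R} {a : P → MvPowerSeries T R}
    (hg : HasSubst g) (ha : HasSubst a) : HasSubst (Sum.elim g a) := by
  refine ⟨?_, fun d => ?_⟩
  · rintro (s | s)
    exacts [hg.const_coeff s, ha.const_coeff s]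
  · refine (((hg.coeff_zero d).image Sum.inl).union ((ha.coeff_zero d).image Sum.inr)).subset ?_
    rintro (s | s) hs
    exacts [Or.inl ⟨s, hs, rfl⟩, Or.inr ⟨s, hs, rfl⟩]

theorem hasSubst_subst {g : S → MvPowerSeries T R} (hg : HasSubst g)
    {z : T → MvPowerSeries T' R} (hz : HasSubst z) : HasSubst (fun s => subst z (g s)) := by
  simpa using hg.comp hz

theorem comp_elim {α β γ δ : Type*} (f : γ → δ) (g : α → γ) (h : β → γ) :
    (fun s => f (Sum.elim g h s)) = Sum.elim (fun s => f (g s)) (fun s => f (h s)) := by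
  funext s
  cases s <;> rfl

theorem subst_finsetSum {y : S → MvPowerSeries T ℝ} (hy : HasSubst y) {ι : Type*} (F : Finset ι)
    (f : ι → MvPowerSeries S ℝ) : subst y (∑ i ∈ F, f i) = ∑ i ∈ F, subst y (f i) := by
  simp only [← substAlgHom_apply hy, map_sum]

end Substitutions

/-! ### Expansion in part of the variables -/

section Parts

variable {C P : Type}

/-- The inclusion of power series in the coordinates. -/
def incl (h : MvPowerSeries C ℝ) : MvPowerSeries (C ⊕ P) ℝ := subst (fun x => X (Sum.inl x)) h

theorem hasSubst_inl : HasSubst (fun x : C => (X (Sum.inl x) : MvPowerSeries (C ⊕ P) ℝ)) :=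
  hasSubst_X_comp Sum.inl_injective

/-- The coefficient of the monomial `e` in the variables `P`. -/
def part (e : P →₀ ℕ) (h : MvPowerSeries (C ⊕ P) ℝ) : MvPowerSeries C ℝ :=
  fun d => coeff (Finsupp.sumElim d e) h

theorem sumElim_inj {d d' : C →₀ ℕ} {e e' : P →₀ ℕ} :
    Finsupp.sumElim d e = Finsupp.sumElim d' e' ↔ d = d' ∧ e = e' := by
  constructor
  · intro h
    exact ⟨Finsupp.ext fun x => DFunLike.congr_fun h (Sum.inl x),
      Finsupp.ext fun x => DFunLike.congr_fun h (Sum.inr x)⟩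
  · rintro ⟨rfl, rfl⟩; rfl

theorem exists_sumElim (D : C ⊕ P →₀ ℕ) : ∃ d e, D = Finsupp.sumElim d e :=
  ⟨D.comapDomain Sum.inl Sum.inl_injective.injOn, D.comapDomain Sum.inr Sum.inr_injective.injOn,
    by ext (x | x) <;> rfl⟩

variable [Fintype P]

theorem prod_X_inr (e : P →₀ ℕ) :
    (∏ p, (X (Sum.inr p) : MvPowerSeries (C ⊕ P) ℝ) ^ e p) =
      monomial (Finsupp.sumElim 0 e) 1 := by
  classical
  simp only [X_pow_eq]
  rw [show Finsupp.sumElim (0 : C →₀ ℕ) e = ∑ p, Finsupp.single (Sum.inr p) (e p) from ?_]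
  · generalize (Finset.univ : Finset P) = F
    induction F using Finset.induction_on with
    | empty => simp
    | insert p F hp ih =>
      rw [Finset.prod_insert hp, Finset.sum_insert hp, ih, monomial_mul_monomial, one_mul]
  · ext (x | x)
    · simp [Finsupp.finsetSum_apply]
    · simp [Finsupp.finsetSum_apply, Finsupp.single_apply]

/-- Both sides are local functionals of `g`, so it is enough to check a monomial, where the product
is a single monomial on the disjoint union of variables. -/
theorem coeff_incl_mul (g : MvPowerSeries C ℝ) (e e' : P →₀ ℕ) (d : C →₀ ℕ) [Decidable (e' = e)] :
    coeff (Finsupp.sumElim d e') (incl g * ∏ p, X (Sum.inr p) ^ e p) =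
      if e' = e then coeff d g else 0 := by
  classical
  let A : MvPowerSeries C ℝ →+ MvPowerSeries (C ⊕ P) ℝ :=
    (AddMonoidHom.mulLeft (∏ p, X (Sum.inr p) ^ e p)).comp
      (substAlgHom (R := ℝ) hasSubst_inl).toLinearMap.toAddMonoidHom
  have hA : IsLocal A := (isLocal_mulLeft _).comp (isLocal_subst _)
  let B : MvPowerSeries C ℝ →+ ℝ := if e' = e then (coeff d).toAddMonoidHom else 0
  have hB : LocalFun B := by
    refine ⟨{d}, fun a ha => ?_⟩
    have := ha d (Finset.mem_singleton_self d)
    simp only [B]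
    split_ifs
    · exact this
    · rfl
  have := LocalFun.ext (hA (Finsupp.sumElim d e')) hB fun x r => ?_
  · have := DFunLike.congr_fun this g
    change coeff (Finsupp.sumElim d e') ((∏ p, X (Sum.inr p) ^ e p) *
      substAlgHom (R := ℝ) hasSubst_inl g) = B g at this
    rw [substAlgHom_apply] at this
    rw [mul_comm, incl, this]
    simp only [B]
    split_ifs <;> rfl
  · change coeff (Finsupp.sumElim d e') ((∏ p, X (Sum.inr p) ^ e p) *
      substAlgHom (R := ℝ) hasSubst_inl (monomial x r)) = B (monomial x r)
    have hx : substAlgHom (R := ℝ) hasSubst_inl (monomial x r) =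
        (monomial (Finsupp.sumElim x 0) r : MvPowerSeries (C ⊕ P) ℝ) := by
      rw [substAlgHom_monomial, ← Algebra.smul_def]
      rw [show (monomial (Finsupp.sumElim x (0 : P →₀ ℕ)) r : MvPowerSeries (C ⊕ P) ℝ) =
        r • monomial (Finsupp.sumElim x (0 : P →₀ ℕ)) 1 by rw [← map_smul, smul_eq_mul, mul_one]]
      congr 1
      simp only [X_pow_eq, Finsupp.prod]
      rw [show Finsupp.sumElim x (0 : P →₀ ℕ) =
        ∑ p ∈ x.support, Finsupp.single (Sum.inl p) (x p) from ?_]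
      · generalize x.support = F
        induction F using Finset.induction_on with
        | empty => simp
        | insert p F hp ih =>
          rw [Finset.prod_insert hp, Finset.sum_insert hp, ih, monomial_mul_monomial, one_mul]
      · ext (y | y)
        · simp [Finsupp.finsetSum_apply, Finsupp.single_apply]
        · simp [Finsupp.finsetSum_apply]
    rw [hx, prod_X_inr, monomial_mul_monomial, one_mul, ← Finsupp.sumElim_add, zero_add, add_zero,
      coeff_monomial]
    simp only [sumElim_inj, B]
    by_cases he : e' = e
    · simp only [he, and_true, if_true]
      exact (coeff_monomial _ _ _).symm
    · simp [he]

theorem hasFSum_part (h : MvPowerSeries (C ⊕ P) ℝ) :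
    HasFSum (fun e : P →₀ ℕ => incl (part e h) * ∏ p, X (Sum.inr p) ^ e p) h := by
  classical
  have hs : FormallySummable (fun e : P →₀ ℕ =>
      incl (part e h) * ∏ p, (X (Sum.inr p) : MvPowerSeries (C ⊕ P) ℝ) ^ e p) := by
    intro D
    obtain ⟨d, e', rfl⟩ := exists_sumElim D
    refine (Set.finite_singleton e').subset fun e he => ?_
    simp only [Set.mem_ofPred_eq, coeff_incl_mul] at he
    exact (ite_ne_right_iff.1 he).1.symm
  refine ⟨hs, ?_⟩
  ext D
  obtain ⟨d, e', rfl⟩ := exists_sumElim D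
  rw [hs.coeff_eq_sum _ {e'}, Finset.sum_singleton, coeff_incl_mul, if_pos rfl]
  · rfl
  · intro e he
    rw [coeff_incl_mul, if_neg fun h => he (Finset.mem_singleton.2 h.symm)]

/-- Uniqueness of the expansion in the variables `P`. It converts identities between generating
series in the points into identities between functions of the coordinates. -/
theorem part_eq_of_hasFSum {g : (P →₀ ℕ) → MvPowerSeries C ℝ} {h : MvPowerSeries (C ⊕ P) ℝ}
    (hg : HasFSum (fun e : P →₀ ℕ => incl (g e) * ∏ p, X (Sum.inr p) ^ e p) h) (e : P →₀ ℕ) :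
    part e h = g e := by
  classical
  ext d
  change coeff (Finsupp.sumElim d e) h = _
  rw [← hg.2, hg.1.coeff_eq_sum _ {e}, Finset.sum_singleton, coeff_incl_mul, if_pos rfl]
  intro e' he
  rw [coeff_incl_mul, if_neg fun h => he (Finset.mem_singleton.2 h.symm)]

end Parts

/-! ### Monomials and exponents for several points -/

section Exponents

variable {m k : ℕ} {T : Type}

/-- The monomial `a^I`. -/
def pw (a : Fin m → MvPowerSeries T ℝ) (I : Fin m →₀ ℕ) : MvPowerSeries T ℝ := ∏ μ, a μ ^ I μ

theorem subst_pw {T' : Type} {z : T → MvPowerSeries T' ℝ} (hz : HasSubst z)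
    (a : Fin m → MvPowerSeries T ℝ) (I : Fin m →₀ ℕ) :
    subst z (pw a I) = pw (fun μ => subst z (a μ)) I := by
  simp only [pw, ← substAlgHom_apply hz, map_prod, map_pow]

theorem pderiv_pw_eq_zero {a : Fin m → MvPowerSeries T ℝ} {t : T}
    (h : ∀ μ, pderiv ℝ t (a μ) = 0) (I : Fin m →₀ ℕ) : pderiv ℝ t (pw a I) = 0 := by
  classical
  rw [pw]
  generalize (Finset.univ : Finset (Fin m)) = F
  induction F using Finset.induction_on with
  | empty => exact pderiv_one
  | insert μ F hμ ih =>
    rw [Finset.prod_insert hμ, Derivation.leibniz, ih, Derivation.leibniz_pow, h, smul_zero,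
      smul_zero, smul_zero, smul_zero, add_zero]

/-- Exponents for `k` points. -/
def exps (m k : ℕ) : (Fin k → (Fin m →₀ ℕ)) ≃ (Fin k × Fin m →₀ ℕ) where
  toFun E := Finsupp.equivFunOnFinite.symm fun p => E p.1 p.2
  invFun e r := Finsupp.equivFunOnFinite.symm fun μ => e (r, μ)
  left_inv E := by
    funext r; ext μ; rfl
  right_inv e := by
    ext p; rfl

theorem prod_exps (a : Fin k → Fin m → MvPowerSeries T ℝ) (E : Fin k → (Fin m →₀ ℕ)) :
    ∏ p : Fin k × Fin m, a p.1 p.2 ^ exps m k E p = ∏ r, pw (a r) (E r) := by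
  rw [Fintype.prod_prod_type]; rfl

theorem exps_two (I J : Fin m →₀ ℕ) :
    exps m 2 ![I, J] = I.mapDomain (fun μ => ((0 : Fin 2), μ)) +
      J.mapDomain (fun μ => ((1 : Fin 2), μ)) := by
  ext ⟨r, μ⟩
  have h0 : Function.Injective fun μ : Fin m => ((0 : Fin 2), μ) := fun _ _ h => (Prod.mk.inj h).2
  have h1 : Function.Injective fun μ : Fin m => ((1 : Fin 2), μ) := fun _ _ h => (Prod.mk.inj h).2
  change (![I, J] : Fin 2 → (Fin m →₀ ℕ)) r μ = _
  rw [Finsupp.add_apply]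
  fin_cases r
  · change I μ = Finsupp.mapDomain _ I ((fun μ => ((0 : Fin 2), μ)) μ) + _
    rw [Finsupp.mapDomain_apply h0, Finsupp.mapDomain_of_notMem_range, add_zero]
    rintro ⟨x, hx⟩
    exact absurd (Prod.mk.inj hx).1 (by decide)
  · change J μ = _ + Finsupp.mapDomain _ J ((fun μ => ((1 : Fin 2), μ)) μ)
    rw [Finsupp.mapDomain_apply h1, Finsupp.mapDomain_of_notMem_range, zero_add]
    rintro ⟨x, hx⟩
    exact absurd (Prod.mk.inj hx).1 (by decide)

/-- Pairs as functions on `Fin 2`. -/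
def pairEquiv (α : Type) : α × α ≃ (Fin 2 → α) where
  toFun x := ![x.1, x.2]
  invFun f := (f 0, f 1)
  left_inv _ := rfl
  right_inv f := by funext i; fin_cases i <;> rfl

/-- Triples as functions on `Fin 3`. -/
def tripleEquiv (α : Type) : α × α × α ≃ (Fin 3 → α) where
  toFun x := ![x.1, x.2.1, x.2.2]
  invFun f := (f 0, f 1, f 2)
  left_inv _ := rfl
  right_inv f := by funext i; fin_cases i <;> rfl

end Exponents

/-! ### Generic maps -/

section Generic

variable {m n : ℕ} {T T' : Type}

/-- The universal generic map at the universal point. -/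
def univMap (m n : ℕ) (i : Fin n) : MvPowerSeries (Coord m n ⊕ Fin m) ℝ :=
  genericMap Sum.inl (fun μ => X (Sum.inr μ)) i

/-- `F^i(a)` for the formal map `F` with coefficients `g`. -/
def ev (g : Coord m n → MvPowerSeries T ℝ) (a : Fin m → MvPowerSeries T ℝ) (i : Fin n) :
    MvPowerSeries T ℝ := subst (Sum.elim g a) (univMap m n i)

/-- `(F_{*a})^i_μ` for the formal map `F` with coefficients `g`. -/
def dev (g : Coord m n → MvPowerSeries T ℝ) (a : Fin m → MvPowerSeries T ℝ) (i : Fin n)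
    (μ : Fin m) : MvPowerSeries T ℝ :=
  subst (Sum.elim g a) (pderiv ℝ (Sum.inr μ) (univMap m n i))

/-- The tensor `Π` for the formal map with coefficients `g`, at the points `a`, `b`. -/
def evPi (φm : TwoTensor m) (φn : TwoTensor n) (g : Coord m n → MvPowerSeries T ℝ)
    (a b : Fin m → MvPowerSeries T ℝ) (i j : Fin n) : MvPowerSeries T ℝ :=
  (∑ μ, ∑ ν, dev g a i μ * dev g b j ν * φm.at μ ν a b) - φn.at i j (ev g a) (ev g b)

variable {g : Coord m n → MvPowerSeries T ℝ} {a b : Fin m → MvPowerSeries T ℝ}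

theorem hasFSum_genericMap {c : Coord m n → T} (hc : Function.Injective c)
    (a : Fin m → MvPowerSeries T ℝ) (i : Fin n) :
    HasFSum (fun I => X (c (i, I)) * pw a I) (genericMap c a i) := by
  classical
  refine FormallySummable.hasFSum (FormallySummable.mul_any (fun d => ?_) _)
  exact (hasSubst_X_comp (R := ℝ) (c := fun I => c (i, I))
    fun I J h => (Prod.mk.inj (hc h)).2).coeff_zero d

theorem hasFSum_ev (hg : HasSubst g) (ha : HasSubst a) (i : Fin n) :
    HasFSum (fun I => g (i, I) * pw a I) (ev g a i) := by
  have hz := hasSubst_elim hg ha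
  refine ((hasFSum_genericMap Sum.inl_injective _ i).subst hz).congr fun I => ?_
  rw [subst_mul hz, subst_X hz, subst_pw hz]
  simp only [subst_X hz, Sum.elim_inl, Sum.elim_inr]

theorem genericMap_eq_ev {c : Coord m n → T} (hc : Function.Injective c) (ha : HasSubst a) :
    genericMap c a = ev (fun p => X (c p)) a := by
  funext i
  exact (hasFSum_genericMap hc a i).unique (hasFSum_ev (hasSubst_X_comp hc) ha i)

theorem constantCoeff_univMap (i : Fin n) : constantCoeff (univMap m n i) = 0 := by
  rw [← coeff_zero_eq_constantCoeff_apply, univMap, ← (hasFSum_genericMap Sum.inl_injective _ i).2,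
    coeff_formalSum]
  exact finsum_eq_zero_of_forall_eq_zero fun I => by simp

/-- The constant coefficient $f^i_0$ of the generic map is itself a variable, so `univMap` has no
constant term and all compositions of generic maps are defined. -/
theorem hasSubst_ev (hg : HasSubst g) (ha : HasSubst a) : HasSubst (ev g a) :=
  hasSubst_of_constantCoeff_nilpotent fun i => IsNilpotent_subst (hasSubst_elim hg ha)
    (by rw [constantCoeff_univMap]; exact IsNilpotent.zero)

section Subst

variable {z : T → MvPowerSeries T' ℝ}

theorem subst_ev (hz : HasSubst z) (hg : HasSubst g) (ha : HasSubst a) (i : Fin n) :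
    subst z (ev g a i) = ev (fun p => subst z (g p)) (fun μ => subst z (a μ)) i := by
  rw [ev, subst_comp_subst_apply (hasSubst_elim hg ha) hz, comp_elim, ev]

theorem subst_dev (hz : HasSubst z) (hg : HasSubst g) (ha : HasSubst a) (i : Fin n) (μ : Fin m) :
    subst z (dev g a i μ) = dev (fun p => subst z (g p)) (fun μ => subst z (a μ)) i μ := by
  rw [dev, subst_comp_subst_apply (hasSubst_elim hg ha) hz, comp_elim, dev]

theorem subst_at (φ : TwoTensor n) {a b : Fin n → MvPowerSeries T ℝ} (hz : HasSubst z)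
    (ha : HasSubst a) (hb : HasSubst b) (i j : Fin n) :
    subst z (φ.at i j a b) = φ.at i j (fun μ => subst z (a μ)) (fun μ => subst z (b μ)) := by
  rw [TwoTensor.at, subst_comp_subst_apply (hasSubst_elim ha hb) hz, comp_elim, TwoTensor.at]

theorem subst_evPi (φm : TwoTensor m) (φn : TwoTensor n) (hz : HasSubst z) (hg : HasSubst g)
    (ha : HasSubst a) (hb : HasSubst b) (i j : Fin n) :
    subst z (evPi φm φn g a b i j) =
      evPi φm φn (fun p => subst z (g p)) (fun μ => subst z (a μ)) (fun μ => subst z (b μ)) i j := by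
  rw [evPi, subst_sub hz, subst_at φn hz (hasSubst_ev hg ha) (hasSubst_ev hg hb), evPi]
  simp only [subst_finsetSum hz, subst_mul hz, subst_dev hz hg ha, subst_dev hz hg hb,
    subst_ev hz hg ha, subst_ev hz hg hb, subst_at φm hz ha hb]

end Subst

theorem pderiv_univMap_inl (p : Coord m n) (i : Fin n) :
    pderiv ℝ (Sum.inl p) (univMap m n i) =
      if p.1 = i then pw (fun μ => X (Sum.inr μ)) p.2 else 0 := by
  classical
  have hX : ∀ I, pderiv ℝ (Sum.inl p) (pw (fun μ : Fin m =>
      (X (Sum.inr μ) : MvPowerSeries (Coord m n ⊕ Fin m) ℝ)) I) = 0 := by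
    intro I
    exact pderiv_pw_eq_zero (fun μ => pderiv_X_of_ne Sum.inr_ne_inl) I
  have hD : ∀ I, pderiv ℝ (Sum.inl p) (X (Sum.inl (i, I)) *
      pw (fun μ : Fin m => (X (Sum.inr μ) : MvPowerSeries (Coord m n ⊕ Fin m) ℝ)) I) =
      if p = (i, I) then pw (fun μ => X (Sum.inr μ)) I else 0 := by
    intro I
    rw [Derivation.leibniz, hX, smul_zero, zero_add, pderiv_X, smul_eq_mul]
    by_cases h : p = (i, I)
    · rw [if_pos h, h, Pi.single_eq_same, mul_one]
    · rw [if_neg h, Pi.single_eq_of_ne (fun h' => h (Sum.inl_injective h').symm), mul_zero]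
  have := ((hasFSum_genericMap Sum.inl_injective _ i).pderiv (Sum.inl p)).eq_sum {p.2} fun I hI => by
    rw [hD, if_neg]
    rintro rfl
    exact hI (Finset.mem_singleton_self _)
  rw [univMap, this, Finset.sum_singleton, hD]
  by_cases h : p.1 = i
  · subst h; simp
  · rw [if_neg h, if_neg fun h' => h (congrArg Prod.fst h')]

theorem subst_pderiv_univMap_inl (hg : HasSubst g) (ha : HasSubst a) (p : Coord m n) (i : Fin n) :
    subst (Sum.elim g a) (pderiv ℝ (Sum.inl p) (univMap m n i)) =
      if p.1 = i then pw a p.2 else 0 := by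
  have hz := hasSubst_elim hg ha
  rw [pderiv_univMap_inl]
  split_ifs
  · rw [subst_pw hz]
    simp only [subst_X hz, Sum.elim_inr]
  · rw [← substAlgHom_apply hz, map_zero]

/-- The value depends on `t` through the coefficients of the map and through the point. The
coefficients are infinitely many, so the finite set `F` records those that involve `t`. -/
theorem pderiv_ev (hg : HasSubst g) (ha : HasSubst a) (t : T) (F : Finset (Coord m n))
    (hF : ∀ p ∉ F, pderiv ℝ t (g p) = 0) (i : Fin n) :
    pderiv ℝ t (ev g a i) = (∑ p ∈ F, (if p.1 = i then pw a p.2 else 0) * pderiv ℝ t (g p)) +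
      ∑ μ, dev g a i μ * pderiv ℝ t (a μ) := by
  rw [ev, pderiv_subst_of_pderiv_eq_zero (hasSubst_elim hg ha) t (F.disjSum Finset.univ),
    Finset.sum_disjSum]
  · simp only [subst_pderiv_univMap_inl hg ha, Sum.elim_inl, Sum.elim_inr]
    rfl
  · rintro (p | μ) hp
    · exact hF p fun h => hp (Finset.inl_mem_disjSum.2 h)
    · exact absurd (Finset.inr_mem_disjSum.2 (Finset.mem_univ μ)) hp

theorem pderiv_ev_of_const (hg : HasSubst g) (ha : HasSubst a) (t : T)
    (h : ∀ p, pderiv ℝ t (g p) = 0) (i : Fin n) :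
    pderiv ℝ t (ev g a i) = ∑ μ, dev g a i μ * pderiv ℝ t (a μ) := by
  rw [pderiv_ev hg ha t ∅ fun p _ => h p, Finset.sum_empty, zero_add]

theorem pderiv_ev_coord {c : Coord m n → T} (hc : Function.Injective c) (ha : HasSubst a)
    (p : Coord m n) (i : Fin n) :
    pderiv ℝ (c p) (ev (fun p => X (c p)) a i) = (if p.1 = i then pw a p.2 else 0) +
      ∑ μ, dev (fun p => X (c p)) a i μ * pderiv ℝ (c p) (a μ) := by
  rw [pderiv_ev (hasSubst_X_comp hc) ha (c p) {p} (fun q hq => pderiv_X_of_ne fun h =>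
    hq (Finset.mem_singleton.2 (hc h))), Finset.sum_singleton, pderiv_X_self, mul_one]

end Generic

/-! ### Points -/

section Points

variable {C : Type} {m k : ℕ}

/-- The `r`-th point, over an arbitrary set of coordinates. -/
def pt (C : Type) {m k : ℕ} (r : Fin k) : Fin m → MvPowerSeries (C ⊕ (Fin k × Fin m)) ℝ :=
  fun μ => X (Sum.inr (r, μ))

theorem hasSubst_pt (r : Fin k) : HasSubst (pt C r : Fin m → _) :=
  hasSubst_X_comp fun _ _ h => (Prod.mk.inj (Sum.inr_injective h)).2

theorem prod_X_exps (E : Fin k → (Fin m →₀ ℕ)) :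
    (∏ p, (X (Sum.inr p) : MvPowerSeries (C ⊕ (Fin k × Fin m)) ℝ) ^ exps m k E p) =
      ∏ r, pw (pt C r) (E r) :=
  prod_exps (fun r => pt C r) E

theorem hasFSum_part_two (H : MvPowerSeries (C ⊕ (Fin 2 × Fin m)) ℝ) :
    HasFSum (fun x : (Fin m →₀ ℕ) × (Fin m →₀ ℕ) =>
      incl (part (exps m 2 ![x.1, x.2]) H) * (pw (pt C 0) x.1 * pw (pt C 1) x.2)) H :=
  ((hasFSum_part H).equiv ((pairEquiv _).trans (exps m 2))).congr fun x => by
    rw [Equiv.trans_apply, prod_X_exps, Fin.prod_univ_two]; rfl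

theorem part_two {H : MvPowerSeries (C ⊕ (Fin 2 × Fin m)) ℝ}
    {g : (Fin m →₀ ℕ) → (Fin m →₀ ℕ) → MvPowerSeries C ℝ}
    (h : HasFSum (fun x : (Fin m →₀ ℕ) × (Fin m →₀ ℕ) =>
      incl (g x.1 x.2) * (pw (pt C 0) x.1 * pw (pt C 1) x.2)) H) (I J : Fin m →₀ ℕ) :
    part (exps m 2 ![I, J]) H = g I J := by
  have := part_eq_of_hasFSum (C := C) (h := H)
    (g := fun e => g ((exps m 2).symm e 0) ((exps m 2).symm e 1)) ?_ (exps m 2 ![I, J])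
  · rw [this, Equiv.symm_apply_apply]; rfl
  · refine (h.equiv ((pairEquiv _).trans (exps m 2)).symm).congr fun e => ?_
    obtain ⟨E, rfl⟩ := (exps m 2).surjective e
    rw [prod_X_exps, Fin.prod_univ_two, Equiv.symm_trans_apply, Equiv.symm_apply_apply]; rfl

theorem part_three {H : MvPowerSeries (C ⊕ (Fin 3 × Fin m)) ℝ}
    {g : (Fin m →₀ ℕ) → (Fin m →₀ ℕ) → (Fin m →₀ ℕ) → MvPowerSeries C ℝ}
    (h : HasFSum (fun x : (Fin m →₀ ℕ) × (Fin m →₀ ℕ) × (Fin m →₀ ℕ) =>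
      incl (g x.1 x.2.1 x.2.2) * (pw (pt C 0) x.1 * pw (pt C 1) x.2.1 * pw (pt C 2) x.2.2)) H)
    (I J K : Fin m →₀ ℕ) : part (exps m 3 ![I, J, K]) H = g I J K := by
  have := part_eq_of_hasFSum (C := C) (h := H)
    (g := fun e => g ((exps m 3).symm e 0) ((exps m 3).symm e 1) ((exps m 3).symm e 2)) ?_
    (exps m 3 ![I, J, K])
  · rw [this, Equiv.symm_apply_apply]; rfl
  · refine (h.equiv ((tripleEquiv _).trans (exps m 3)).symm).congr fun e => ?_
    obtain ⟨E, rfl⟩ := (exps m 3).surjective e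
    rw [prod_X_exps, Fin.prod_univ_three, Equiv.symm_trans_apply, Equiv.symm_apply_apply]; rfl

end Points

/-! ### The tensor `Π` and its components -/

section Tensor

variable {m n k : ℕ} {T : Type} {g : Coord m n → MvPowerSeries T ℝ}
  {a b : Fin m → MvPowerSeries T ℝ} (φm : TwoTensor m) (φn : TwoTensor n)

theorem hasSubst_coord : HasSubst (fun p : Coord m n => (X (Sum.inl p) : MvPowerSeries (Vars m n k) ℝ)) :=
  hasSubst_X_comp Sum.inl_injective

theorem jet_eq (r : Fin k) : jet m n r = ev (fun p => X (Sum.inl p)) (pt (Coord m n) r) :=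
  genericMap_eq_ev Sum.inl_injective (hasSubst_pt r)

theorem hasSubst_jet (r : Fin k) : HasSubst (jet m n r) := by
  rw [jet_eq]; exact hasSubst_ev hasSubst_coord (hasSubst_pt r)

theorem pderiv_pt (C : Type) (r : Fin k) (μ ν : Fin m) :
    pderiv ℝ (Sum.inr (r, μ)) (pt C r ν) = if ν = μ then 1 else 0 := by
  classical
  split_ifs with h
  · rw [h]; exact pderiv_X_self
  · exact pderiv_X_of_ne fun h' => h (Prod.mk.inj (Sum.inr_injective h')).2

theorem pderiv_pt_of_ne (C : Type) {r s : Fin k} (hrs : r ≠ s) (μ ν : Fin m) :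
    pderiv ℝ (Sum.inr (r, μ)) (pt C s ν) = 0 :=
  pderiv_X_of_ne fun h' => hrs (Prod.mk.inj (Sum.inr_injective h')).1.symm

theorem jetDeriv_eq (r : Fin k) (i : Fin n) (μ : Fin m) :
    jetDeriv m n r i μ = dev (fun p => X (Sum.inl p)) (pt (Coord m n) r) i μ := by
  rw [jetDeriv, jet_eq, pderiv_ev_of_const hasSubst_coord (hasSubst_pt r) _
    fun p => pderiv_X_of_ne Sum.inl_ne_inr]
  simp only [pderiv_pt, mul_ite, mul_one, mul_zero, Finset.sum_ite_eq', Finset.mem_univ, if_true]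

theorem tensorPi_eq (r s : Fin k) (i j : Fin n) :
    tensorPi φm φn r s i j =
      evPi φm φn (fun p => X (Sum.inl p)) (pt (Coord m n) r) (pt (Coord m n) s) i j := by
  simp only [tensorPi, evPi, jetDeriv_eq, jet_eq]
  rfl

theorem components_eq (p q : Coord m n) :
    components φm φn p q = part (exps m 2 ![p.2, q.2]) (tensorPi φm φn (0 : Fin 2) 1 p.1 q.1) := by
  rw [exps_two]; rfl

/-- For the generic map at two generic points this is the definition of the components. The general
case follows by substitution, which commutes with formal sums and with the formation of $\Pi$. -/
theorem hasFSum_evPi (hg : HasSubst g) (ha : HasSubst a) (hb : HasSubst b) (i j : Fin n) :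
    HasFSum (fun x : (Fin m →₀ ℕ) × (Fin m →₀ ℕ) =>
      subst g (components φm φn (i, x.1) (j, x.2)) * (pw a x.1 * pw b x.2))
      (evPi φm φn g a b i j) := by
  let y : Fin 2 × Fin m → MvPowerSeries T ℝ := fun p => (![a, b] : Fin 2 → _) p.1 p.2
  have hy : HasSubst y := hasSubst_of_constantCoeff_nilpotent fun ⟨r, μ⟩ => by
    fin_cases r
    exacts [ha.const_coeff μ, hb.const_coeff μ]
  have hz := hasSubst_elim hg hy
  have h := (hasFSum_part_two (tensorPi φm φn (0 : Fin 2) 1 i j)).subst hz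
  have hX : ∀ s, subst (Sum.elim g y) (X s : MvPowerSeries _ ℝ) = Sum.elim g y s := subst_X hz
  have h0 : (fun μ => subst (Sum.elim g y) (pt (Coord m n) (0 : Fin 2) μ)) = a :=
    funext fun μ => hX _
  have h1 : (fun μ => subst (Sum.elim g y) (pt (Coord m n) (1 : Fin 2) μ)) = b :=
    funext fun μ => hX _
  have hc : (fun p => subst (Sum.elim g y)
      (X (Sum.inl p) : MvPowerSeries (Vars m n 2) ℝ)) = g := funext fun p => hX _
  rw [tensorPi_eq φm φn (0 : Fin 2) 1 i j,
    subst_evPi φm φn hz hasSubst_coord (hasSubst_pt 0) (hasSubst_pt 1), h0, h1, hc] at h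
  refine HasFSum.congr h fun x => ?_
  rw [subst_mul hz, subst_mul hz, subst_pw hz, subst_pw hz, incl,
    subst_comp_subst_apply hasSubst_inl hz, h0, h1, hc, components_eq, tensorPi_eq]

variable {φm φn}

theorem TwoTensor.IsSkew.at_eq {φ : TwoTensor n} (hφ : φ.IsSkew) {a b : Fin n → MvPowerSeries T ℝ}
    (ha : HasSubst a) (hb : HasSubst b) (i j : Fin n) : φ.at i j a b = -φ.at j i b a := by
  have hz := hasSubst_elim ha hb
  rw [TwoTensor.at, hφ i j, ← substAlgHom_apply hz, map_neg, substAlgHom_apply,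
    subst_at φ hz (hasSubst_X_comp Sum.inr_injective) (hasSubst_X_comp Sum.inl_injective)]
  simp only [subst_X hz, Sum.elim_inl, Sum.elim_inr]

theorem evPi_skew (hm : φm.IsSkew) (hn : φn.IsSkew) (hg : HasSubst g) (ha : HasSubst a)
    (hb : HasSubst b) (i j : Fin n) :
    evPi φm φn g a b i j = -evPi φm φn g b a j i := by
  rw [evPi, evPi, hn.at_eq (hasSubst_ev hg ha) (hasSubst_ev hg hb), Finset.sum_comm, neg_sub',
    ← Finset.sum_neg_distrib]
  congr 1
  refine Finset.sum_congr rfl fun μ _ => ?_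
  rw [← Finset.sum_neg_distrib]
  refine Finset.sum_congr rfl fun ν _ => ?_
  rw [hm.at_eq ha hb]; ring

/-- Skewness of $\Pi$ under exchange of the points passes to its coefficients by uniqueness of the
expansion. -/
theorem components_skew (hm : φm.IsSkew) (hn : φn.IsSkew) (p q : Coord m n) :
    components φm φn p q = -components φm φn q p := by
  rw [components_eq]
  refine part_two (g := fun I J => -components φm φn (q.1, J) (p.1, I)) ?_ p.2 q.2
  rw [tensorPi_eq, evPi_skew hm hn hasSubst_coord (hasSubst_pt 0) (hasSubst_pt 1)]
  have h := (hasFSum_evPi φm φn hasSubst_coord (hasSubst_pt (C := Coord m n) (m := m) (1 : Fin 2))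
    (hasSubst_pt 0) q.1 p.1).neg.equiv (Equiv.prodComm _ _)
  refine h.congr fun x => ?_
  simp only [Equiv.prodComm_apply, Prod.fst_swap, Prod.snd_swap, incl]
  rw [← substAlgHom_apply hasSubst_inl, map_neg, substAlgHom_apply]
  ring

end Tensor

/-! ### Weights on the jet space -/

section JetWeights

variable {m n k : ℕ} {T : Type} {φm : TwoTensor m} {φn : TwoTensor n}

/-- The degree of the coordinate `f^i_I`. -/
def coordWt (p : Coord m n) : ℤ := p.2.degree

/-- Weights of coordinates and points. -/
def varsWt {P : Type} : Coord m n ⊕ P → ℤ := Sum.elim coordWt fun _ => -1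

theorem isGrading_of_coordWt {wt : T → ℤ} {c : Coord m n → T} (hc : Function.Injective c) (s : ℤ)
    (h : ∀ p, wt (c p) = coordWt p + s) : IsGrading wt c := by
  refine ⟨hc, fun N => ?_⟩
  refine (Set.Finite.prod (Set.finite_univ (α := Fin n))
    (Finsupp.finite_of_degree_le (σ := Fin m) (N - s).toNat)).subset fun p hp => ?_
  refine ⟨trivial, ?_⟩
  have : wt (c p) ≤ N := hp
  rw [h, coordWt] at this
  change p.2.degree ≤ _
  omega

theorem isGrading_id : IsGrading (coordWt (m := m) (n := n)) id :=
  isGrading_of_coordWt Function.injective_id 0 fun _ => (add_zero _).symm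

theorem isGrading_inl {P : Type} :
    IsGrading (varsWt (m := m) (n := n) (P := P)) Sum.inl :=
  isGrading_of_coordWt Sum.inl_injective 0 fun _ => (add_zero _).symm

theorem Bdd.pw {wt : T → ℤ} {a : Fin m → MvPowerSeries T ℝ} {κ : ℤ}
    (h : ∀ μ, Bdd wt κ (a μ)) (I : Fin m →₀ ℕ) : Bdd wt (I.degree * κ) (pw a I) := by
  refine (Bdd.prod Finset.univ fun μ => (h μ).pow (I μ)).mono (le_of_eq ?_)
  rw [Finsupp.degree_eq_sum, Nat.cast_sum, Finset.sum_mul]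

/-- Each term $f^i_I a^I$ has weight exactly `s`, since `ε` times the degree cancels against the
points. The scale `ε` and the shift `s` stay free because the action map is studied with several
such weights. -/
theorem bdd_univMap (ε s : ℤ) (i : Fin n) :
    Bdd (Sum.elim (fun p => ε * coordWt p + s) fun _ => -ε) s (univMap m n i) := by
  refine Bdd.formalSum fun I => ?_
  have h1 : Bdd (Sum.elim (fun p => ε * coordWt p + s) fun _ => -ε) (ε * coordWt (i, I) + s)
      (X (Sum.inl (i, I)) : MvPowerSeries (Coord m n ⊕ Fin m) ℝ) := bdd_X _
  have h2 : Bdd (Sum.elim (fun p : Coord m n => ε * coordWt p + s) fun _ => -ε) (I.degree * -ε)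
      (pw (fun μ => (X (Sum.inr μ) : MvPowerSeries (Coord m n ⊕ Fin m) ℝ)) I) :=
    Bdd.pw (fun μ => bdd_X (Sum.inr μ)) I
  refine (h1.mul h2).mono (le_of_eq ?_)
  rw [coordWt]; ring

theorem bdd_ev_of_scaled {wt : T → ℤ} {g : Coord m n → MvPowerSeries T ℝ}
    {a : Fin m → MvPowerSeries T ℝ} (hg : HasSubst g) (ha : HasSubst a) (ε : ℤ) {s : ℤ}
    (hgb : ∀ p, Bdd wt (ε * coordWt p + s) (g p)) (hab : ∀ μ, Bdd wt (-ε) (a μ)) (i : Fin n) :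
    Bdd wt s (ev g a i) :=
  (bdd_univMap ε s i).subst (hasSubst_elim hg ha) (by rintro (p | μ); exacts [hgb p, hab μ])

theorem bdd_ev {wt : T → ℤ} {g : Coord m n → MvPowerSeries T ℝ} {a : Fin m → MvPowerSeries T ℝ}
    (hg : HasSubst g) (ha : HasSubst a) {s : ℤ} (hgb : ∀ p, Bdd wt (coordWt p + s) (g p))
    (hab : ∀ μ, Bdd wt (-1) (a μ)) (i : Fin n) : Bdd wt s (ev g a i) :=
  bdd_ev_of_scaled hg ha 1 (by simpa only [one_mul] using hgb) hab i

theorem bdd_dev {wt : T → ℤ} {g : Coord m n → MvPowerSeries T ℝ} {a : Fin m → MvPowerSeries T ℝ}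
    (hg : HasSubst g) (ha : HasSubst a) {s : ℤ} (hgb : ∀ p, Bdd wt (coordWt p + s) (g p))
    (hab : ∀ μ, Bdd wt (-1) (a μ)) (i : Fin n) (μ : Fin m) : Bdd wt (s + 1) (dev g a i μ) :=
  (((bdd_univMap 1 s i).pderiv (Sum.inr μ)).mono (by simp)).subst (hasSubst_elim hg ha)
    (by rintro (p | μ); exacts [by simpa only [Sum.elim_inl, one_mul] using hgb p, hab μ])

theorem bdd_subst_of_nonpos {S : Type} {wt : T → ℤ} {y : S → MvPowerSeries T ℝ} (hy : HasSubst y)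
    (hw : ∀ s, Bdd wt 0 (y s)) (f : MvPowerSeries S ℝ) : Bdd wt 0 (subst y f) :=
  (bdd_zero_weight f).subst hy hw

theorem bdd_at {wt : T → ℤ} (φ : TwoTensor n) {a b : Fin n → MvPowerSeries T ℝ} (ha : HasSubst a)
    (hb : HasSubst b) (hab : ∀ i, Bdd wt 0 (a i)) (hbb : ∀ i, Bdd wt 0 (b i)) (i j : Fin n) :
    Bdd wt 0 (φ.at i j a b) :=
  bdd_subst_of_nonpos (hasSubst_elim ha hb) (by rintro (p | μ); exacts [hab p, hbb μ]) _

theorem bdd_coord (p : Coord m n) :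
    Bdd (varsWt (P := Fin k × Fin m)) (coordWt p + 0) (X (Sum.inl p)) := by
  rw [add_zero]; exact bdd_X _

theorem bdd_pt (r : Fin k) (μ : Fin m) :
    Bdd (varsWt (P := Fin k × Fin m)) (-1) (pt (Coord m n) r μ) := bdd_X _

theorem bdd_jet (r : Fin k) (i : Fin n) : Bdd varsWt 0 (jet m n r i) := by
  rw [jet_eq]; exact bdd_ev hasSubst_coord (hasSubst_pt r) bdd_coord (bdd_pt r) i

theorem bdd_jetDeriv (r : Fin k) (i : Fin n) (μ : Fin m) : Bdd varsWt 1 (jetDeriv m n r i μ) := by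
  rw [jetDeriv_eq]; exact bdd_dev hasSubst_coord (hasSubst_pt r) bdd_coord (bdd_pt r) i μ

/-- Each Jacobian factor contributes at most 1, and the values of $\varphi_m$ and $\varphi_n$ at
most 0, because points and jets have nonpositive weight. -/
theorem bdd_tensorPi (φm : TwoTensor m) (φn : TwoTensor n) (r s : Fin k) (i j : Fin n) :
    Bdd varsWt 2 (tensorPi φm φn r s i j) := by
  refine Bdd.sub (Bdd.sum _ fun μ => Bdd.sum _ fun ν => ?_) ?_
  · exact ((bdd_jetDeriv r i μ).mul (bdd_jetDeriv s j ν)).mul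
      (bdd_at φm (hasSubst_pt r) (hasSubst_pt s) (fun μ => (bdd_pt r μ).mono (by norm_num))
        (fun μ => (bdd_pt s μ).mono (by norm_num)) μ ν)
  · exact (bdd_at φn (hasSubst_jet r) (hasSubst_jet s) (bdd_jet r) (bdd_jet s) i j).mono
      (by norm_num)

theorem weight_sumElim {C P : Type} [Fintype P] (wt : C → ℤ) (κ : ℤ) (d : C →₀ ℕ) (e : P →₀ ℕ) :
    Finsupp.weight (Sum.elim wt fun _ => κ) (Finsupp.sumElim d e) =
      Finsupp.weight wt d + e.degree * κ := by
  rw [show Finsupp.sumElim d e = d.embDomain .inl + e.embDomain .inr by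
    ext (x | x)
    · simp
    · simp]
  rw [map_add, Finsupp.weight_apply, Finsupp.weight_apply, Finsupp.weight_apply,
    Finsupp.sum_embDomain, Finsupp.sum_embDomain, Finsupp.degree_eq_sum,
    Finsupp.sum_fintype e _ fun _ => by simp]
  simp [Finset.sum_mul]

theorem degree_exps (E : Fin k → (Fin m →₀ ℕ)) : (exps m k E).degree = ∑ r, (E r).degree := by
  simp only [Finsupp.degree_eq_sum, Fintype.sum_prod_type]
  rfl

/-- The extracted monomial $u^Iv^J$ has weight $-|I|-|J|$, which is moved to the other side of the
bound 2 for $\Pi$. -/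
theorem bdd_components (φm : TwoTensor m) (φn : TwoTensor n) (p q : Coord m n) :
    Bdd coordWt (coordWt p + coordWt q + 2) (components φm φn p q) := by
  rw [components_eq]
  intro d hd
  have := bdd_tensorPi φm φn (0 : Fin 2) 1 p.1 q.1 _ hd
  rw [varsWt, weight_sumElim, degree_exps, Fin.sum_univ_two] at this
  push_cast at this
  change _ + ((p.2.degree : ℤ) + (q.2.degree : ℤ)) * -1 ≤ 2 at this
  simp only [coordWt]
  linarith

theorem bddComponents_id (φm : TwoTensor m) (φn : TwoTensor n) :
    BddComponents coordWt id (components φm φn) := ⟨2, bdd_components φm φn⟩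

theorem bddComponents_inl (φm : TwoTensor m) (φn : TwoTensor n) {P : Type} :
    BddComponents (varsWt (P := P)) Sum.inl fun p q => incl (components φm φn p q) :=
  ⟨2, fun p q => Bdd.subst (wS := coordWt) hasSubst_inl
    (fun x => (bdd_X (Sum.inl x) : Bdd varsWt (varsWt (Sum.inl x)) _)) (bdd_components φm φn p q)⟩

theorem mem_functions_iff {a : MvPowerSeries (Coord m n) ℝ} :
    a ∈ Functions m n ↔ IsBdd coordWt a := by
  have hw : ∀ d : Coord m n →₀ ℕ, Finsupp.weight coordWt d = (weight d : ℤ) := fun d => by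
    simp [Finsupp.weight_apply, weight, Finsupp.sum, coordWt]
  constructor
  · rintro ⟨k, hk⟩
    exact ⟨k, fun d hd => by rw [hw]; exact_mod_cast hk d hd⟩
  · rintro ⟨K, hK⟩
    refine ⟨K.toNat, fun d hd => ?_⟩
    have := hK d hd
    rw [hw] at this
    omega

end JetWeights

/-! ### Brackets of generic maps -/

section GenericBrackets

variable {m n k : ℕ} {T : Type} (φm : TwoTensor m) (φn : TwoTensor n)

/-- The sum over the multi-indices in the bracket reassembles the expansion of $\Pi^{kl}(a,b)$,
leaving a finite sum over the component indices `k`, `l`. Neither `A` nor `B` has to be a jet: only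
the shape of its coordinate derivatives matters. -/
theorem IsGrading.br_generic {wt : T → ℤ} {c : Coord m n → T} (h : IsGrading wt c)
    {A B : MvPowerSeries T ℝ} (hA : IsBdd wt A) (hB : IsBdd wt B)
    {a b : Fin m → MvPowerSeries T ℝ} (ha : HasSubst a) (hb : HasSubst b)
    {M N : Fin n → MvPowerSeries T ℝ} (hM : ∀ p, pderiv ℝ (c p) A = M p.1 * pw a p.2)
    (hN : ∀ p, pderiv ℝ (c p) B = N p.1 * pw b p.2) :
    br c (fun p q => subst (fun x => X (c x)) (components φm φn p q)) A B =
      ∑ k, ∑ l, M k * N l * evPi φm φn (fun x => X (c x)) a b k l := by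
  refine (h.hasFSum_br hA hB _).unique ?_
  have h1 := HasFSum.of_fintype_prod (ι := Fin n × Fin n)
    (t := fun x : (Fin n × Fin n) × ((Fin m →₀ ℕ) × (Fin m →₀ ℕ)) => M x.1.1 * N x.1.2 *
      (subst (fun x => (X (c x) : MvPowerSeries T ℝ))
        (components φm φn (x.1.1, x.2.1) (x.1.2, x.2.2)) * (pw a x.2.1 * pw b x.2.2)))
    fun kl => (hasFSum_evPi φm φn (hasSubst_X_comp h.inj) ha hb kl.1 kl.2).mul_left
      (M kl.1 * N kl.2)
  rw [Fintype.sum_prod_type] at h1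
  refine (h1.equiv (Equiv.prodProdProdComm _ _ _ _)).congr fun x => ?_
  rw [hM, hN]
  simp only [Equiv.prodProdProdComm_apply]
  ring

/-- The bracket of the jet space, extended to power series depending on points. -/
def jetBr (φm : TwoTensor m) (φn : TwoTensor n) (k : ℕ) (a b : MvPowerSeries (Vars m n k) ℝ) :
    MvPowerSeries (Vars m n k) ℝ :=
  br Sum.inl (fun p q => incl (components φm φn p q)) a b

theorem pderiv_jet (r : Fin k) (p : Coord m n) (i : Fin n) :
    pderiv ℝ (Sum.inl p) (jet m n r i) =
      (if p.1 = i then 1 else 0) * pw (pt (Coord m n) r) p.2 := by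
  rw [jet_eq, pderiv_ev_coord Sum.inl_injective (hasSubst_pt r)]
  simp only [pt, pderiv_X_of_ne (show (Sum.inr _ : Vars m n k) ≠ Sum.inl p from Sum.inr_ne_inl),
    mul_zero, Finset.sum_const_zero, add_zero, ite_mul, one_mul, zero_mul]

theorem jetBr_jet (r s : Fin k) (i j : Fin n) :
    jetBr φm φn k (jet m n r i) (jet m n s j) = tensorPi φm φn r s i j := by
  rw [jetBr]
  refine (isGrading_inl.br_generic φm φn ⟨0, bdd_jet r i⟩ ⟨0, bdd_jet s j⟩ (hasSubst_pt r)
    (hasSubst_pt s) (M := fun k => if k = i then 1 else 0) (N := fun l => if l = j then 1 else 0)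
    (fun p => pderiv_jet r p i) (fun p => pderiv_jet s p j)).trans ?_
  rw [tensorPi_eq]
  simp

/-- The inner bracket of jets has bounded weight, so the outer sum converges for the same reason as
the inner one. -/
theorem bracketRepresentsPi : BracketRepresentsPi φm φn := by
  intro r s t _ _ _ i j k
  have h1 := isGrading_inl.hasFSum_br ⟨0, bdd_jet r i⟩ ⟨0, bdd_jet s j⟩
    (fun p q => incl (components φm φn p q))
  refine ⟨h1.1, jetBr_jet φm φn r s i j, ?_⟩
  exact (isGrading_inl.hasFSum_br
    ((bddComponents_inl φm φn).isBdd_br ⟨0, bdd_jet r i⟩ ⟨0, bdd_jet s j⟩) ⟨0, bdd_jet t k⟩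
    (fun p q => incl (components φm φn p q))).1

end GenericBrackets

/-! ### Derivatives of two-point tensors and the Yang-Baxter expression -/

section TwoTensors

variable {n : ℕ} {T T' : Type} {φ : TwoTensor n} {a b e : Fin n → MvPowerSeries T ℝ}

/-- The derivative of `φ^{ij}` in the direction `l` of its first argument, at `(a, b)`. -/
def TwoTensor.dat (φ : TwoTensor n) (i j l : Fin n) (a b : Fin n → MvPowerSeries T ℝ) :
    MvPowerSeries T ℝ := subst (Sum.elim a b) (pderiv ℝ (Sum.inl l) (φ i j))

/-- One of the six contractions of `φ` with its derivative. -/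
def TwoTensor.psi (φ : TwoTensor n) (a b e : Fin n → MvPowerSeries T ℝ) (i j k : Fin n) :
    MvPowerSeries T ℝ := ∑ l, φ.dat i k l a e * φ.at l j a b

theorem subst_dat {z : T → MvPowerSeries T' ℝ} (hz : HasSubst z) (ha : HasSubst a)
    (hb : HasSubst b) (i j l : Fin n) : subst z (φ.dat i j l a b) =
      φ.dat i j l (fun μ => subst z (a μ)) (fun μ => subst z (b μ)) := by
  rw [TwoTensor.dat, subst_comp_subst_apply (hasSubst_elim ha hb) hz, comp_elim, TwoTensor.dat]

/-- Skewness trades derivatives in the second argument for derivatives in the first, so `dat` is the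
only kind of derivative needed later. -/
theorem TwoTensor.IsSkew.subst_pderiv_inr (hφ : φ.IsSkew) (ha : HasSubst a) (hb : HasSubst b)
    (i j l : Fin n) :
    subst (Sum.elim a b) (pderiv ℝ (Sum.inr l) (φ i j)) = -φ.dat j i l b a := by
  classical
  have hz := hasSubst_elim ha hb
  have hr : HasSubst fun l : Fin n => (X (Sum.inr l) : MvPowerSeries (Fin n ⊕ Fin n) ℝ) :=
    hasSubst_X_comp Sum.inr_injective
  have hl : HasSubst fun l : Fin n => (X (Sum.inl l) : MvPowerSeries (Fin n ⊕ Fin n) ℝ) :=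
    hasSubst_X_comp Sum.inl_injective
  have h1 : pderiv ℝ (Sum.inr l) (φ i j) =
      -φ.dat j i l (fun l => X (Sum.inr l)) (fun l => X (Sum.inl l)) := by
    rw [hφ i j, map_neg, TwoTensor.at, pderiv_subst (hasSubst_elim hr hl), Fintype.sum_sum_type]
    simp only [Sum.elim_inl, Sum.elim_inr, pderiv_X, Pi.single_apply, reduceCtorEq, if_false,
      mul_zero, Finset.sum_const_zero, add_zero, Sum.inr.injEq, mul_ite, mul_one,
      Finset.sum_ite_eq', Finset.mem_univ, if_true]
    rfl
  rw [h1, ← substAlgHom_apply hz, map_neg, substAlgHom_apply, subst_dat hz hr hl]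
  simp only [subst_X hz, Sum.elim_inl, Sum.elim_inr]

theorem TwoTensor.IsSkew.pderiv_at (hφ : φ.IsSkew) (ha : HasSubst a) (hb : HasSubst b)
    (i j : Fin n) (t : T) : pderiv ℝ t (φ.at i j a b) =
      ∑ l, φ.dat i j l a b * pderiv ℝ t (a l) - ∑ l, φ.dat j i l b a * pderiv ℝ t (b l) := by
  rw [TwoTensor.at, pderiv_subst (hasSubst_elim ha hb), Fintype.sum_sum_type, sub_eq_add_neg,
    ← Finset.sum_neg_distrib]
  congr 1
  refine Finset.sum_congr rfl fun l _ => ?_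
  rw [hφ.subst_pderiv_inr ha hb, neg_mul]; rfl

theorem IsGrading.br_at {C : Type} {wt : T → ℤ} {c : C → T} {Ω : C → C → MvPowerSeries T ℝ}
    (h : IsGrading wt c) (hφ : φ.IsSkew) (ha : HasSubst a) (hb : HasSubst b)
    (hab : ∀ l, IsBdd wt (a l)) (hbb : ∀ l, IsBdd wt (b l)) (i j : Fin n)
    (hat : IsBdd wt (φ.at i j a b)) {x : MvPowerSeries T ℝ} (hx : IsBdd wt x) :
    br c Ω (φ.at i j a b) x =
      ∑ l, φ.dat i j l a b * br c Ω (a l) x - ∑ l, φ.dat j i l b a * br c Ω (b l) x := by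
  rw [TwoTensor.at, h.br_subst_left (hasSubst_elim ha hb)
    (by rintro (l | l); exacts [hab l, hbb l]) hat hx, Fintype.sum_sum_type, sub_eq_add_neg,
    ← Finset.sum_neg_distrib]
  congr 1
  refine Finset.sum_congr rfl fun l _ => ?_
  rw [hφ.subst_pderiv_inr ha hb, neg_mul]; rfl

theorem hasSubst_slot (r : Fin 3) : HasSubst (slot r : Fin n → _) :=
  hasSubst_X_comp fun _ _ h => (Prod.mk.inj h).2

theorem TwoTensor.IsSkew.pderiv_at_slot (hφ : φ.IsSkew) {r s : Fin 3} (hrs : r ≠ s)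
    (i j l : Fin n) :
    pderiv ℝ (r, l) (φ.at i j (slot r) (slot s)) = φ.dat i j l (slot r) (slot s) := by
  classical
  rw [hφ.pderiv_at (hasSubst_slot r) (hasSubst_slot s)]
  simp [slot, pderiv_X, Pi.single_apply, hrs.symm]

/-- The substitution of three points into the Yang-Baxter expression. -/
theorem TwoTensor.IsSkew.subst_Phi (hφ : φ.IsSkew) {y : Fin 3 → Fin n → MvPowerSeries T ℝ}
    (hy : ∀ r, HasSubst (y r)) (i j k : Fin n) :
    subst (fun p : Fin 3 × Fin n => y p.1 p.2) (φ.Phi i j k) =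
      φ.psi (y 0) (y 1) (y 2) i j k - φ.psi (y 1) (y 0) (y 2) j i k
        + φ.psi (y 2) (y 0) (y 1) k i j - φ.psi (y 0) (y 2) (y 1) i k j
        + φ.psi (y 1) (y 2) (y 0) j k i - φ.psi (y 2) (y 1) (y 0) k j i := by
  have hz : HasSubst (fun p : Fin 3 × Fin n => y p.1 p.2) :=
    hasSubst_of_constantCoeff_nilpotent fun p => (hy p.1).const_coeff p.2
  have hs : ∀ r, (fun μ : Fin n => subst (fun p : Fin 3 × Fin n => y p.1 p.2)
      (slot r μ : MvPowerSeries (Fin 3 × Fin n) ℝ)) = y r := fun r => funext fun μ => subst_X hz _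
  have hA : ∀ r s i j, subst (fun p : Fin 3 × Fin n => y p.1 p.2) (φ.at i j (slot r) (slot s)) =
      φ.at i j (y r) (y s) := fun r s i j => by
    rw [subst_at φ hz (hasSubst_slot r) (hasSubst_slot s), hs, hs]
  have hD : ∀ r s i j l, subst (fun p : Fin 3 × Fin n => y p.1 p.2)
      (φ.dat i j l (slot r) (slot s)) = φ.dat i j l (y r) (y s) := fun r s i j l => by
    rw [subst_dat hz (hasSubst_slot r) (hasSubst_slot s), hs, hs]
  simp only [TwoTensor.Phi, TwoTensor.psi, subst_finsetSum hz, subst_add hz, subst_mul hz, hA,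
    hφ.pderiv_at_slot (show (0 : Fin 3) ≠ 1 by decide),
    hφ.pderiv_at_slot (show (0 : Fin 3) ≠ 2 by decide),
    hφ.pderiv_at_slot (show (1 : Fin 3) ≠ 0 by decide),
    hφ.pderiv_at_slot (show (1 : Fin 3) ≠ 2 by decide),
    hφ.pderiv_at_slot (show (2 : Fin 3) ≠ 0 by decide),
    hφ.pderiv_at_slot (show (2 : Fin 3) ≠ 1 by decide), hD,
    ← Finset.sum_add_distrib, ← Finset.sum_sub_distrib]
  refine Finset.sum_congr rfl fun l _ => ?_
  -- Three of the six terms carry their undifferentiated factor with the arguments in the opposite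
  -- order. Flipping it produces the signs, and the whole becomes the alternating sum of `psi` over
  -- the permutations of the three points.
  rw [hφ.at_eq (hy 2) (hy 0) k l, hφ.at_eq (hy 0) (hy 1) i l, hφ.at_eq (hy 1) (hy 2) j l]
  ring

end TwoTensors

/-! ### The Jacobiator of three jets -/

section Jacobiator

variable {m n K : ℕ} {φm : TwoTensor m} {φn : TwoTensor n}

theorem br_eq_zero_of_pderiv {C T : Type} {c : C → T} {Ω : C → C → MvPowerSeries T ℝ}
    {a b : MvPowerSeries T ℝ} (h : ∀ p, pderiv ℝ (c p) a = 0) : br c Ω a b = 0 := by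
  rw [br]
  exact (hasFSum_zero.congr fun p : C × C => by rw [h, zero_mul, zero_mul]).2

theorem pderiv_incl_inr {C P : Type} (f : MvPowerSeries C ℝ) (t : P) :
    pderiv ℝ (Sum.inr t) (incl f : MvPowerSeries (C ⊕ P) ℝ) = 0 := by
  rw [incl, pderiv_subst_of_pderiv_eq_zero hasSubst_inl _ ∅
    fun s _ => pderiv_X_of_ne Sum.inl_ne_inr, Finset.sum_empty]

theorem pderiv_incl_inl {C P : Type} (f : MvPowerSeries C ℝ) (p : C) :
    pderiv ℝ (Sum.inl p) (incl f : MvPowerSeries (C ⊕ P) ℝ) = incl (pderiv ℝ p f) := by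
  rw [incl, pderiv_subst_of_pderiv_eq_zero hasSubst_inl _ {p} fun s hs =>
    pderiv_X_of_ne fun h => hs (Finset.mem_singleton.2 (Sum.inl_injective h)),
    Finset.sum_singleton, pderiv_X_self, mul_one, incl]

theorem pderiv_jet_of_ne {r t : Fin K} (hrt : r ≠ t) (μ : Fin m) (i : Fin n) :
    pderiv ℝ (Sum.inr (r, μ)) (jet m n t i) = 0 := by
  rw [jet_eq, pderiv_ev_of_const hasSubst_coord (hasSubst_pt t) _
    fun p => pderiv_X_of_ne Sum.inl_ne_inr]
  exact Finset.sum_eq_zero fun ν _ => by rw [pderiv_pt_of_ne _ hrt, mul_zero]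

theorem pderiv_jetDeriv_of_ne {r t : Fin K} (hrt : r ≠ t) (μ ν : Fin m) (i : Fin n) :
    pderiv ℝ (Sum.inr (r, μ)) (jetDeriv m n t i ν) = 0 := by
  rw [jetDeriv, pderiv_pderiv_comm, pderiv_jet_of_ne hrt, map_zero]

/-- Contraction of `φ_m(u,v)` with the derivative of the jet at `v`. -/
def contr (φm : TwoTensor m) (n : ℕ) (r s : Fin K) (j : Fin n) (μ : Fin m) :
    MvPowerSeries (Vars m n K) ℝ :=
  ∑ ν, jetDeriv m n s j ν * φm.at μ ν (point m n r) (point m n s)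

theorem tensorPi_eq_contr (r s : Fin K) (i j : Fin n) : tensorPi φm φn r s i j =
    ∑ μ, jetDeriv m n r i μ * contr φm n r s j μ - φn.at i j (jet m n r) (jet m n s) := by
  simp only [tensorPi, contr, Finset.mul_sum, mul_assoc]

theorem hasSubst_point (r : Fin K) : HasSubst (point m n r) := hasSubst_pt r

theorem pderiv_at_point (hm : φm.IsSkew) {r t : Fin K} (hrt : r ≠ t) (α β μ : Fin m) :
    pderiv ℝ (Sum.inr (r, μ)) (φm.at α β (point m n r) (point m n t)) =
      φm.dat α β μ (point m n r) (point m n t) := by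
  change pderiv ℝ _ (φm.at α β (pt _ r) (pt _ t)) = φm.dat α β μ (pt _ r) (pt _ t)
  rw [hm.pderiv_at (hasSubst_pt r) (hasSubst_pt t)]
  simp [pderiv_pt, pderiv_pt_of_ne _ hrt]

theorem pderiv_tensorPi (hm : φm.IsSkew) (hn : φn.IsSkew) {r t : Fin K} (hrt : r ≠ t)
    (i k : Fin n) (μ : Fin m) :
    pderiv ℝ (Sum.inr (r, μ)) (tensorPi φm φn r t i k) =
      ∑ α, pderiv ℝ (Sum.inr (r, μ)) (jetDeriv m n r i α) * contr φm n r t k α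
        + ∑ α, jetDeriv m n r i α *
          ∑ β, jetDeriv m n t k β * φm.dat α β μ (point m n r) (point m n t)
        - ∑ l, φn.dat i k l (jet m n r) (jet m n t) * jetDeriv m n r l μ := by
  rw [tensorPi_eq_contr, map_sub, hn.pderiv_at (hasSubst_jet r) (hasSubst_jet t),
    ← Finset.sum_add_distrib]
  simp only [pderiv_jet_of_ne hrt, mul_zero, Finset.sum_const_zero, sub_zero]
  rw [map_sum]
  congr 1
  refine Finset.sum_congr rfl fun α _ => ?_
  rw [Derivation.leibniz, smul_eq_mul, smul_eq_mul, contr, map_sum, add_comm]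
  congr 1
  · ring
  · congr 1
    refine Finset.sum_congr rfl fun β _ => ?_
    rw [Derivation.leibniz, pderiv_jetDeriv_of_ne hrt, smul_zero, add_zero, smul_eq_mul,
      pderiv_at_point hm hrt]

theorem pderiv_inl_at_point (hm : φm.IsSkew) (r s : Fin K) (μ ν : Fin m) (p : Coord m n) :
    pderiv ℝ (Sum.inl p) (φm.at μ ν (point m n r) (point m n s)) = 0 := by
  rw [hm.pderiv_at (hasSubst_point r) (hasSubst_point s)]
  simp only [point, pderiv_X_of_ne (show (Sum.inr _ : Vars m n K) ≠ Sum.inl p from Sum.inr_ne_inl),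
    mul_zero, Finset.sum_const_zero, sub_zero]

/-- The variable $u^\mu$ is a parameter for the bracket and does not occur in the jet at the other
point, so differentiating $\{F^i(u),F^k(w)\}=\Pi^{ik}$ by it affects only the first entry. -/
theorem jetBr_jetDeriv {r t : Fin K} (hrt : r ≠ t) (i k : Fin n) (μ : Fin m) :
    jetBr φm φn K (jetDeriv m n r i μ) (jet m n t k) =
      pderiv ℝ (Sum.inr (r, μ)) (tensorPi φm φn r t i k) := by
  have hz : jetBr φm φn K (jet m n r i) 0 = 0 := by
    rw [jetBr, br]
    exact (hasFSum_zero.congr fun p : Coord m n × Coord m n => by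
      rw [map_zero, mul_zero, zero_mul]).2
  have h := isGrading_inl.pderiv_br (Ω := fun p q => incl (components φm φn p q))
    ⟨0, bdd_jet r i⟩ ⟨0, bdd_jet t k⟩ (Sum.inr (r, μ)) fun p q => pderiv_incl_inr _ _
  rw [pderiv_jet_of_ne hrt] at h
  change pderiv ℝ _ (jetBr φm φn K (jet m n r i) (jet m n t k)) =
    jetBr φm φn K (jetDeriv m n r i μ) (jet m n t k) + jetBr φm φn K (jet m n r i) 0 at h
  rw [← jetBr_jet, h, hz, add_zero]

theorem bdd_at_point (φm : TwoTensor m) (r s : Fin K) (μ ν : Fin m) :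
    Bdd varsWt 0 (φm.at μ ν (point m n r) (point m n s)) :=
  bdd_at φm (hasSubst_pt r) (hasSubst_pt s) (fun μ => (bdd_pt r μ).mono (by norm_num))
    (fun μ => (bdd_pt s μ).mono (by norm_num)) μ ν

/-- Half of the double bracket `{{F^i(u),F^j(v)},F^k(w)}`. -/
def halfBr (φm : TwoTensor m) (φn : TwoTensor n) (r s t : Fin K) (i j k : Fin n) :
    MvPowerSeries (Vars m n K) ℝ :=
  ∑ μ, pderiv ℝ (Sum.inr (r, μ)) (tensorPi φm φn r t i k) * contr φm n r s j μ
    - ∑ l, φn.dat i j l (jet m n r) (jet m n s) * tensorPi φm φn r t l k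

/-- By the Leibniz and chain rules, $F^k(w)$ pairs either with the jet at `r` or with the jet at
`s`. The factor $\varphi_m(u,v)$ involves no coordinates and has bracket zero. Skewness makes the
second contribution minus the first with the two points exchanged. -/
theorem jetBr_tensorPi (hm : φm.IsSkew) (hn : φn.IsSkew) {r s t : Fin K} (hrt : r ≠ t)
    (hst : s ≠ t) (i j k : Fin n) :
    jetBr φm φn K (tensorPi φm φn r s i j) (jet m n t k) =
      halfBr φm φn r s t i j k - halfBr φm φn s r t j i k := by
  have hA : ∀ r i μ, IsBdd varsWt (jetDeriv m n (k := K) r i μ) := fun r i μ =>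
    ⟨1, bdd_jetDeriv r i μ⟩
  have hQ : ∀ μ ν, IsBdd varsWt (φm.at μ ν (point m n r) (point m n s)) := fun μ ν =>
    ⟨0, bdd_at_point φm r s μ ν⟩
  have hP : IsBdd varsWt (φn.at i j (jet m n r) (jet m n s)) :=
    ⟨0, bdd_at φn (hasSubst_jet r) (hasSubst_jet s) (bdd_jet r) (bdd_jet s) i j⟩
  have hF : ∀ r i, IsBdd varsWt (jet m n (k := K) r i) := fun r i => ⟨0, bdd_jet r i⟩
  have hG := isGrading_inl (m := m) (n := n) (P := Fin K × Fin m)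
  have h1 : jetBr φm φn K (φn.at i j (jet m n r) (jet m n s)) (jet m n t k) =
      ∑ l, φn.dat i j l (jet m n r) (jet m n s) * tensorPi φm φn r t l k
        - ∑ l, φn.dat j i l (jet m n s) (jet m n r) * tensorPi φm φn s t l k := by
    rw [jetBr, hG.br_at hn (hasSubst_jet r) (hasSubst_jet s) (hF r) (hF s) i j hP (hF t k)]
    simp only [← jetBr_jet]; rfl
  have h2 : ∀ μ ν, jetBr φm φn K (jetDeriv m n r i μ * jetDeriv m n s j ν *
      φm.at μ ν (point m n r) (point m n s)) (jet m n t k) =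
      (pderiv ℝ (Sum.inr (r, μ)) (tensorPi φm φn r t i k) * jetDeriv m n s j ν
        + jetDeriv m n r i μ * pderiv ℝ (Sum.inr (s, ν)) (tensorPi φm φn s t j k))
          * φm.at μ ν (point m n r) (point m n s) := fun μ ν => by
    have h0 : br Sum.inl (fun p q => incl (components φm φn p q))
        (φm.at μ ν (point m n r) (point m n s)) (jet m n t k) = 0 :=
      br_eq_zero_of_pderiv (pderiv_inl_at_point hm r s μ ν)
    rw [← jetBr_jetDeriv hrt, ← jetBr_jetDeriv hst, jetBr,
      hG.br_mul_left ((hA r i μ).mul (hA s j ν)) (hQ μ ν) (hF t k),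
      hG.br_mul_left (hA r i μ) (hA s j ν) (hF t k), h0]
    simp only [jetBr]
    ring
  have h3 : jetBr φm φn K (tensorPi φm φn r s i j) (jet m n t k) =
      ∑ μ, ∑ ν, jetBr φm φn K (jetDeriv m n r i μ * jetDeriv m n s j ν *
        φm.at μ ν (point m n r) (point m n s)) (jet m n t k) -
      jetBr φm φn K (φn.at i j (jet m n r) (jet m n s)) (jet m n t k) := by
    have hb : ∀ μ ν, IsBdd varsWt (jetDeriv m n r i μ * jetDeriv m n s j ν *
        φm.at μ ν (point m n r) (point m n s)) := fun μ ν =>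
      ((hA r i μ).mul (hA s j ν)).mul (hQ μ ν)
    have hb' : ∀ μ, IsBdd varsWt (∑ ν, jetDeriv m n r i μ * jetDeriv m n s j ν *
        φm.at μ ν (point m n r) (point m n s)) := fun μ => IsBdd.sum _ fun ν _ => hb μ ν
    simp only [jetBr]
    rw [tensorPi, hG.br_sub_left (IsBdd.sum _ fun μ _ => hb' μ) hP (hF t k),
      hG.br_sum_left _ (fun μ _ => hb' μ) (hF t k)]
    simp only [hG.br_sum_left _ (fun ν _ => hb _ ν) (hF t k)]
  have h4 : ∑ μ, ∑ ν, jetDeriv m n r i μ * pderiv ℝ (Sum.inr (s, ν)) (tensorPi φm φn s t j k)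
      * φm.at μ ν (point m n r) (point m n s) =
      -∑ ν, pderiv ℝ (Sum.inr (s, ν)) (tensorPi φm φn s t j k) * contr φm n s r i ν := by
    rw [Finset.sum_comm, ← Finset.sum_neg_distrib]
    refine Finset.sum_congr rfl fun ν _ => ?_
    rw [contr, Finset.mul_sum, ← Finset.sum_neg_distrib]
    refine Finset.sum_congr rfl fun μ _ => ?_
    rw [hm.at_eq (hasSubst_point r) (hasSubst_point s) μ ν]
    ring
  rw [h3, h1]
  simp only [h2, add_mul, Finset.sum_add_distrib, h4, halfBr]
  simp only [contr, Finset.mul_sum, mul_assoc]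
  ring

/-- Index bookkeeping for `halfBr`. Here `H` stands for second derivatives of the jet at `r`, `Vs`
and `Vt` for the contractions with the other points, `A`, `B`, `C` for Jacobians, `Q` for the
derivative of $\varphi_m$, and `D`, `E`, `P` for derivatives and values of $\varphi_n$. The
bracketed terms are those symmetric under exchange of `s` and `t`. -/
theorem halfBr_sum_identity {R ι κ : Type*} [CommRing R] [Fintype ι] [Fintype κ]
    (H : ι → ι → R) (Vs Vt A C : ι → R) (B : κ → ι → R) (Q : ι → ι → ι → R) (D E P : κ → R) :
    ∑ μ, (∑ α, H μ α * Vt α + ∑ α, A α * ∑ β, C β * Q α β μ - ∑ l, E l * B l μ) * Vs μ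
      - ∑ l, D l * (∑ μ, B l μ * Vt μ - P l) =
    (∑ μ, ∑ α, H μ α * (Vs μ * Vt α) - (∑ l, E l * ∑ μ, B l μ * Vs μ
      + ∑ l, D l * ∑ μ, B l μ * Vt μ))
      + ∑ α, ∑ β, A α * C β * (∑ μ, Q α β μ * Vs μ) + ∑ l, D l * P l := by
  have h1 : ∑ μ, (∑ α, H μ α * Vt α) * Vs μ = ∑ μ, ∑ α, H μ α * (Vs μ * Vt α) := by
    simp only [Finset.sum_mul]
    exact Finset.sum_congr rfl fun μ _ => Finset.sum_congr rfl fun α _ => by ring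
  have h2 : ∑ μ, (∑ α, A α * ∑ β, C β * Q α β μ) * Vs μ =
      ∑ α, ∑ β, A α * C β * (∑ μ, Q α β μ * Vs μ) := by
    simp only [Finset.sum_mul, Finset.mul_sum]
    rw [Finset.sum_comm]
    refine Finset.sum_congr rfl fun α _ => ?_
    rw [Finset.sum_comm]
    exact Finset.sum_congr rfl fun β _ => Finset.sum_congr rfl fun μ _ => by ring
  have h3 : ∑ μ, (∑ l, E l * B l μ) * Vs μ = ∑ l, E l * ∑ μ, B l μ * Vs μ := by
    simp only [Finset.sum_mul, Finset.mul_sum]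
    rw [Finset.sum_comm]
    exact Finset.sum_congr rfl fun l _ => Finset.sum_congr rfl fun μ _ => by ring
  simp only [sub_mul, add_mul, mul_sub, Finset.sum_sub_distrib, Finset.sum_add_distrib, h1, h2, h3]
  ring

/-- The part of `halfBr` which is symmetric in the last two points. -/
def halfSym (φm : TwoTensor m) (φn : TwoTensor n) (r s t : Fin K) (i j k : Fin n) :
    MvPowerSeries (Vars m n K) ℝ :=
  ∑ μ, ∑ α, pderiv ℝ (Sum.inr (r, μ)) (jetDeriv m n r i α) *
      (contr φm n r s j μ * contr φm n r t k α)
    - (∑ l, φn.dat i k l (jet m n r) (jet m n t) * ∑ μ, jetDeriv m n r l μ * contr φm n r s j μ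
      + ∑ l, φn.dat i j l (jet m n r) (jet m n s) * ∑ μ, jetDeriv m n r l μ * contr φm n r t k μ)

/-- Second derivatives of the jet are symmetric, and the two $\varphi_n$ sums are exchanged with
each other. -/
theorem halfSym_comm (r s t : Fin K) (i j k : Fin n) :
    halfSym φm φn r s t i j k = halfSym φm φn r t s i k j := by
  rw [halfSym, halfSym, add_comm, Finset.sum_comm]
  congr 1
  refine Finset.sum_congr rfl fun α _ => Finset.sum_congr rfl fun μ _ => ?_
  rw [jetDeriv, jetDeriv, pderiv_pderiv_comm]
  ring

/-- The push-forward of a contraction of `φ_m` with its derivative. -/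
def pushPsi (φm : TwoTensor m) (n : ℕ) (r s t : Fin K) (i j k : Fin n) :
    MvPowerSeries (Vars m n K) ℝ :=
  ∑ α, ∑ ν, ∑ β, jetDeriv m n r i α * jetDeriv m n s j ν * jetDeriv m n t k β *
    φm.psi (point m n r) (point m n s) (point m n t) α ν β

/-- The symmetric part gathers the terms with second derivatives of $F$ and those mixing $\varphi_m$
with $\varphi_n$. What is left is purely quadratic in $\varphi_m$ or in $\varphi_n$, namely one term
each of $\Phi_m$ and $\Phi_n$. -/
theorem halfBr_eq (hm : φm.IsSkew) (hn : φn.IsSkew) {r s t : Fin K} (hrt : r ≠ t)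
    (i j k : Fin n) :
    halfBr φm φn r s t i j k = halfSym φm φn r s t i j k + pushPsi φm n r s t i j k
      + φn.psi (jet m n r) (jet m n t) (jet m n s) i k j := by
  rw [halfBr]
  simp only [pderiv_tensorPi hm hn hrt]
  simp only [tensorPi_eq_contr]
  rw [halfBr_sum_identity, halfSym, TwoTensor.psi]
  congr 2
  rw [pushPsi]
  refine Finset.sum_congr rfl fun α _ => ?_
  rw [Finset.sum_comm]
  refine Finset.sum_congr rfl fun β _ => ?_
  simp only [contr, TwoTensor.psi, Finset.mul_sum]
  rw [Finset.sum_comm]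
  exact Finset.sum_congr rfl fun ν _ => Finset.sum_congr rfl fun μ _ => by ring

/-- The Jacobiator of three jets is the difference of the two sides of the push-forward
identity. -/
theorem jac_jet (hm : φm.IsSkew) (hn : φn.IsSkew) (i j k : Fin n) :
    jac Sum.inl (fun p q => incl (components φm φn p q))
      (jet m n (0 : Fin 3) i) (jet m n 1 j) (jet m n 2 k) =
    (∑ μ : Fin m, ∑ ν : Fin m, ∑ σ : Fin m,
        jetDeriv m n (0 : Fin 3) i μ * jetDeriv m n 1 j ν * jetDeriv m n 2 k σ
          * subst (fun p : Fin 3 × Fin m => (point m n p.1 p.2 : MvPowerSeries (Vars m n 3) ℝ))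
              (φm.Phi μ ν σ)) -
    subst (fun p : Fin 3 × Fin n => (jet m n p.1 p.2 : MvPowerSeries (Vars m n 3) ℝ))
      (φn.Phi i j k) := by
  have h01 : (0 : Fin 3) ≠ 1 := by decide
  have h02 : (0 : Fin 3) ≠ 2 := by decide
  have h12 : (1 : Fin 3) ≠ 2 := by decide
  have hj : jac Sum.inl (fun p q => incl (components φm φn p q))
      (jet m n (0 : Fin 3) i) (jet m n 1 j) (jet m n 2 k) =
      jetBr φm φn 3 (jetBr φm φn 3 (jet m n 0 i) (jet m n 1 j)) (jet m n 2 k)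
      + jetBr φm φn 3 (jetBr φm φn 3 (jet m n 2 k) (jet m n 0 i)) (jet m n 1 j)
      + jetBr φm φn 3 (jetBr φm φn 3 (jet m n 1 j) (jet m n 2 k)) (jet m n 0 i) := rfl
  have hΦm : ∀ μ ν σ, subst (fun p : Fin 3 × Fin m =>
      (point m n p.1 p.2 : MvPowerSeries (Vars m n 3) ℝ)) (φm.Phi μ ν σ) = _ := fun μ ν σ =>
    hm.subst_Phi (y := fun r => point m n r) (fun r => hasSubst_pt r) μ ν σ
  have hΦn : subst (fun p : Fin 3 × Fin n => (jet m n p.1 p.2 : MvPowerSeries (Vars m n 3) ℝ))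
      (φn.Phi i j k) = _ :=
    hn.subst_Phi (y := fun r => jet m n r) (fun r => hasSubst_jet r) i j k
  simp only [hΦm, hΦn, mul_add, mul_sub, Finset.sum_add_distrib, Finset.sum_sub_distrib]
  have p1 : pushPsi φm n 1 0 2 j i k = ∑ μ : Fin m, ∑ ν : Fin m, ∑ σ : Fin m,
      jetDeriv m n (0 : Fin 3) i μ * jetDeriv m n 1 j ν * jetDeriv m n 2 k σ *
        φm.psi (point m n 1) (point m n 0) (point m n 2) ν μ σ := by
    rw [pushPsi, Finset.sum_comm]
    exact Finset.sum_congr rfl fun μ _ => Finset.sum_congr rfl fun ν _ =>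
      Finset.sum_congr rfl fun σ _ => by ring
  have p2 : pushPsi φm n 2 0 1 k i j = ∑ μ : Fin m, ∑ ν : Fin m, ∑ σ : Fin m,
      jetDeriv m n (0 : Fin 3) i μ * jetDeriv m n 1 j ν * jetDeriv m n 2 k σ *
        φm.psi (point m n 2) (point m n 0) (point m n 1) σ μ ν := by
    rw [pushPsi, Finset.sum_comm]
    refine Finset.sum_congr rfl fun μ _ => ?_
    rw [Finset.sum_comm]
    exact Finset.sum_congr rfl fun ν _ => Finset.sum_congr rfl fun σ _ => by ring
  have p3 : pushPsi φm n 0 2 1 i k j = ∑ μ : Fin m, ∑ ν : Fin m, ∑ σ : Fin m,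
      jetDeriv m n (0 : Fin 3) i μ * jetDeriv m n 1 j ν * jetDeriv m n 2 k σ *
        φm.psi (point m n 0) (point m n 2) (point m n 1) μ σ ν := by
    rw [pushPsi]
    refine Finset.sum_congr rfl fun μ _ => ?_
    rw [Finset.sum_comm]
    exact Finset.sum_congr rfl fun ν _ => Finset.sum_congr rfl fun σ _ => by ring
  have p4 : pushPsi φm n 1 2 0 j k i = ∑ μ : Fin m, ∑ ν : Fin m, ∑ σ : Fin m,
      jetDeriv m n (0 : Fin 3) i μ * jetDeriv m n 1 j ν * jetDeriv m n 2 k σ *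
        φm.psi (point m n 1) (point m n 2) (point m n 0) ν σ μ := by
    rw [pushPsi, Finset.sum_congr rfl fun σ _ => Finset.sum_comm, Finset.sum_comm]
    refine Finset.sum_congr rfl fun μ _ => ?_
    exact Finset.sum_congr rfl fun ν _ => Finset.sum_congr rfl fun σ _ => by ring
  have p5 : pushPsi φm n 2 1 0 k j i = ∑ μ : Fin m, ∑ ν : Fin m, ∑ σ : Fin m,
      jetDeriv m n (0 : Fin 3) i μ * jetDeriv m n 1 j ν * jetDeriv m n 2 k σ *
        φm.psi (point m n 2) (point m n 1) (point m n 0) σ ν μ := by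
    rw [pushPsi, Finset.sum_congr rfl fun σ _ => Finset.sum_comm, Finset.sum_comm]
    refine Finset.sum_congr rfl fun μ _ => ?_
    rw [Finset.sum_comm]
    exact Finset.sum_congr rfl fun ν _ => Finset.sum_congr rfl fun σ _ => by ring
  -- The three double brackets give six halves. Two halves with the same leading point occur with
  -- opposite signs, so their symmetric parts cancel. The $\varphi_n$ terms have the last two points
  -- exchanged, which is why $\Phi_n$ enters with a minus sign.
  rw [← p1, ← p2, ← p3, ← p4, ← p5, hj, jetBr_jet, jetBr_jet, jetBr_jet,
    jetBr_tensorPi hm hn h02 h12, jetBr_tensorPi hm hn h12.symm h01,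
    jetBr_tensorPi hm hn h01.symm h02.symm, halfBr_eq hm hn h02, halfBr_eq hm hn h12,
    halfBr_eq hm hn h12.symm, halfBr_eq hm hn h01, halfBr_eq hm hn h01.symm,
    halfBr_eq hm hn h02.symm, halfSym_comm 0 1 2, halfSym_comm 1 0 2, halfSym_comm 2 0 1, pushPsi]
  ring

theorem jacobiIdentity_iff (hm : φm.IsSkew) (hn : φn.IsSkew) (i j k : Fin n) :
    JacobiIdentity φm φn i j k ↔ PushForwardIdentity φm φn i j k := by
  change jac Sum.inl (fun p q => incl (components φm φn p q))
      (jet m n (0 : Fin 3) i) (jet m n 1 j) (jet m n 2 k) = 0 ↔ _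
  rw [jac_jet hm hn, sub_eq_zero, eq_comm, PushForwardIdentity]

end Jacobiator

/-! ### Poisson brackets on the algebra of functions -/

section Poisson

variable {m n : ℕ} {φm : TwoTensor m} {φn : TwoTensor n}

theorem HasFSum.restrict {κ κ' T : Type} {t : κ' → MvPowerSeries T ℝ} {a : MvPowerSeries T ℝ}
    (h : HasFSum t a) {j : κ → κ'} (hj : Function.Injective j) (h0 : ∀ y ∉ Set.range j, t y = 0) :
    HasFSum (fun x => t (j x)) a := by
  have hs : FormallySummable fun x => t (j x) := fun d => (h.1 d).preimage hj.injOn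
  exact ⟨hs, (hs.hasFSum.extend hj (fun _ => rfl) h0).unique h⟩

/-- Iterated sums with coefficients from summable families. -/
theorem HasFSum.iterate_three {κ T : Type} {s₀ s₁ s₂ : κ → MvPowerSeries T ℝ}
    (h₀ : FormallySummable s₀) (h₁ : FormallySummable s₁) (h₂ : FormallySummable s₂)
    {a : MvPowerSeries T ℝ} {b : κ → MvPowerSeries T ℝ} {c : κ → κ → MvPowerSeries T ℝ}
    {e : κ → κ → κ → MvPowerSeries T ℝ} (ha : HasFSum (fun x => s₀ x * b x) a)
    (hb : ∀ x, HasFSum (fun y => s₁ y * c x y) (b x))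
    (hc : ∀ x y, HasFSum (fun z => s₂ z * e x y z) (c x y)) :
    HasFSum (fun x : κ × κ × κ => s₀ x.1 * (s₁ x.2.1 * (s₂ x.2.2 * e x.1 x.2.1 x.2.2))) a := by
  have hr : ∀ x, FormallySummable fun y : κ × κ => s₁ y.1 * (s₂ y.2 * e x y.1 y.2) := fun x =>
    h₁.mul_dep (r := fun y z => s₂ z * e x y z) fun y => h₂.mul_any _
  have hr' : ∀ x, HasFSum (fun y : κ × κ => s₁ y.1 * (s₂ y.2 * e x y.1 y.2)) (b x) := by
    intro x
    have h := (hr x).hasFSum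
    have h' := h.fiberwise (b := fun y => s₁ y * c x y) fun y => (hc x y).mul_left (s₁ y)
    exact ⟨hr x, h'.unique (hb x)⟩
  have hs := h₀.mul_dep (r := fun x (y : κ × κ) => s₁ y.1 * (s₂ y.2 * e x y.1 y.2)) hr
  have h := hs.hasFSum
  have h' := h.fiberwise (b := fun x => s₀ x * b x) fun x => (hr' x).mul_left (s₀ x)
  exact ⟨hs, h'.unique ha⟩

theorem incl_br {C P : Type} {wt : C → ℤ} {wt' : C ⊕ P → ℤ} (h : IsGrading wt id)
    (h' : IsGrading wt' Sum.inl) {Ω : C → C → MvPowerSeries C ℝ} {a b : MvPowerSeries C ℝ}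
    (ha : IsBdd wt a) (hb : IsBdd wt b) (ha' : IsBdd wt' (incl a)) (hb' : IsBdd wt' (incl b)) :
    (incl (br id Ω a b) : MvPowerSeries (C ⊕ P) ℝ) =
      br Sum.inl (fun p q => incl (Ω p q)) (incl a) (incl b) := by
  refine ((h.hasFSum_br ha hb Ω).subst hasSubst_inl).unique
    ((h'.hasFSum_br ha' hb' _).congr fun p => ?_)
  rw [pderiv_incl_inl, pderiv_incl_inl, subst_mul hasSubst_inl, subst_mul hasSubst_inl]
  rfl

theorem isBdd_incl {P : Type} {a : MvPowerSeries (Coord m n) ℝ} (ha : IsBdd coordWt a) :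
    IsBdd (varsWt (P := P)) (incl a) := by
  obtain ⟨K, hK⟩ := ha
  exact ⟨K, Bdd.subst (wS := coordWt) hasSubst_inl
    (fun x => (bdd_X (Sum.inl x) : Bdd varsWt (varsWt (Sum.inl x)) _)) hK⟩

theorem incl_X {C P : Type} (p : C) : (incl (X p) : MvPowerSeries (C ⊕ P) ℝ) = X (Sum.inl p) :=
  subst_X hasSubst_inl p

theorem incl_jac {P : Type} (φm : TwoTensor m) (φn : TwoTensor n)
    {a b e : MvPowerSeries (Coord m n) ℝ} (ha : IsBdd coordWt a) (hb : IsBdd coordWt b)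
    (he : IsBdd coordWt e) :
    (incl (jac id (components φm φn) a b e) : MvPowerSeries (Coord m n ⊕ P) ℝ) =
      jac Sum.inl (fun p q => incl (components φm φn p q)) (incl a) (incl b) (incl e) := by
  have h2 : ∀ {a b}, IsBdd coordWt a → IsBdd coordWt b →
      (incl (br id (components φm φn) a b) : MvPowerSeries (Coord m n ⊕ P) ℝ) =
      br Sum.inl (fun p q => incl (components φm φn p q)) (incl a) (incl b) := fun ha hb =>
    incl_br isGrading_id isGrading_inl ha hb (isBdd_incl ha) (isBdd_incl hb)
  have hb2 := fun {a b} (ha : IsBdd coordWt a) (hb : IsBdd coordWt b) =>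
    (bddComponents_id φm φn).isBdd_br ha hb
  have hadd : ∀ a b : MvPowerSeries (Coord m n) ℝ,
      (incl (a + b) : MvPowerSeries (Coord m n ⊕ P) ℝ) = incl a + incl b := fun a b =>
    subst_add hasSubst_inl a b
  rw [jac, hadd, hadd, h2 (hb2 ha hb) he, h2 (hb2 he ha) hb, h2 (hb2 hb he) ha, h2 ha hb, h2 he ha,
    h2 hb he, jac]

/-- These monomials are the derivatives of the jet by its coordinates, so their summability is a
case of `IsGrading.summable_pderiv`. -/
theorem summable_pw_pt (i : Fin n) {K : ℕ} (r : Fin K) :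
    FormallySummable fun I : Fin m →₀ ℕ => pw (pt (Coord m n) r) I := by
  have h := isGrading_inl.summable_pderiv ⟨0, bdd_jet (m := m) r i⟩
  have hinj : Function.Injective fun I : Fin m →₀ ℕ => (i, I) := fun _ _ h => (Prod.mk.inj h).2
  intro d
  refine ((h d).preimage hinj.injOn).subset fun I hI => ?_
  change coeff d (pderiv ℝ (Sum.inl (i, I)) (jet m n r i)) ≠ 0
  rw [pderiv_jet, if_pos rfl, one_mul]
  exact hI

section Jets

variable {b e : MvPowerSeries (Vars m n 3) ℝ}

/-- The jet is linear in the coordinates $f^i_I$ with coefficients $u^I$, so the derivation property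
of the Jacobiator becomes an expansion in powers of the point. -/
theorem hasFSum_jac_jet (hm : φm.IsSkew) (hn : φn.IsSkew) (r : Fin 3) (i : Fin n)
    (hb : IsBdd varsWt b) (he : IsBdd varsWt e) :
    HasFSum (fun I => pw (pt (Coord m n) r) I *
      jac Sum.inl (fun p q => incl (components φm φn p q)) (X (Sum.inl (i, I))) b e)
      (jac Sum.inl (fun p q => incl (components φm φn p q)) (jet m n r i) b e) := by
  have h := isGrading_inl.hasFSum_jac (bddComponents_inl φm φn)
    (fun p q => by
      rw [components_skew hm hn, incl, ← substAlgHom_apply hasSubst_inl, map_neg,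
        substAlgHom_apply]; rfl) ⟨0, bdd_jet r i⟩ hb he
  refine (h.restrict (j := fun I => (i, I)) (fun _ _ h => (Prod.mk.inj h).2) fun p hp => ?_).congr
    fun I => ?_
  · rw [pderiv_jet, if_neg fun hi => hp ⟨p.2, Prod.ext hi.symm rfl⟩, zero_mul, zero_mul]
  · rw [pderiv_jet, if_pos rfl, one_mul]

end Jets

/-- The expansion of the Jacobiator of three jets. -/
theorem hasFSum_jac_jets (hm : φm.IsSkew) (hn : φn.IsSkew) (i j k : Fin n) :
    HasFSum (fun x : (Fin m →₀ ℕ) × (Fin m →₀ ℕ) × (Fin m →₀ ℕ) =>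
      incl (jac id (components φm φn) (X (i, x.1)) (X (j, x.2.1)) (X (k, x.2.2))) *
        (pw (pt (Coord m n) 0) x.1 * pw (pt (Coord m n) 1) x.2.1 * pw (pt (Coord m n) 2) x.2.2))
      (jac Sum.inl (fun p q => incl (components φm φn p q))
        (jet m n (0 : Fin 3) i) (jet m n 1 j) (jet m n 2 k)) := by
  have hJ : ∀ r i, IsBdd varsWt (jet m n (k := 3) r i) := fun r i => ⟨0, bdd_jet r i⟩
  have hX : ∀ p : Coord m n, IsBdd (varsWt (P := Fin 3 × Fin m)) (X (Sum.inl p)) := fun p =>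
    isBdd_X _
  have h0 := hasFSum_jac_jet hm hn 0 i (hJ 1 j) (hJ 2 k)
  have h1 := fun I => hasFSum_jac_jet hm hn 1 j (hJ 2 k) (hX (i, I))
  have h2 := fun I J => hasFSum_jac_jet hm hn 2 k (hX (i, I)) (hX (j, J))
  refine (HasFSum.iterate_three (summable_pw_pt i 0) (summable_pw_pt j 1) (summable_pw_pt k 2)
    h0 (fun I => ?_) (fun I J => h2 I J)).congr fun x => ?_
  · rw [jac_cyclic]
    refine (h1 I).congr fun J => ?_
    rw [← jac_cyclic]
  · rw [incl_jac φm φn (isBdd_X _) (isBdd_X _) (isBdd_X _), incl_X, incl_X, incl_X,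
      jac_cyclic _ _ (X (Sum.inl (k, x.2.2)))]
    ring

/-- The Jacobiators of the coordinates are the coefficients of $u^Iv^Jw^K$ in the Jacobiator of
three jets. -/
theorem jac_coords_eq_zero_iff (hm : φm.IsSkew) (hn : φn.IsSkew) :
    (∀ p q r : Coord m n, jac id (components φm φn) (X p) (X q) (X r) = 0) ↔
      ∀ i j k, PushForwardIdentity φm φn i j k := by
  simp only [← jacobiIdentity_iff hm hn]
  constructor
  · intro h i j k
    exact (hasFSum_jac_jets hm hn i j k).unique (hasFSum_zero.congr fun x => by
      rw [h, incl, ← substAlgHom_apply hasSubst_inl, map_zero, zero_mul])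
  · intro h p q r
    have h1 := hasFSum_jac_jets hm hn p.1 q.1 r.1
    have h0 : jac Sum.inl (fun p q => incl (components φm φn p q))
      (jet m n (0 : Fin 3) p.1) (jet m n 1 q.1) (jet m n 2 r.1) = 0 := h p.1 q.1 r.1
    rw [h0] at h1
    have := part_three (g := fun I J K => jac id (components φm φn) (X (p.1, I)) (X (q.1, J))
      (X (r.1, K))) h1 p.2 q.2 r.2
    rw [← this]
    rfl

theorem bracketTerm_id {C : Type} (ω : C → C → MvPowerSeries C ℝ) (a b : MvPowerSeries C ℝ) :
    bracketTerm id ω a b =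
      fun p : C × C => pderiv ℝ (id p.1) a * pderiv ℝ (id p.2) b * ω p.1 p.2 := by
  funext p
  rw [bracketTerm]
  congr 1
  exact congrFun subst_self _

theorem bracket_id {C : Type} (ω : C → C → MvPowerSeries C ℝ) (a b : MvPowerSeries C ℝ) :
    bracket id ω a b = br id ω a b := by
  rw [bracket, bracketTerm_id, br]

/-- Every axiom except Jacobi holds for any bracket with bounded skew components, and Jacobi only
needs testing on coordinates. -/
theorem isPoisson_iff (hm : φm.IsSkew) (hn : φn.IsSkew) :
    IsPoisson (components φm φn) ↔ ∀ i j k, PushForwardIdentity φm φn i j k := by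
  rw [← jac_coords_eq_zero_iff hm hn]
  have hG := isGrading_id (m := m) (n := n)
  have hB := bddComponents_id φm φn
  have hs := components_skew hm hn
  constructor
  · intro h p q r
    have hX : ∀ p : Coord m n, X p ∈ Functions m n := fun p => mem_functions_iff.2 (isBdd_X p)
    have := h.jacobi _ (hX p) _ (hX q) _ (hX r)
    simpa only [bracket_id, jac] using this
  · intro h
    constructor
    · intro a ha b hb
      rw [bracketTerm_id]
      exact (hG.hasFSum_br (mem_functions_iff.1 ha) (mem_functions_iff.1 hb) _).1
    all_goals simp only [bracket_id, mem_functions_iff]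
    · exact fun a ha b hb => hB.isBdd_br ha hb
    · exact fun a ha b hb c hc => hG.br_add_left ha hb hc
    · exact fun t a ha b hb => hG.br_smul_left t ha hb
    · exact fun a ha b hb => hG.br_skew hs ha hb
    · exact fun a ha b hb c hc => hG.br_mul_left ha hb hc
    · exact fun a ha b hb c hc => hG.jac_eq_zero hB hs h ha hb hc

theorem TwoTensor.IsCYBESolution.pushForwardIdentity (hm : φm.IsCYBESolution)
    (hn : φn.IsCYBESolution) (i j k : Fin n) : PushForwardIdentity φm φn i j k := by
  have h1 : HasSubst (fun p : Fin 3 × Fin n =>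
      (jet m n p.1 p.2 : MvPowerSeries (Vars m n 3) ℝ)) :=
    hasSubst_of_constantCoeff_nilpotent fun p => (hasSubst_jet p.1).const_coeff p.2
  have h2 : HasSubst (fun p : Fin 3 × Fin m =>
      (point m n p.1 p.2 : MvPowerSeries (Vars m n 3) ℝ)) :=
    hasSubst_of_constantCoeff_nilpotent fun p => (hasSubst_pt p.1).const_coeff p.2
  simp only [PushForwardIdentity, hm.2, hn.2, ← substAlgHom_apply h1, ← substAlgHom_apply h2,
    map_zero, mul_zero, Finset.sum_const_zero]

theorem isPoisson_of_isCYBESolution (hm : φm.IsCYBESolution) (hn : φn.IsCYBESolution) :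
    IsPoisson (components φm φn) :=
  (isPoisson_iff hm.1 hn.1).2 (hm.pushForwardIdentity hn)

end Poisson

/-! ### The equation of the left-right action at points -/

section Telescope

variable {A : Type*} [CommRing A]

theorem sum_bilinear {α β γ δ : Type*} [Fintype α] [Fintype β] [Fintype γ] [Fintype δ]
    (x : γ → A) (y : δ → A) (M : γ → α → A) (N : δ → β → A) (q : α → β → A) :
    ∑ μ, ∑ ν, (∑ σ, x σ * M σ μ) * (∑ ρ, y ρ * N ρ ν) * q μ ν =
      ∑ σ, ∑ ρ, x σ * y ρ * ∑ μ, ∑ ν, M σ μ * N ρ ν * q μ ν := by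
  let g : α × β → γ × δ → A := fun r p =>
    x p.1 * y p.2 * (M p.1 r.1 * N p.2 r.2 * q r.1 r.2)
  have h1 : ∑ μ, ∑ ν, (∑ σ, x σ * M σ μ) * (∑ ρ, y ρ * N ρ ν) * q μ ν = ∑ r, ∑ p, g r p := by
    rw [Fintype.sum_prod_type]
    refine Finset.sum_congr rfl fun μ _ => Finset.sum_congr rfl fun ν _ => ?_
    rw [Finset.sum_mul_sum, Fintype.sum_prod_type, Finset.sum_mul]
    refine Finset.sum_congr rfl fun σ _ => ?_
    rw [Finset.sum_mul]
    exact Finset.sum_congr rfl fun ρ _ => by ring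
  have h2 : ∑ σ, ∑ ρ, x σ * y ρ * ∑ μ, ∑ ν, M σ μ * N ρ ν * q μ ν = ∑ p, ∑ r, g r p := by
    rw [Fintype.sum_prod_type]
    refine Finset.sum_congr rfl fun σ _ => Finset.sum_congr rfl fun ρ _ => ?_
    rw [← Finset.mul_sum, Fintype.sum_prod_type]
  rw [h1, h2, Finset.sum_comm]

/-- The tensor `Π` of a composition of three maps. -/
theorem tensor_comp {α β : Type*} [Fintype α] [Fintype β] (Y Y' : β → A) (F F' : β → α → A)
    (M N q q' : α → α → A) (p : β → β → A) (pbar : A) :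
    (∑ μ, ∑ ν, (∑ k, Y k * ∑ σ, F k σ * M σ μ) * (∑ l, Y' l * ∑ ρ, F' l ρ * N ρ ν) * q μ ν) - pbar =
      (∑ k, ∑ l, Y k * Y' l * ((∑ σ, ∑ ρ, F k σ * F' l ρ * q' σ ρ) - p k l)) +
      (∑ k, ∑ l, ∑ σ, ∑ ρ, Y k * F k σ * (Y' l * F' l ρ) *
        ((∑ μ, ∑ ν, M σ μ * N ρ ν * q μ ν) - q' σ ρ)) +
      ((∑ k, ∑ l, Y k * Y' l * p k l) - pbar) := by
  -- After the Jacobian factors are pulled out, the sum telescopes: `q'` pushed forward by $Y_*F_*$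
  -- and `p` pushed forward by $Y_*$ each occur once with either sign on the right.
  rw [sum_bilinear]
  simp only [sum_bilinear]
  rw [← add_sub_assoc]
  congr 1
  simp only [← Finset.sum_add_distrib]
  refine Finset.sum_congr rfl fun k _ => Finset.sum_congr rfl fun l _ => ?_
  have h : ∀ σ ρ, Y k * F k σ * (Y' l * F' l ρ) * ((∑ μ, ∑ ν, M σ μ * N ρ ν * q μ ν) - q' σ ρ) =
      Y k * Y' l * (F k σ * F' l ρ * ∑ μ, ∑ ν, M σ μ * N ρ ν * q μ ν) -
        Y k * Y' l * (F k σ * F' l ρ * q' σ ρ) := fun σ ρ => by ring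
  simp only [h, Finset.sum_sub_distrib, ← Finset.mul_sum]
  ring

end Telescope

section ActionAtPoints

variable {l m n : ℕ} {T : Type} {R : Type*} [CommRing R]

theorem evalAt_evalAt {Y : Fin n → MvPowerSeries (Fin m) R} {G : Fin m → MvPowerSeries (Fin l) R}
    {a : Fin l → MvPowerSeries T R} (hG : HasSubst G) (ha : HasSubst a) :
    evalAt (evalAt Y G) a = evalAt Y (evalAt G a) :=
  funext fun i => subst_comp_subst_apply hG ha (Y i)

theorem derivAt_evalAt {Y : Fin n → MvPowerSeries (Fin m) R} {G : Fin m → MvPowerSeries (Fin l) R}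
    {a : Fin l → MvPowerSeries T R} (hG : HasSubst G) (ha : HasSubst a) (i : Fin n) (μ : Fin l) :
    derivAt (evalAt Y G) a i μ =
      ∑ k, derivAt Y (evalAt G a) i k * derivAt G a k μ := by
  rw [derivAt, evalAt, pderiv_subst hG, ← substAlgHom_apply ha, map_sum]
  refine Finset.sum_congr rfl fun k _ => ?_
  rw [substAlgHom_apply, subst_mul ha, subst_comp_subst_apply hG ha]
  rfl

theorem FormalMap.hasSubst (F : FormalMap m n R) : HasSubst F.toFun :=
  hasSubst_of_constantCoeff_nilpotent F.nilpotent

theorem hasSubst_evalAt {F : Fin n → MvPowerSeries (Fin m) R} (hF : HasSubst F)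
    {a : Fin m → MvPowerSeries T R} (ha : HasSubst a) : HasSubst (evalAt F a) :=
  hasSubst_of_constantCoeff_nilpotent fun i => IsNilpotent_subst ha (hF.const_coeff i)

/-- The chain rule factors the Jacobian of $Y\circ F\circ X^{-1}$ at each point, after which the
equation is the algebraic identity `tensor_comp`. -/
theorem actionEquation [Algebra ℝ R] (φm : TwoTensor m) (φn : TwoTensor n) :
    ActionEquation φm φn R := by
  intro Xd Y F i j
  have hX := Xd.invMap.hasSubst
  have hF := F.hasSubst
  have hFX := hasSubst_evalAt hF hX
  have hu : HasSubst (fun μ : Fin m => (X (Sum.inl μ) : MvPowerSeries (Fin m ⊕ Fin m) R)) :=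
    hasSubst_X_comp Sum.inl_injective
  have hv : HasSubst (fun μ : Fin m => (X (Sum.inr μ) : MvPowerSeries (Fin m ⊕ Fin m) R)) :=
    hasSubst_X_comp Sum.inr_injective
  simp only [tensorPiAt, evalAt_evalAt hFX hu, evalAt_evalAt hFX hv, evalAt_evalAt hX hu,
    evalAt_evalAt hX hv, derivAt_evalAt hFX hu, derivAt_evalAt hFX hv, derivAt_evalAt hX hu,
    derivAt_evalAt hX hv]
  exact tensor_comp _ _ _ _ _ _ _ _ _ _

end ActionAtPoints

/-! ### Product structures -/

section Products

variable {C D T : Type}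

theorem productComponents_skew {ω : C → C → MvPowerSeries C ℝ} {η : D → D → MvPowerSeries D ℝ}
    (hω : ∀ p q, ω p q = -ω q p) (hη : ∀ p q, η p q = -η q p) (p q : C ⊕ D) :
    productComponents ω η p q = -productComponents ω η q p := by
  rcases p with p | p <;> rcases q with q | q
  · rw [productComponents, productComponents, hω p q,
      ← substAlgHom_apply (hasSubst_X_comp Sum.inl_injective), map_neg,
      substAlgHom_apply]
  · exact neg_zero.symm
  · exact neg_zero.symm
  · rw [productComponents, productComponents, hη p q,
      ← substAlgHom_apply (hasSubst_X_comp Sum.inr_injective), map_neg,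
      substAlgHom_apply]

theorem IsGrading.of_sum {wt : T → ℤ} {c : C ⊕ D → T} (hc : Function.Injective c)
    (h : IsGrading wt fun p => c (Sum.inl p)) (h' : IsGrading wt fun p => c (Sum.inr p)) :
    IsGrading wt c := by
  refine ⟨hc, fun N => (((h.finite N).image Sum.inl).union
    ((h'.finite N).image Sum.inr)).subset ?_⟩
  rintro (p | p) hp
  exacts [Or.inl ⟨p, hp, rfl⟩, Or.inr ⟨p, hp, rfl⟩]

/-- The mixed components of a product structure vanish, so the sum over pairs splits into the pairs
from each factor, each extended by zero. -/
theorem IsGrading.br_product {wt : T → ℤ} {c : C ⊕ D → T} (hc : Function.Injective c)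
    (h : IsGrading wt fun p => c (Sum.inl p)) (h' : IsGrading wt fun p => c (Sum.inr p))
    {a b : MvPowerSeries T ℝ} (ha : IsBdd wt a) (hb : IsBdd wt b)
    (ω : C → C → MvPowerSeries C ℝ) (η : D → D → MvPowerSeries D ℝ) :
    br c (fun p q => subst (fun x => X (c x)) (productComponents ω η p q)) a b =
      br (fun p => c (Sum.inl p)) (fun p q => subst (fun x => X (c (Sum.inl x))) (ω p q)) a b +
      br (fun p => c (Sum.inr p)) (fun p q => subst (fun x => X (c (Sum.inr x))) (η p q)) a b := by
  have hz := hasSubst_X_comp (R := ℝ) hc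
  have h0 : subst (fun x => X (c x)) (0 : MvPowerSeries (C ⊕ D) ℝ) = (0 : MvPowerSeries T ℝ) := by
    rw [← substAlgHom_apply hz, map_zero]
  have h1 := (h.hasFSum_br ha hb fun p q => subst (fun x => X (c (Sum.inl x))) (ω p q)).extend
    (Sum.inl_injective.prodMap Sum.inl_injective) (t' := fun p : (C ⊕ D) × (C ⊕ D) => match p with
      | (Sum.inl p, Sum.inl q) => pderiv ℝ (c (Sum.inl p)) a * pderiv ℝ (c (Sum.inl q)) b *
          subst (fun x => X (c (Sum.inl x))) (ω p q)
      | _ => 0) (fun _ => rfl) (by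
        rintro ⟨p | p, q | q⟩ hp
        · exact absurd ⟨(p, q), rfl⟩ hp
        all_goals rfl)
  have h2 := (h'.hasFSum_br ha hb fun p q => subst (fun x => X (c (Sum.inr x))) (η p q)).extend
    (Sum.inr_injective.prodMap Sum.inr_injective) (t' := fun p : (C ⊕ D) × (C ⊕ D) => match p with
      | (Sum.inr p, Sum.inr q) => pderiv ℝ (c (Sum.inr p)) a * pderiv ℝ (c (Sum.inr q)) b *
          subst (fun x => X (c (Sum.inr x))) (η p q)
      | _ => 0) (fun _ => rfl) (by
        rintro ⟨p | p, q | q⟩ hp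
        pick_goal 4
        · exact absurd ⟨(p, q), rfl⟩ hp
        all_goals rfl)
  refine ((IsGrading.of_sum hc h h').hasFSum_br ha hb _).unique ((h1.add h2).congr ?_)
  rintro ⟨p | p, q | q⟩
  · simp only [productComponents]
    rw [add_zero, subst_comp_subst_apply (hasSubst_X_comp Sum.inl_injective) hz]
    simp only [subst_X hz]
  · simp only [productComponents, h0, mul_zero, add_zero]
  · simp only [productComponents, h0, mul_zero, add_zero]
  · simp only [productComponents]
    rw [zero_add, subst_comp_subst_apply (hasSubst_X_comp Sum.inr_injective) hz]
    simp only [subst_X hz]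

end Products

/-! ### The left-right action of generic maps -/

section Act

variable {m n : ℕ} {T T' : Type}

/-- `X⁻¹(a)` for the generic diffeomorphism `X⁻¹`. -/
def actX (c : ActionCoord m n → T) (a : Fin m → MvPowerSeries T ℝ) : Fin m → MvPowerSeries T ℝ :=
  ev (fun q => X (c (Sum.inl (Sum.inr q)))) a

/-- `F(X⁻¹(a))` for generic maps. -/
def actFX (c : ActionCoord m n → T) (a : Fin m → MvPowerSeries T ℝ) : Fin n → MvPowerSeries T ℝ :=
  ev (fun q => X (c (Sum.inr q))) (actX c a)

/-- `Y(F(X⁻¹(a)))` for generic maps. -/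
def act (c : ActionCoord m n → T) (a : Fin m → MvPowerSeries T ℝ) : Fin n → MvPowerSeries T ℝ :=
  ev (fun q => X (c (Sum.inl (Sum.inl q)))) (actFX c a)

/-- The derivative of `X⁻¹`. -/
def actDX (c : ActionCoord m n → T) (a : Fin m → MvPowerSeries T ℝ) (σ μ : Fin m) :
    MvPowerSeries T ℝ := dev (fun q => X (c (Sum.inl (Sum.inr q)))) a σ μ

/-- The derivative of `F` at `X⁻¹(a)`. -/
def actDF (c : ActionCoord m n → T) (a : Fin m → MvPowerSeries T ℝ) (k : Fin n) (σ : Fin m) :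
    MvPowerSeries T ℝ := dev (fun q => X (c (Sum.inr q))) (actX c a) k σ

/-- The derivative of `Y` at `F(X⁻¹(a))`. -/
def actDY (c : ActionCoord m n → T) (a : Fin m → MvPowerSeries T ℝ) (i k : Fin n) :
    MvPowerSeries T ℝ := dev (fun q => X (c (Sum.inl (Sum.inl q)))) (actFX c a) i k

variable {c : ActionCoord m n → T} {c' : ActionCoord m n → T'} {a b : Fin m → MvPowerSeries T ℝ}

theorem injective_coordX (hc : Function.Injective c) :
    Function.Injective fun q => c (Sum.inl (Sum.inr q)) :=
  hc.comp (Sum.inl_injective.comp Sum.inr_injective)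

theorem injective_coordF (hc : Function.Injective c) : Function.Injective fun q => c (Sum.inr q) :=
  hc.comp Sum.inr_injective

theorem injective_coordY (hc : Function.Injective c) :
    Function.Injective fun q => c (Sum.inl (Sum.inl q)) :=
  hc.comp (Sum.inl_injective.comp Sum.inl_injective)

theorem hasSubst_actX (hc : Function.Injective c) (ha : HasSubst a) : HasSubst (actX c a) :=
  hasSubst_ev (hasSubst_X_comp (injective_coordX hc)) ha

theorem hasSubst_actFX (hc : Function.Injective c) (ha : HasSubst a) : HasSubst (actFX c a) :=
  hasSubst_ev (hasSubst_X_comp (injective_coordF hc)) (hasSubst_actX hc ha)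

theorem subst_act {z : T → MvPowerSeries T' ℝ} (hz : HasSubst z) (hc : Function.Injective c)
    (h : ∀ p, z (c p) = X (c' p)) (ha : HasSubst a) (i : Fin n) :
    subst z (act c a i) = act c' (fun μ => subst z (a μ)) i := by
  have h1 : (fun σ => subst z (actX c a σ)) = actX c' fun μ => subst z (a μ) := funext fun σ => by
    rw [actX, subst_ev hz (hasSubst_X_comp (injective_coordX hc)) ha]
    simp only [subst_X hz, h]
    rfl
  have h2 : (fun k => subst z (actFX c a k)) = actFX c' fun μ => subst z (a μ) := funext fun k => by
    rw [actFX, subst_ev hz (hasSubst_X_comp (injective_coordF hc)) (hasSubst_actX hc ha), h1]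
    simp only [subst_X hz, h]
    rfl
  rw [act, subst_ev hz (hasSubst_X_comp (injective_coordY hc)) (hasSubst_actFX hc ha), h2]
  simp only [subst_X hz, h]
  rfl

/-- The chain rule for a variable which is not a coordinate. -/
theorem pderiv_act_of_ne (hc : Function.Injective c) (ha : HasSubst a) {t : T} (ht : ∀ p, c p ≠ t)
    (i : Fin n) :
    pderiv ℝ t (act c a i) =
      ∑ k, actDY c a i k * ∑ σ, actDF c a k σ * ∑ μ, actDX c a σ μ * pderiv ℝ t (a μ) := by
  rw [act, pderiv_ev_of_const (hasSubst_X_comp (injective_coordY hc)) (hasSubst_actFX hc ha) _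
    fun p => pderiv_X_of_ne (ht _)]
  refine Finset.sum_congr rfl fun k _ => ?_
  rw [actFX, pderiv_ev_of_const (hasSubst_X_comp (injective_coordF hc)) (hasSubst_actX hc ha) _
    fun p => pderiv_X_of_ne (ht _)]
  congr 1
  refine Finset.sum_congr rfl fun σ _ => ?_
  rw [actX, pderiv_ev_of_const (hasSubst_X_comp (injective_coordX hc)) ha _
    fun p => pderiv_X_of_ne (ht _)]
  rfl

theorem pderiv_actX_of_ne (hc : Function.Injective c) (ha : HasSubst a)
    {t : T} (ht : ∀ p, c (Sum.inl (Sum.inr p)) ≠ t) (h0 : ∀ μ, pderiv ℝ t (a μ) = 0) (σ : Fin m) :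
    pderiv ℝ t (actX c a σ) = 0 := by
  rw [actX, pderiv_ev_of_const (hasSubst_X_comp (injective_coordX hc)) ha _
    fun p => pderiv_X_of_ne (ht _)]
  exact Finset.sum_eq_zero fun μ _ => by rw [h0, mul_zero]

theorem pderiv_actFX_of_ne (hc : Function.Injective c) (ha : HasSubst a)
    {t : T} (ht : ∀ p, c (Sum.inr p) ≠ t) (h0 : ∀ σ, pderiv ℝ t (actX c a σ) = 0) (k : Fin n) :
    pderiv ℝ t (actFX c a k) = 0 := by
  rw [actFX, pderiv_ev_of_const (hasSubst_X_comp (injective_coordF hc)) (hasSubst_actX hc ha) _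
    fun p => pderiv_X_of_ne (ht _)]
  exact Finset.sum_eq_zero fun μ _ => by rw [h0, mul_zero]

/-- This and the next two lemmas bring the derivatives of $Y(F(X^{-1}(a)))$ by the coordinates of
$Y$, $F$ and $X^{-1}$ into the form "factor times monomial in a point" required by
`IsGrading.br_generic`. The point is $F(X^{-1}(a))$, $X^{-1}(a)$ and $a$ respectively. -/
theorem pderiv_act_coordY (hc : Function.Injective c) (ha : HasSubst a)
    (h0 : ∀ p μ, pderiv ℝ (c p) (a μ) = 0) (p : Coord n n) (i : Fin n) :
    pderiv ℝ (c (Sum.inl (Sum.inl p))) (act c a i) =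
      (if p.1 = i then 1 else 0) * pw (actFX c a) p.2 := by
  have h1 : ∀ k, pderiv ℝ (c (Sum.inl (Sum.inl p))) (actFX c a k) = 0 :=
    pderiv_actFX_of_ne hc ha (fun q hq => Sum.inr_ne_inl (hc hq))
      (pderiv_actX_of_ne hc ha (fun q hq => Sum.inr_ne_inl (Sum.inl_injective (hc hq))) (h0 _))
  rw [act, pderiv_ev_coord (injective_coordY hc) (hasSubst_actFX hc ha)]
  simp only [h1, mul_zero, Finset.sum_const_zero, add_zero, ite_mul, one_mul, zero_mul]

theorem pderiv_act_coordF (hc : Function.Injective c) (ha : HasSubst a)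
    (h0 : ∀ p μ, pderiv ℝ (c p) (a μ) = 0) (p : Coord m n) (i : Fin n) :
    pderiv ℝ (c (Sum.inr p)) (act c a i) = actDY c a i p.1 * pw (actX c a) p.2 := by
  have h1 : ∀ σ, pderiv ℝ (c (Sum.inr p)) (actX c a σ) = 0 :=
    pderiv_actX_of_ne hc ha (fun q hq => Sum.inl_ne_inr (hc hq)) (h0 _)
  rw [act, pderiv_ev_of_const (hasSubst_X_comp (injective_coordY hc)) (hasSubst_actFX hc ha) _
    fun q => pderiv_X_of_ne fun hq => Sum.inl_ne_inr (hc hq)]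
  simp only [actFX, pderiv_ev_coord (injective_coordF hc) (hasSubst_actX hc ha), h1, mul_zero,
    Finset.sum_const_zero, add_zero, mul_ite, Finset.sum_ite_eq, Finset.mem_univ, if_true]
  rfl

theorem pderiv_act_coordX (hc : Function.Injective c) (ha : HasSubst a)
    (h0 : ∀ p μ, pderiv ℝ (c p) (a μ) = 0) (p : Coord m m) (i : Fin n) :
    pderiv ℝ (c (Sum.inl (Sum.inr p))) (act c a i) =
      (∑ k, actDY c a i k * actDF c a k p.1) * pw a p.2 := by
  rw [act, pderiv_ev_of_const (hasSubst_X_comp (injective_coordY hc)) (hasSubst_actFX hc ha) _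
    fun q => pderiv_X_of_ne fun hq => Sum.inl_ne_inr (Sum.inl_injective (hc hq)), Finset.sum_mul]
  refine Finset.sum_congr rfl fun k _ => ?_
  rw [actFX, pderiv_ev_of_const (hasSubst_X_comp (injective_coordF hc)) (hasSubst_actX hc ha) _
    fun q => pderiv_X_of_ne fun hq => Sum.inr_ne_inl (hc hq), mul_assoc]
  simp only [actX, pderiv_ev_coord (injective_coordX hc) ha, h0, mul_zero,
    Finset.sum_const_zero, add_zero, mul_ite, Finset.sum_ite_eq, Finset.mem_univ, if_true]
  rfl

/-- The components of the product structure on the source of the action map. -/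
def actionComponents (φm : TwoTensor m) (φn : TwoTensor n) :
    ActionCoord m n → ActionCoord m n → MvPowerSeries (ActionCoord m n) ℝ :=
  productComponents (productComponents (components φn φn) (components φm φm)) (components φm φn)

/-- The three factors of the source contribute $\Omega_n$ at $Y$, the push-forward of $\Omega_m$ at
$X^{-1}$, and the push-forward of $\Pi$ at $F$. Read backwards, `tensor_comp` adds them up to the
tensor of the composite. -/
theorem br_act (φm : TwoTensor m) (φn : TwoTensor n) {wt : T → ℤ} (hc : Function.Injective c)
    (hY : IsGrading wt fun p => c (Sum.inl (Sum.inl p)))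
    (hX : IsGrading wt fun p => c (Sum.inl (Sum.inr p))) (hF : IsGrading wt fun p => c (Sum.inr p))
    (ha : HasSubst a) (hb : HasSubst b) (ha0 : ∀ p μ, pderiv ℝ (c p) (a μ) = 0)
    (hb0 : ∀ p μ, pderiv ℝ (c p) (b μ) = 0) {i j : Fin n} (hA : IsBdd wt (act c a i))
    (hB : IsBdd wt (act c b j)) :
    br c (fun p q => subst (fun x => X (c x)) (actionComponents φm φn p q))
        (act c a i) (act c b j) =
      (∑ μ, ∑ ν, (∑ k, actDY c a i k * ∑ σ, actDF c a k σ * actDX c a σ μ) *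
        (∑ l, actDY c b j l * ∑ ρ, actDF c b l ρ * actDX c b ρ ν) * φm.at μ ν a b) -
        φn.at i j (act c a) (act c b) := by
  have hc' : Function.Injective fun p => c (Sum.inl p) := hc.comp Sum.inl_injective
  have eY := hY.br_generic φn φn hA hB (hasSubst_actFX hc ha) (hasSubst_actFX hc hb)
    (fun p => pderiv_act_coordY hc ha ha0 p i) (fun p => pderiv_act_coordY hc hb hb0 p j)
    (M := fun k => if k = i then 1 else 0) (N := fun l => if l = j then 1 else 0)
  have eX := hX.br_generic φm φm hA hB ha hb
    (fun p => pderiv_act_coordX hc ha ha0 p i) (fun p => pderiv_act_coordX hc hb hb0 p j)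
    (M := fun σ => ∑ k, actDY c a i k * actDF c a k σ)
    (N := fun ρ => ∑ l, actDY c b j l * actDF c b l ρ)
  have eF := hF.br_generic φm φn hA hB (hasSubst_actX hc ha) (hasSubst_actX hc hb)
    (fun p => pderiv_act_coordF hc ha ha0 p i) (fun p => pderiv_act_coordF hc hb hb0 p j)
    (M := fun k => actDY c a i k) (N := fun l => actDY c b j l)
  simp only [mul_ite, ite_mul, one_mul, mul_one, mul_zero, zero_mul, Finset.sum_ite_eq',
    Finset.mem_univ, if_true] at eY
  rw [sum_bilinear] at eX
  rw [actionComponents, IsGrading.br_product hc (IsGrading.of_sum hc' hY hX) hF hA hB,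
    IsGrading.br_product hc' hY hX hA hB, eY, eX, eF,
    tensor_comp _ _ _ _ _ _ _ (fun σ ρ => φm.at σ ρ (actX c a) (actX c b))
      (fun k l => φn.at k l (actFX c a) (actFX c b))]
  refine ((show ∀ y x f : MvPowerSeries T ℝ, y + x + f = f + x + y from fun _ _ _ => by ring)
    _ _ _).trans (congrArg₂ _ (congrArg₂ _ rfl ?_) rfl)
  refine Finset.sum_congr rfl fun k _ => Finset.sum_congr rfl fun l _ => ?_
  simp only [Finset.mul_sum]
  refine Finset.sum_congr rfl fun σ _ => Finset.sum_congr rfl fun ρ _ => ?_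
  have h : evPi φm φm (fun q => X (c (Sum.inl (Sum.inr q)))) a b σ ρ =
    (∑ μ, ∑ ν, actDX c a σ μ * actDX c b ρ ν * φm.at μ ν a b) -
      φm.at σ ρ (actX c a) (actX c b) := rfl
  rw [h]
  ring

end Act

/-! ### The action map is Poisson -/

section ActionMap

variable {m n : ℕ} {T : Type}

/-- Weights of the coordinates on `FDiff(ℝⁿ) × FDiff(ℝ^m) × J^∞(ℝ^m, ℝⁿ)`, for which the
coefficients of the composition `Y ∘ F ∘ X⁻¹` have bounded weight. -/
def actionWt (ε s : ℤ) : ActionCoord m n → ℤ :=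
  Sum.elim (Sum.elim (fun p => ε * coordWt p + s) fun p => ε * coordWt p + -ε)
    fun p => ε * coordWt p + -ε

theorem bdd_act {wt : T → ℤ} {c : ActionCoord m n → T} {a : Fin m → MvPowerSeries T ℝ}
    (hc : Function.Injective c) (ha : HasSubst a) (ε s : ℤ) (h : ∀ p, wt (c p) = actionWt ε s p)
    (hab : ∀ μ, Bdd wt (-ε) (a μ)) (i : Fin n) : Bdd wt s (act c a i) := by
  have hX : ∀ p, Bdd wt (actionWt ε s p) (X (c p)) := fun p => by rw [← h]; exact bdd_X _
  have h1 : ∀ σ, Bdd wt (-ε) (actX c a σ) := bdd_ev_of_scaled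
    (hasSubst_X_comp (injective_coordX hc)) ha ε (fun p => hX (Sum.inl (Sum.inr p))) hab
  have h2 : ∀ k, Bdd wt (-ε) (actFX c a k) := bdd_ev_of_scaled
    (hasSubst_X_comp (injective_coordF hc)) (hasSubst_actX hc ha) ε
      (fun p => hX (Sum.inr p)) h1
  exact bdd_ev_of_scaled (hasSubst_X_comp (injective_coordY hc)) (hasSubst_actFX hc ha) ε
    (fun p => hX (Sum.inl (Sum.inl p))) h2 i

theorem actionMap_eq (p : Coord m n) :
    actionMap m n p = part p.2 (act Sum.inl (fun μ => X (Sum.inr μ)) p.1) := by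
  have hc : Function.Injective (Sum.inl : ActionCoord m n → ActionCoord m n ⊕ Fin m) :=
    Sum.inl_injective
  have ha : HasSubst fun μ : Fin m => (X (Sum.inr μ) : MvPowerSeries (ActionCoord m n ⊕ Fin m) ℝ) :=
    hasSubst_X_comp Sum.inr_injective
  have h1 := genericMap_eq_ev (injective_coordX hc) ha
  have h2 := genericMap_eq_ev (injective_coordF hc) (hasSubst_actX hc ha)
  have h3 := genericMap_eq_ev (injective_coordY hc) (hasSubst_actFX hc ha)
  change part p.2 (genericMap _ (genericMap _ (genericMap _ _)) p.1) = _
  rw [h1]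
  change part p.2 (genericMap _ (genericMap _ (actX _ _)) p.1) = _
  rw [h2]
  change part p.2 (genericMap _ (actFX _ _) p.1) = _
  rw [h3]
  rfl

/-- The composite has weight at most `s`, and extracting $u^I$, of weight $-\varepsilon|I|$, adds
$\varepsilon|I|$. -/
theorem bdd_actionMap (ε s : ℤ) (p : Coord m n) :
    Bdd (actionWt ε s) (s - ε * coordWt p * -1) (actionMap m n p) := by
  rw [actionMap_eq]
  intro d hd
  have := bdd_act (wt := Sum.elim (actionWt ε s) fun _ => -ε) Sum.inl_injective
    (hasSubst_X_comp Sum.inr_injective) ε s (fun _ => rfl) (fun μ => bdd_X (Sum.inr μ)) p.1 _ hd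
  rw [weight_sumElim] at this
  rw [coordWt]
  linarith

theorem hasSubst_actionMap : HasSubst (actionMap m n) := by
  refine ⟨fun p => ?_, fun d => ?_⟩
  · have h : constantCoeff (actionMap m n p) = 0 := by
      by_contra h
      -- With these weights the coordinates of $Y$ count $-1$ and all others $0$. Every monomial
      -- then has weight at most $-1$, which excludes the constant monomial.
      have := bdd_actionMap 0 (-1) p 0 h
      simp at this
    rw [h]
    exact IsNilpotent.zero
  · refine (isGrading_id.finite (-Finsupp.weight (actionWt (-1) 0) d)).subset fun p hp => ?_
    -- With the negative scale the bound is minus the degree of `p`, so a fixed monomial `d` occurs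
    -- only for `p` of bounded degree.
    have := bdd_actionMap (-1) 0 p d hp
    change coordWt p ≤ _
    linarith

theorem isGrading_actionWt {wt : T → ℤ} {c : ActionCoord m n → T} (hc : Function.Injective c)
    (h : ∀ p, wt (c p) = actionWt 1 0 p) :
    (IsGrading wt fun p => c (Sum.inl (Sum.inl p))) ∧
      (IsGrading wt fun p => c (Sum.inl (Sum.inr p))) ∧ IsGrading wt fun p => c (Sum.inr p) := by
  refine ⟨isGrading_of_coordWt (injective_coordY hc) 0 fun p => ?_,
    isGrading_of_coordWt (injective_coordX hc) (-1) fun p => ?_,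
    isGrading_of_coordWt (injective_coordF hc) (-1) fun p => ?_⟩
  all_goals rw [h]; simp [actionWt]

theorem isGrading_action {wt : T → ℤ} {c : ActionCoord m n → T} (hc : Function.Injective c)
    (h : ∀ p, wt (c p) = actionWt 1 0 p) : IsGrading wt c :=
  have hG := isGrading_actionWt hc h
  IsGrading.of_sum hc (IsGrading.of_sum (hc.comp Sum.inl_injective) hG.1 hG.2.1) hG.2.2

theorem hasSubst_incl_actionMap {P : Type} :
    HasSubst fun p => (incl (actionMap m n p) : MvPowerSeries (ActionCoord m n ⊕ P) ℝ) :=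
  hasSubst_subst hasSubst_actionMap hasSubst_inl

/-- The composition of the generic maps has the coefficients `actionMap m n`. -/
theorem act_pt (r : Fin 2) :
    act Sum.inl (pt (ActionCoord m n) r) =
      ev (fun p => incl (actionMap m n p)) (pt (ActionCoord m n) r) := by
  funext i
  let w : ActionCoord m n ⊕ Fin m → MvPowerSeries (ActionCoord m n ⊕ (Fin 2 × Fin m)) ℝ :=
    Sum.elim (fun p => X (Sum.inl p)) (pt (ActionCoord m n) r)
  have hw : HasSubst w := hasSubst_elim hasSubst_inl (hasSubst_pt r)
  have h := (hasFSum_part (act (Sum.inl : ActionCoord m n → ActionCoord m n ⊕ Fin m)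
    (fun μ => X (Sum.inr μ)) i)).subst hw
  rw [subst_act hw Sum.inl_injective (c' := Sum.inl) (fun _ => rfl)
    (hasSubst_X_comp Sum.inr_injective)] at h
  have hX : ∀ s, subst w (X s : MvPowerSeries _ ℝ) = w s := subst_X hw
  simp only [hX] at h
  refine h.unique ((hasFSum_ev hasSubst_incl_actionMap (hasSubst_pt r) i).congr fun I => ?_)
  rw [subst_mul hw, incl, subst_comp_subst_apply hasSubst_inl hw, actionMap_eq, incl]
  refine congrArg₂ _ ?_ ((subst_pw hw (fun μ => X (Sum.inr μ)) I).trans ?_)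
  · simp only [hX]
    rfl
  · simp only [hX]
    rfl

/-- Both sides are the derivative by the point of the same series, expanded once as a map with
coefficients `actionMap` and once as a composition of generic maps. -/
theorem dev_incl_actionMap (r : Fin 2) (i : Fin n) (μ : Fin m) :
    dev (fun p => incl (actionMap m n p)) (pt (ActionCoord m n) r) i μ =
      ∑ k, actDY Sum.inl (pt (ActionCoord m n) r) i k *
        ∑ σ, actDF Sum.inl (pt (ActionCoord m n) r) k σ *
          actDX Sum.inl (pt (ActionCoord m n) r) σ μ := by
  have h1 := pderiv_act_of_ne (c := (Sum.inl : ActionCoord m n → _)) Sum.inl_injective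
    (hasSubst_pt r) (t := Sum.inr (r, μ)) (fun _ => Sum.inl_ne_inr) i
  rw [act_pt, pderiv_ev_of_const hasSubst_incl_actionMap (hasSubst_pt r) _
    fun p => pderiv_incl_inr _ _] at h1
  simpa only [pderiv_pt, mul_ite, mul_one, mul_zero, Finset.sum_ite_eq', Finset.mem_univ,
    if_true] using h1

variable (φm : TwoTensor m) (φn : TwoTensor n)

/-- The bracket of the compositions at two points. -/
theorem br_act_pt (i j : Fin n) :
    br Sum.inl (fun p q => incl (actionComponents φm φn p q))
        (act Sum.inl (pt (ActionCoord m n) (0 : Fin 2)) i)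
        (act Sum.inl (pt (ActionCoord m n) 1) j) =
      evPi φm φn (fun p => incl (actionMap m n p)) (pt (ActionCoord m n) (0 : Fin 2))
        (pt (ActionCoord m n) 1) i j := by
  have hG := isGrading_actionWt (wt := Sum.elim (actionWt (m := m) (n := n) 1 0)
    fun _ : Fin 2 × Fin m => -1) Sum.inl_injective fun _ => rfl
  have hb := fun (r : Fin 2) => bdd_act (wt := Sum.elim (actionWt (m := m) (n := n) 1 0)
    fun _ : Fin 2 × Fin m => -1) Sum.inl_injective (hasSubst_pt r) 1 0 (fun _ => rfl)
    fun μ => bdd_X (Sum.inr (r, μ))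
  have h := br_act φm φn Sum.inl_injective hG.1 hG.2.1 hG.2.2 (hasSubst_pt (0 : Fin 2))
    (hasSubst_pt 1) (fun p μ => pderiv_X_of_ne Sum.inr_ne_inl)
    (fun p μ => pderiv_X_of_ne Sum.inr_ne_inl) (i := i) (j := j) ⟨0, hb 0 i⟩ ⟨0, hb 1 j⟩
  refine h.trans ?_
  simp only [evPi, dev_incl_actionMap, act_pt]

theorem isBdd_actionMap (p : Coord m n) : Bdd (actionWt 1 0) (coordWt p) (actionMap m n p) :=
  (bdd_actionMap 1 0 p).mono (by linarith)

/-- Coefficient extraction as an additive map. -/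
def partHom {C P : Type} (e : P →₀ ℕ) : MvPowerSeries (C ⊕ P) ℝ →+ MvPowerSeries C ℝ where
  toFun := part e
  map_zero' := rfl
  map_add' _ _ := rfl

theorem isLocal_partHom {C P : Type} (e : P →₀ ℕ) : IsLocal (partHom (C := C) e) := fun d =>
  ⟨{Finsupp.sumElim d e}, fun _ ha => ha _ (Finset.mem_singleton_self _)⟩

/-- This is the coefficient of $u^Iv^J$ in `br_act_pt`: the left side is expanded termwise in the
coordinates of the source, the right side by `hasFSum_evPi`. -/
theorem br_actionMap (p q : Coord m n) :
    br id (actionComponents φm φn) (actionMap m n p) (actionMap m n q) =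
      subst (actionMap m n) (components φm φn p q) := by
  obtain ⟨i, I⟩ := p
  obtain ⟨j, J⟩ := q
  let A : Fin 2 → Fin n → MvPowerSeries (ActionCoord m n ⊕ (Fin 2 × Fin m)) ℝ :=
    fun r => act Sum.inl (pt (ActionCoord m n) r)
  have hA : ∀ r i, HasFSum (fun I => incl (actionMap m n (i, I)) * pw (pt _ r) I) (A r i) :=
    fun r i => by
      simp only [A, act_pt]
      exact hasFSum_ev hasSubst_incl_actionMap (hasSubst_pt r) i
  have hd : ∀ r i (P : ActionCoord m n), HasFSum
      (fun I => incl (pderiv ℝ P (actionMap m n (i, I))) * pw (pt _ r) I)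
      (pderiv ℝ (Sum.inl P) (A r i)) := fun r i P =>
    ((hA r i).pderiv (Sum.inl P)).congr fun I => by
      rw [Derivation.leibniz, pderiv_incl_inl,
        pderiv_pw_eq_zero (a := pt _ r) fun μ => pderiv_X_of_ne Sum.inr_ne_inl, smul_zero, zero_add, smul_eq_mul,
        mul_comm]
  have hmul : ∀ f g : MvPowerSeries (ActionCoord m n) ℝ,
      (incl (f * g) : MvPowerSeries (ActionCoord m n ⊕ (Fin 2 × Fin m)) ℝ) = incl f * incl g :=
    fun f g => subst_mul hasSubst_inl f g
  have hpart : ∀ P Q : ActionCoord m n, part (exps m 2 ![I, J])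
      (pderiv ℝ (Sum.inl P) (A 0 i) * pderiv ℝ (Sum.inl Q) (A 1 j) *
        incl (actionComponents φm φn P Q)) =
      pderiv ℝ P (actionMap m n (i, I)) * pderiv ℝ Q (actionMap m n (j, J)) *
        actionComponents φm φn P Q := fun P Q => by
    refine part_two (g := fun I J => pderiv ℝ P (actionMap m n (i, I)) *
      pderiv ℝ Q (actionMap m n (j, J)) * actionComponents φm φn P Q) ?_ I J
    refine (((hd 0 i P).mul (hd 1 j Q)).mul_right _).congr fun x => ?_
    rw [hmul, hmul]
    ring
  have hG := isGrading_action (wt := Sum.elim (actionWt (m := m) (n := n) 1 0)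
    fun _ : Fin 2 × Fin m => -1) Sum.inl_injective fun _ => rfl
  have hb := fun (r : Fin 2) => bdd_act (wt := Sum.elim (actionWt (m := m) (n := n) 1 0)
    fun _ : Fin 2 × Fin m => -1) Sum.inl_injective (hasSubst_pt r) 1 0 (fun _ => rfl)
    fun μ => bdd_X (Sum.inr (r, μ))
  -- Coefficient extraction is local, so it may be applied to each term of the infinite sum defining
  -- the bracket.
  have h1 := (hG.hasFSum_br ⟨0, hb 0 i⟩ ⟨0, hb 1 j⟩
    fun p q => incl (actionComponents φm φn p q)).map (isLocal_partHom (exps m 2 ![I, J]))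
  rw [br_act_pt] at h1
  have h2 : part (exps m 2 ![I, J]) (evPi φm φn (fun p => incl (actionMap m n p))
      (pt (ActionCoord m n) (0 : Fin 2)) (pt (ActionCoord m n) 1) i j) =
      subst (actionMap m n) (components φm φn (i, I) (j, J)) := by
    refine part_two (g := fun I J => subst (actionMap m n) (components φm φn (i, I) (j, J)))
      ((hasFSum_evPi φm φn hasSubst_incl_actionMap (hasSubst_pt 0) (hasSubst_pt 1) i j).congr
        fun x => ?_) I J
    rw [incl, subst_comp_subst_apply hasSubst_actionMap hasSubst_inl]
    rfl
  refine ((isGrading_action Function.injective_id fun _ => rfl).hasFSum_br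
    ⟨_, isBdd_actionMap _⟩ ⟨_, isBdd_actionMap _⟩ _).unique (h2 ▸ h1.congr fun P => ?_)
  exact (hpart P.1 P.2).symm

/-- Degrees of coordinates are nonnegative, so a coordinate of degree larger than the weight bound
cannot occur in any monomial of `a`. -/
theorem exists_finset_pderiv_eq_zero {a : MvPowerSeries (Coord m n) ℝ} (ha : IsBdd coordWt a) :
    ∃ F : Finset (Coord m n), ∀ p ∉ F, pderiv ℝ p a = 0 := by
  obtain ⟨K, hK⟩ := ha
  refine ⟨(isGrading_id.finite K).toFinset, fun p hp => ?_⟩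
  have hp' : K < coordWt p := by
    by_contra h
    exact hp ((isGrading_id.finite K).mem_toFinset.2 (not_lt.1 h))
  ext d
  by_contra h
  have h1 := hK.pderiv p d h
  have h2 : 0 ≤ Finsupp.weight (coordWt (m := m) (n := n)) d := by
    rw [Finsupp.weight_apply]
    exact Finset.sum_nonneg fun q _ => by simp [coordWt]; positivity
  linarith

variable {φm φn}

theorem actionComponents_skew (hm : φm.IsSkew) (hn : φn.IsSkew) (p q : ActionCoord m n) :
    actionComponents φm φn p q = -actionComponents φm φn q p :=
  productComponents_skew
    (productComponents_skew (components_skew hn hn) (components_skew hm hm))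
    (components_skew hm hn) p q

/-- Functions involve finitely many coordinates, so the chain rule in both arguments is a finite sum
and the claim reduces to `br_actionMap`. -/
theorem isPoissonMap_actionMap (hm : φm.IsSkew) (hn : φn.IsSkew) :
    IsPoissonMap (actionComponents φm φn) (components φm φn) (actionMap m n) := by
  have hz := hasSubst_actionMap (m := m) (n := n)
  have hG := isGrading_action (m := m) (n := n) (wt := actionWt 1 0) Function.injective_id
    fun _ => rfl
  have hs := actionComponents_skew hm hn
  have hzb : ∀ p, IsBdd (actionWt 1 0) (actionMap m n p) := fun p => ⟨_, isBdd_actionMap p⟩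
  refine ⟨hz, fun a ha b hb => ?_⟩
  rw [mem_functions_iff] at ha hb
  have hsub : ∀ {a}, IsBdd coordWt a → IsBdd (actionWt 1 0) (subst (actionMap m n) a) :=
    fun ⟨K, hK⟩ => ⟨K, hK.subst hz isBdd_actionMap⟩
  rw [bracketTerm_id, bracket_id, bracket_id]
  refine ⟨(hG.hasFSum_br (hsub ha) (hsub hb) _).1, ?_⟩
  obtain ⟨F, hF⟩ := exists_finset_pderiv_eq_zero ha
  obtain ⟨G, hG'⟩ := exists_finset_pderiv_eq_zero hb
  rw [(isGrading_id.hasFSum_br ha hb _).eq_sum (F ×ˢ G) fun x hx => ?_, Finset.sum_product,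
    hG.br_subst_left_of_vars hz hzb F hF (hsub ha) (hsub hb), subst_finsetSum hz]
  · refine Finset.sum_congr rfl fun p _ => ?_
    -- The chain rule is available for the first argument of the bracket; skewness brings the second
    -- argument there and back.
    rw [hG.br_skew hs (hzb p) (hsub hb),
      hG.br_subst_left_of_vars hz hzb G hG' (hsub hb) (hzb p), subst_finsetSum hz,
      ← Finset.sum_neg_distrib, Finset.mul_sum]
    refine Finset.sum_congr rfl fun q _ => ?_
    rw [hG.br_skew hs (hzb q) (hzb p), br_actionMap, subst_mul hz, subst_mul hz]
    simp only [id]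
    ring
  · by_cases h1 : x.1 ∈ F
    · have h2 : x.2 ∉ G := fun h2 => hx (Finset.mem_product.2 ⟨h1, h2⟩)
      simp only [id, hG' _ h2, mul_zero, zero_mul]
    · simp only [id, hF _ h1, zero_mul]

end ActionMap

end JetPoisson

end

open JetPoisson in
theorem proposition5p3 (m n : ℕ) (φm : TwoTensor m) (φn : TwoTensor n)
    (hm : φm.IsSkew) (hn : φn.IsSkew) :
    BracketRepresentsPi φm φn ∧
    (∀ i j k : Fin n, JacobiIdentity φm φn i j k ↔ PushForwardIdentity φm φn i j k) ∧
    (IsPoisson (components φm φn) ↔ ∀ i j k : Fin n, PushForwardIdentity φm φn i j k) ∧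
    (φm.IsCYBESolution → φn.IsCYBESolution →
      IsPoisson (components φn φn) ∧ IsPoisson (components φm φm) ∧
      IsPoisson (components φm φn) ∧ IsPoissonAction.{u} φm φn) :=
  ⟨bracketRepresentsPi φm φn, fun i j k => jacobiIdentity_iff hm hn i j k, isPoisson_iff hm hn,
    fun h1 h2 => ⟨isPoisson_of_isCYBESolution h2 h2, isPoisson_of_isCYBESolution h1 h1,
      isPoisson_of_isCYBESolution h1 h2,
      isPoissonMap_actionMap hm hn, fun _ _ _ => actionEquation φm φn⟩⟩
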